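/- Let $n\ge 2$, let $(N^n,g_N)$ be a closed connected smooth Riemannian manifold, let $0<\bar r\le\infty$, and let $\lambda$ be a smooth positive function on $(0,\bar r)$. Let $\overline M^{n+1}$ be the warped product $[0,\bar r)\times_\lambda N$ with metric $\bar g=dr\otimes dr+\lambda(r)^2 g_N$ (which is defined on the part $r>0$), and suppose that $$\mathrm{Ric}_N\ \ge\ (n-1)\bigl(\lambda'(r)^2-\lambda(r)\lambda''(r)\bigr)\,g_N\qquad\text{for all } r\in(0,\bar r).$$ Let $X:M^n\to\overline M^{n+1}$ be a smooth immersion of a closed connected $n$-manifold $M$ with image in $(0,\bar r)\times N$, let $\nu$ be a smooth unit normal vector field along $X$, and let $H=\frac1n(\kappa_1+\dots+\kappa_n)$ be the normalized mean curvature, where $\kappa_1,\dots,\kappa_n$ are the eigenvalues of the shape operator $v\mapsto\bar\nabla_v\nu$ ($\bar\nabla$ is the Levi-Civita connection of $\bar g$). If $H>0$ everywhere ($M$ is mean convex) and, for some constant $\alpha>0$, $$H^{-\alpha}=\bar g(\lambda\,\partial_r,\nu)\qquad\text{on } M,$$ then $M$ is a slice: there is $r_0\in(0,\bar r)$ with $X(M)=\{r_0\}\times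 N$. -/

import Mathlib

open Set
open scoped Manifold ContDiff

noncomputable section

namespace WarpedProduct

/-! ### Metrics in coordinates on a finite-dimensional space `E`

`G y a b` is the value at the point `y` of the metric on the constant vectors `a`, `b`. -/

section Coordinates

variable {E : Type*} [NormedAddCommGroup E] [NormedSpace ℝ E]

/-- The Christoffel symbol `Γ(a, b)` at `y` of the metric `G`, that is, the Levi-Civita derivative of
the constant field `b` in the direction `a`. It is the vector with
`G(Γ(a, b), c) = (∂_a G(b, c) + ∂_b G(a, c) - ∂_c G(a, b)) / 2` for all `c`. -/
def christoffel (G : E → E →L[ℝ] E →L[ℝ] ℝ) (y a b : E) : E :=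
  (G y).inverse ((1 / 2 : ℝ) •
    (fderiv ℝ G y a b + fderiv ℝ G y b a - ((fderiv ℝ G y).flip a).flip b))

/-- The curvature tensor `R(a, b) c = ∇_a ∇_b c - ∇_b ∇_a c` on constant fields. -/
def curvature (G : E → E →L[ℝ] E →L[ℝ] ℝ) (y a b c : E) : E :=
  fderiv ℝ (fun z => christoffel G z b c) y a - fderiv ℝ (fun z => christoffel G z a c) y b
    + christoffel G y a (christoffel G y b c) - christoffel G y b (christoffel G y a c)

/-- The Ricci tensor `Ric(b, c)`, the trace of `a ↦ R(a, b) c`. -/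
def coordRicci {n : ℕ}
    (G : EuclideanSpace ℝ (Fin n) → EuclideanSpace ℝ (Fin n) →L[ℝ] EuclideanSpace ℝ (Fin n) →L[ℝ] ℝ)
    (y b c : EuclideanSpace ℝ (Fin n)) : ℝ :=
  ∑ i, curvature G y (EuclideanSpace.single i 1) b c i

end Coordinates

/-! ### Metrics on a manifold without boundary

The tangent space at `p` is, in Mathlib, the model space `E`, a tangent vector being represented by
its coordinates in the preferred chart `extChartAt I p` at `p`. A tensor at `p` is therefore given by
its components in this chart. -/

section Manifold

variable {E : Type*} [NormedAddCommGroup E] [NormedSpace ℝ E] {H : Type*} [TopologicalSpace H]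
  (I : ModelWithCorners ℝ E H) {B : Type*} [TopologicalSpace B] [ChartedSpace H B]

/-- The pull-back of the metric `G` on `B` to the vector space `F` by the linear map `A : F → T_p B`. -/
def pullbackForm {F : Type*} [NormedAddCommGroup F] [NormedSpace ℝ F] {p : B}
    (G : TangentSpace I p →L[ℝ] TangentSpace I p →L[ℝ] ℝ) (A : F →L[ℝ] TangentSpace I p) :
    F →L[ℝ] F →L[ℝ] ℝ :=
  ContinuousLinearMap.bilinearComp (E := E) (F := E) G A A

/-- The metric `G` in the coordinates of the chart at `p₀`: its pull-back by the inverse chart. -/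
def chartMetric (G : ∀ p : B, TangentSpace I p →L[ℝ] TangentSpace I p →L[ℝ] ℝ)
    (p₀ : B) (y : E) : E →L[ℝ] E →L[ℝ] ℝ :=
  pullbackForm I (G ((extChartAt I p₀).symm y)) (mfderiv 𝓘(ℝ, E) I (extChartAt I p₀).symm y)

variable {E' : Type*} [NormedAddCommGroup E'] [NormedSpace ℝ E'] {H' : Type*} [TopologicalSpace H']
  (J : ModelWithCorners ℝ E' H') {M : Type*} [TopologicalSpace M] [ChartedSpace H' M]

/-- The vector field `ν` along `X : M → B`, in the coordinates of the chart of `M` at `x₀` and of the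
chart of `B` at `X x₀`. -/
def chartField (X : M → B) (ν : ∀ x, TangentSpace I (X x)) (x₀ : M) (y : E') : E :=
  mfderiv I 𝓘(ℝ, E) (extChartAt I (X x₀)) (X ((extChartAt J x₀).symm y))
    (ν ((extChartAt J x₀).symm y))

/-- The covariant derivative `∇_v ν` at `x` of the vector field `ν` along `X : M → B`, for the
Levi-Civita connection of the metric `G` on `B`: in coordinates it is `∂_v ν + Γ(dX v, ν)`. -/
def covDerivAlong (G : ∀ p : B, TangentSpace I p →L[ℝ] TangentSpace I p →L[ℝ] ℝ)
    (X : M → B) (ν : ∀ x, TangentSpace I (X x)) (x : M) (v : E') : TangentSpace I (X x) :=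
  fderiv ℝ (chartField I J X ν x) (extChartAt J x x) v +
    christoffel (chartMetric I G (X x)) (extChartAt I (X x) (X x)) (mfderiv J I X x v) (ν x)

/-- The second fundamental form `h(v, ·) = G(∇_v ν, dX ·)` of the immersion `X : M → B` with unit
normal field `ν`; round spheres in Euclidean space have `h > 0` for the outward normal. -/
def secondForm (G : ∀ p : B, TangentSpace I p →L[ℝ] TangentSpace I p →L[ℝ] ℝ)
    (X : M → B) (ν : ∀ x, TangentSpace I (X x)) (x : M) (v : E') : E' →L[ℝ] ℝ :=
  (G (X x) (covDerivAlong I J G X ν x v)).comp (mfderiv J I X x)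

/-- The shape operator `W` at `x`: `h(v, w) = g(W v, w)`, where `g = X^* G` is the induced metric. -/
def shapeOperator (G : ∀ p : B, TangentSpace I p →L[ℝ] TangentSpace I p →L[ℝ] ℝ)
    (X : M → B) (ν : ∀ x, TangentSpace I (X x)) (x : M) (v : E') : E' :=
  (pullbackForm I (F := E') (G (X x)) (mfderiv J I X x)).inverse
    (secondForm I J G X ν x v)

end Manifold

/-- The Ricci tensor at `p` of a metric `G` on an `n`-manifold. -/
def ricci {n : ℕ} {N : Type*} [TopologicalSpace N] [ChartedSpace (EuclideanSpace ℝ (Fin n)) N]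
    (G : ∀ p : N, TangentSpace (𝓡 n) p →L[ℝ] TangentSpace (𝓡 n) p →L[ℝ] ℝ)
    (p : N) (v w : TangentSpace (𝓡 n) p) : ℝ :=
  coordRicci (chartMetric (𝓡 n) G p) (extChartAt (𝓡 n) p p) v w

/-- The normalized mean curvature `H = (κ₁ + ⋯ + κₙ) / n = (tr W) / n` at `x` of the immersion
`X : M → B` of an `n`-manifold with unit normal field `ν`, for the metric `G` on `B`. -/
def meanCurvature (n : ℕ) {E : Type*} [NormedAddCommGroup E] [NormedSpace ℝ E]
    {H : Type*} [TopologicalSpace H] (I : ModelWithCorners ℝ E H)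
    {B : Type*} [TopologicalSpace B] [ChartedSpace H B]
    {M : Type*} [TopologicalSpace M] [ChartedSpace (EuclideanSpace ℝ (Fin n)) M]
    (G : ∀ p : B, TangentSpace I p →L[ℝ] TangentSpace I p →L[ℝ] ℝ)
    (X : M → B) (ν : ∀ x, TangentSpace I (X x)) (x : M) : ℝ :=
  (∑ i, shapeOperator I (𝓡 n) G X ν x (EuclideanSpace.single i 1) i) / n

/-! ### Warped products -/

section Warped

variable {n : ℕ} {N : Type*} [TopologicalSpace N] [ChartedSpace (EuclideanSpace ℝ (Fin n)) N]

/-- The warped product metric `dr ⊗ dr + λ(r)² g` on `ℝ × N`; it is a Riemannian metric over the set of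
`r` where `λ` is smooth and positive. -/
def warpedMetric (lam : ℝ → ℝ)
    (g : ∀ p : N, TangentSpace (𝓡 n) p →L[ℝ] TangentSpace (𝓡 n) p →L[ℝ] ℝ) (q : ℝ × N) :
    TangentSpace (𝓘(ℝ, ℝ).prod (𝓡 n)) q →L[ℝ] TangentSpace (𝓘(ℝ, ℝ).prod (𝓡 n)) q →L[ℝ] ℝ :=
  pullbackForm 𝓘(ℝ, ℝ) (p := q.1) (ContinuousLinearMap.mul ℝ ℝ)
      (ContinuousLinearMap.fst ℝ ℝ (EuclideanSpace ℝ (Fin n))) +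
    lam q.1 ^ 2 • pullbackForm (𝓡 n) (g q.2)
      (ContinuousLinearMap.snd ℝ ℝ (EuclideanSpace ℝ (Fin n)))

/-- The conformal vector field `λ(r) ∂_r` on `ℝ × N`. -/
def radialField (lam : ℝ → ℝ) (q : ℝ × N) : TangentSpace (𝓘(ℝ, ℝ).prod (𝓡 n)) q :=
  ((lam q.1, 0) : ℝ × EuclideanSpace ℝ (Fin n))

end Warped

end WarpedProduct

end

/-!
The proof is an application of the strong maximum principle.

Put `p = 1 / α` and let `u = ⟨λ ∂_r, ν⟩` be the support function, so that the equation reads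
`H = u ^ (-p)` with `u > 0`. Let `P' = λ`. The function to consider is
`f = u ^ (p + 1) / (p + 1) - P(r)` on the hypersurface.

* The field `λ ∂_r` is the gradient of `P(r)` and its covariant derivative is `λ'` times the
  identity. Hence `Δ P(r) = n (λ' - H u)`, see `IsConformalAlong.lap_potential`.
* The Codazzi equation expresses `Δ u` through `H`, `|W|²`, `d H` and the Ricci curvature of the
  warped product in the directions of `ν` and of the tangential part of `λ ∂_r`
  (`IsConformalAlong.lap_support`). The assumption on `Ric_N` fixes the sign of the Ricci term, and
  `n |W|² ≥ (tr W)²`. This gives `Δ u ≤ n λ' H - n u H² + n d H(∇ P(r))` (`lap_support_le`).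
* Together, after the equation `H = u ^ (-p)` is used to write `d H` in terms of `d u`, one has
  `Δ f + ⟨b, ∇ f⟩ ≤ -(n - 1) p u ^ (p - 1) |∇ u|² ≤ 0` for the continuous field
  `b = -(n p / u) ∇ u` (`lap_add_drift_le`).

By the strong maximum principle (`eventually_eq_of_lap_nonpos`) the set where `f` attains its
minimum is open, so `f` is constant on the closed connected hypersurface. The inequality then gives
`∇ u = 0`, as `n ≥ 2`. Since `f` is constant, `P(r)` is locally constant too, and so is `r`, because
`λ > 0`. A hypersurface on which `r = r₀` is mapped to `N` by a local diffeomorphism, whose image is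
open and compact, hence all of `N`.

The geometry is carried out in coordinates, that is, for metrics on open subsets of vector spaces.
No coordinate invariance of the curvature is needed, and none of the mean curvature under changes of
the chart of the warped product: the mean curvature at a point is only computed in the chart of the
warped product centred at the image of this point (`IsWarpedHypersurface.traceShape_eq`), and its
values in this chart nearby are read off from `Δ P(r) = n (λ' - H u)`, whose left-hand side depends
only on the induced metric (`IsSelfSimilarOn.traceShape_eq`).
-/

open Filter
open scoped Topology

set_option maxSynthPendingDepth 3

noncomputable section

namespace WarpedProduct

/-! ### Riemannian metrics on open subsets of a vector space -/

section Metric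

variable {E : Type*} [NormedAddCommGroup E] [NormedSpace ℝ E]

/-- `G` restricts to a smooth Riemannian metric on the open set `V`. -/
structure IsMetricOn (G : E → E →L[ℝ] E →L[ℝ] ℝ) (V : Set E) : Prop where
  isOpen : IsOpen V
  contDiffOn : ContDiffOn ℝ ∞ G V
  symm : ∀ y ∈ V, ∀ a b, G y a b = G y b a
  pos : ∀ y ∈ V, ∀ a, a ≠ 0 → 0 < G y a a

/-- A positive definite form on a finite-dimensional space identifies it with its dual. -/
lemma isInvertible_of_pos [FiniteDimensional ℝ E] {B : E →L[ℝ] E →L[ℝ] ℝ}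
    (hB : ∀ a, a ≠ 0 → 0 < B a a) : B.IsInvertible := by
  have hinj : Function.Injective (B : E →ₗ[ℝ] E →L[ℝ] ℝ) := by
    rw [injective_iff_map_eq_zero]
    intro a ha
    by_contra h
    have := hB a h
    have h2 : B a = 0 := ha
    simp [h2] at this
  have hdim : Module.finrank ℝ E = Module.finrank ℝ (E →L[ℝ] ℝ) := by
    rw [← (LinearMap.toContinuousLinearMap (𝕜 := ℝ) (E := E) (F' := ℝ)).finrank_eq]
    exact (Subspace.dual_finrank_eq (K := ℝ) (V := E)).symm
  refine ⟨(LinearEquiv.ofInjectiveOfFinrankEq (B : E →ₗ[ℝ] E →L[ℝ] ℝ) hinj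
    hdim).toContinuousLinearEquiv, ?_⟩
  ext a b
  rfl

lemma apply_inverse_of_pos [FiniteDimensional ℝ E] {B : E →L[ℝ] E →L[ℝ] ℝ}
    (hB : ∀ a, a ≠ 0 → 0 < B a a) (ξ : E →L[ℝ] ℝ) : B (B.inverse ξ) = ξ := by
  obtain ⟨e, he⟩ := isInvertible_of_pos hB
  rw [← he]; simp

lemma inverse_apply_of_pos [FiniteDimensional ℝ E] {B : E →L[ℝ] E →L[ℝ] ℝ}
    (hB : ∀ a, a ≠ 0 → 0 < B a a) (a : E) : B.inverse (B a) = a := by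
  obtain ⟨e, he⟩ := isInvertible_of_pos hB
  rw [← he]; simp

lemma inverse_eq_of_pos [FiniteDimensional ℝ E] {B : E →L[ℝ] E →L[ℝ] ℝ}
    (hB : ∀ a, a ≠ 0 → 0 < B a a) {ξ : E →L[ℝ] ℝ} {a : E} (h : ∀ c, B a c = ξ c) :
    B.inverse ξ = a := by
  rw [← inverse_apply_of_pos hB a]
  congr 1
  ext c
  exact (h c).symm

lemma eq_of_form_eq {B : E →L[ℝ] E →L[ℝ] ℝ}
    (hB : ∀ a, a ≠ 0 → 0 < B a a) {a b : E} (h : ∀ c, B a c = B b c) : a = b := by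
  by_contra hne
  have := hB (a - b) (sub_ne_zero.2 hne)
  have h2 := h (a - b)
  simp only [map_sub, sub_apply] at this h2
  linarith

/-- The Christoffel symbol of `G` at `y` as a bounded bilinear map. -/
def christoffelL (G : E → E →L[ℝ] E →L[ℝ] ℝ) (y : E) : E →L[ℝ] E →L[ℝ] E :=
  (ContinuousLinearMap.compL ℝ E (E →L[ℝ] ℝ) E ((G y).inverse)).comp
    ((1 / 2 : ℝ) • (fderiv ℝ G y + (fderiv ℝ G y).flip
      - ((ContinuousLinearMap.flipₗᵢ ℝ E E ℝ : (E →L[ℝ] E →L[ℝ] ℝ) →L[ℝ] (E →L[ℝ] E →L[ℝ] ℝ)).comp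
          ((fderiv ℝ G y).flip))))

lemma christoffelL_apply (G : E → E →L[ℝ] E →L[ℝ] ℝ) (y a b : E) :
    christoffelL G y a b = christoffel G y a b := by
  simp only [christoffelL, christoffel]
  rfl

variable {G : E → E →L[ℝ] E →L[ℝ] ℝ} {V : Set E}

namespace IsMetricOn

lemma mem_nhds (h : IsMetricOn G V) {y : E} (hy : y ∈ V) : V ∈ 𝓝 y := h.isOpen.mem_nhds hy

lemma contDiffAt (h : IsMetricOn G V) {y : E} (hy : y ∈ V) : ContDiffAt ℝ ∞ G y :=
  h.contDiffOn.contDiffAt (h.mem_nhds hy)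

lemma differentiableAt (h : IsMetricOn G V) {y : E} (hy : y ∈ V) : DifferentiableAt ℝ G y :=
  (h.contDiffAt hy).differentiableAt (by simp)

lemma contDiffAt_fderiv (h : IsMetricOn G V) {y : E} (hy : y ∈ V) :
    ContDiffAt ℝ ∞ (fderiv ℝ G) y :=
  (h.contDiffAt hy).fderiv_right (by simp)

lemma fderiv_symm (h : IsMetricOn G V) {y : E} (hy : y ∈ V) (a b c : E) :
    fderiv ℝ G y a b c = fderiv ℝ G y a c b := by
  have key : ∀ b c : E, fderiv ℝ G y a b c = fderiv ℝ (fun z => G z b c) y a := by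
    intro b c
    have h1 := (h.differentiableAt hy).hasFDerivAt
    have h2 := (h1.clm_apply (hasFDerivAt_const b y)).clm_apply (hasFDerivAt_const c y)
    rw [h2.fderiv]; simp
  rw [key, key]
  have : (fun z => G z b c) =ᶠ[𝓝 y] fun z => G z c b := by
    filter_upwards [h.mem_nhds hy] with z hz using h.symm z hz b c
  rw [this.fderiv_eq]

variable [FiniteDimensional ℝ E]

/-- The Koszul formula. -/
lemma koszul (h : IsMetricOn G V) {y : E} (hy : y ∈ V) (a b c : E) :
    G y (christoffel G y a b) c =
      (1 / 2 : ℝ) * (fderiv ℝ G y a b c + fderiv ℝ G y b a c - fderiv ℝ G y c a b) := by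
  simp only [christoffel]
  rw [apply_inverse_of_pos (h.pos y hy)]
  simp

lemma christoffel_symm (h : IsMetricOn G V) {y : E} (hy : y ∈ V) (a b : E) :
    christoffel G y a b = christoffel G y b a := by
  apply eq_of_form_eq (h.pos y hy)
  intro c
  rw [h.koszul hy, h.koszul hy, h.fderiv_symm hy c a b]
  ring

/-- The Levi-Civita connection is metric. -/
lemma fderiv_apply (h : IsMetricOn G V) {y : E} (hy : y ∈ V) (a b c : E) :
    fderiv ℝ G y a b c = G y (christoffel G y a b) c + G y b (christoffel G y a c) := by
  rw [h.symm y hy b, h.koszul hy, h.koszul hy, h.fderiv_symm hy a c b, h.fderiv_symm hy c a b,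
    h.fderiv_symm hy b a c]
  ring

/-- The Koszul formula determines the Christoffel symbol: it is the only symmetric metric
connection. -/
lemma christoffel_unique (h : IsMetricOn G V) {y : E} (hy : y ∈ V) {C : E → E → E}
    (hsymm : ∀ a b, C a b = C b a)
    (hC : ∀ a b c, fderiv ℝ G y a b c = G y (C a b) c + G y b (C a c)) (a b : E) :
    christoffel G y a b = C a b := by
  apply eq_of_form_eq (h.pos y hy)
  intro c
  rw [h.koszul hy, hC, hC, hC, hsymm b a, hsymm c a, hsymm c b, h.symm y hy a (C b c),
    h.symm y hy b]
  ring

lemma contDiffAt_inverse (h : IsMetricOn G V) {y : E} (hy : y ∈ V) :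
    ContDiffAt ℝ ∞ (fun z => (G z).inverse) y :=
  (isInvertible_of_pos (h.pos y hy)).contDiffAt_map_inverse.comp y (h.contDiffAt hy)

lemma contDiffAt_christoffelL (h : IsMetricOn G V) {y : E} (hy : y ∈ V) :
    ContDiffAt ℝ ∞ (christoffelL G) y := by
  have h1 := h.contDiffAt_fderiv hy
  have h2 := h.contDiffAt_inverse hy
  unfold christoffelL
  have h3 : ContDiffAt ℝ ∞ (fun z => (fderiv ℝ G z).flip) y :=
    ((ContinuousLinearMap.flipₗᵢ ℝ E E (E →L[ℝ] ℝ)).contDiff.contDiffAt).comp y h1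
  refine ContDiffAt.clm_comp
    ((ContinuousLinearMap.compL ℝ E (E →L[ℝ] ℝ) E).contDiff.contDiffAt.comp y h2) ?_
  refine ContDiffAt.const_smul (1 / 2 : ℝ) ((h1.add h3).sub ?_)
  exact contDiffAt_const.clm_comp h3

lemma contDiffAt_christoffel (h : IsMetricOn G V) {y : E} (hy : y ∈ V) (a b : E) :
    ContDiffAt ℝ ∞ (fun z => christoffel G z a b) y := by
  simp_rw [← christoffelL_apply]
  exact ((h.contDiffAt_christoffelL hy).clm_apply contDiffAt_const).clm_apply contDiffAt_const

lemma curvature_eq (h : IsMetricOn G V) {y : E} (hy : y ∈ V) (a b c : E) :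
    curvature G y a b c = fderiv ℝ (christoffelL G) y a b c - fderiv ℝ (christoffelL G) y b a c
      + christoffelL G y a (christoffelL G y b c) - christoffelL G y b (christoffelL G y a c) := by
  have key : ∀ a b c : E, fderiv ℝ (fun z => christoffel G z b c) y a
      = fderiv ℝ (christoffelL G) y a b c := by
    intro a b c
    simp_rw [← christoffelL_apply]
    have h1 := ((h.contDiffAt_christoffelL hy).differentiableAt (by simp)).hasFDerivAt
    have h2 := (h1.clm_apply (hasFDerivAt_const b y)).clm_apply (hasFDerivAt_const c y)
    rw [h2.fderiv]; simp
  simp only [curvature, key, christoffelL_apply]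

end IsMetricOn

end Metric

/-! ### The covariant derivative along a map between vector spaces -/

section Along

lemma two_le_smoothness : minSmoothness ℝ 2 ≤ (∞ : WithTop ℕ∞) := by
  rw [minSmoothness_of_isRCLikeNormedField]
  exact WithTop.coe_le_coe.2 le_top

variable {E : Type*} [NormedAddCommGroup E] [NormedSpace ℝ E]
  {W : Type*} [NormedAddCommGroup W] [NormedSpace ℝ W]

/-- The covariant derivative `D_a ξ = ∂_a ξ + Γ(dF a, ξ)` at `y` of the field `ξ` along `F : E → W`
for the metric `G` on `W`, as a linear map in `a`. -/
def covD (G : W → W →L[ℝ] W →L[ℝ] ℝ) (F ξ : E → W) (y : E) : E →L[ℝ] W :=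
  fderiv ℝ ξ y + ((christoffelL G (F y)).flip (ξ y)).comp (fderiv ℝ F y)

lemma covD_apply (G : W → W →L[ℝ] W →L[ℝ] ℝ) (F ξ : E → W) (y a : E) :
    covD G F ξ y a = fderiv ℝ ξ y a + christoffelL G (F y) (fderiv ℝ F y a) (ξ y) := rfl

variable {G : W → W →L[ℝ] W →L[ℝ] ℝ} {V : Set W} {F : E → W} {y : E}

lemma covD_congr {ξ ζ : E → W} (h : ξ =ᶠ[𝓝 y] ζ) : covD G F ξ y = covD G F ζ y := by
  simp only [covD, h.fderiv_eq, h.eq_of_nhds]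

/-- The derivative of `z ↦ A z v` for a fixed vector `v`. -/
lemma fderiv_clm_apply_const {Z : Type*} [NormedAddCommGroup Z] [NormedSpace ℝ Z]
    {A : E → W →L[ℝ] Z} (hA : DifferentiableAt ℝ A y) (v : W) (a : E) :
    fderiv ℝ (fun z => A z v) y a = fderiv ℝ A y a v := by
  rw [(hA.hasFDerivAt.clm_apply (hasFDerivAt_const v y)).fderiv]; simp

variable [FiniteDimensional ℝ W]

lemma contDiffAt_covD (h : IsMetricOn G V) (hF : ContDiffAt ℝ ∞ F y) (hy : F y ∈ V) {ξ : E → W}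
    (hξ : ContDiffAt ℝ ∞ ξ y) : ContDiffAt ℝ ∞ (covD G F ξ) y := by
  have h1 : ContDiffAt ℝ ∞ (fun z => (christoffelL G (F z)).flip) y :=
    (ContinuousLinearMap.flipₗᵢ ℝ W W W).contDiff.contDiffAt.comp y
      ((h.contDiffAt_christoffelL hy).comp y hF)
  exact (hξ.fderiv_right (by simp)).add ((h1.clm_apply hξ).clm_comp (hF.fderiv_right (by simp)))

/-- The covariant derivative along a map is metric. -/
lemma fderiv_form (h : IsMetricOn G V) (hF : ContDiffAt ℝ ∞ F y) (hy : F y ∈ V) {ξ ζ : E → W}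
    (hξ : DifferentiableAt ℝ ξ y) (hζ : DifferentiableAt ℝ ζ y) (a : E) :
    fderiv ℝ (fun z => G (F z) (ξ z) (ζ z)) y a =
      G (F y) (covD G F ξ y a) (ζ y) + G (F y) (ξ y) (covD G F ζ y a) := by
  have h1 : HasFDerivAt (fun z => G (F z)) ((fderiv ℝ G (F y)).comp (fderiv ℝ F y)) y :=
    (h.differentiableAt hy).hasFDerivAt.comp y (hF.differentiableAt (by simp)).hasFDerivAt
  rw [((h1.clm_apply hξ.hasFDerivAt).clm_apply hζ.hasFDerivAt).fderiv]
  simp only [covD_apply, christoffelL_apply, map_add, add_apply,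
    ContinuousLinearMap.coe_comp, Function.comp_apply, ContinuousLinearMap.flip_apply,
    h.fderiv_apply hy]
  ring

/-- The Levi-Civita connection has no torsion. -/
lemma covD_fderiv_symm (h : IsMetricOn G V) (hF : ContDiffAt ℝ ∞ F y) (hy : F y ∈ V) (a b : E) :
    covD G F (fun z => fderiv ℝ F z b) y a = covD G F (fun z => fderiv ℝ F z a) y b := by
  have hd : DifferentiableAt ℝ (fderiv ℝ F) y :=
    (hF.fderiv_right (m := ∞) (by simp)).differentiableAt (by simp)
  have hs : IsSymmSndFDerivAt ℝ F y := hF.isSymmSndFDerivAt two_le_smoothness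
  simp only [covD_apply, fderiv_clm_apply_const hd, christoffelL_apply]
  rw [h.christoffel_symm hy, hs a b]

/-- The curvature tensor is the commutator of covariant derivatives along a map. -/
lemma covD_covD_sub (h : IsMetricOn G V) (hF : ContDiffAt ℝ ∞ F y) (hy : F y ∈ V) {ξ : E → W}
    (hξ : ContDiffAt ℝ ∞ ξ y) (a b : E) :
    covD G F (fun z => covD G F ξ z b) y a - covD G F (fun z => covD G F ξ z a) y b =
      curvature G (F y) (fderiv ℝ F y a) (fderiv ℝ F y b) (ξ y) := by
  have hd : DifferentiableAt ℝ (fderiv ℝ F) y :=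
    (hF.fderiv_right (m := ∞) (by simp)).differentiableAt (by simp)
  have hd' : DifferentiableAt ℝ (fderiv ℝ ξ) y :=
    (hξ.fderiv_right (m := ∞) (by simp)).differentiableAt (by simp)
  have hs : IsSymmSndFDerivAt ℝ F y := hF.isSymmSndFDerivAt two_le_smoothness
  have hs' : IsSymmSndFDerivAt ℝ ξ y := hξ.isSymmSndFDerivAt two_le_smoothness
  have hΓ : HasFDerivAt (fun z => christoffelL G (F z))
      ((fderiv ℝ (christoffelL G) (F y)).comp (fderiv ℝ F y)) y :=
    ((h.contDiffAt_christoffelL hy).differentiableAt (by simp)).hasFDerivAt.comp y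
      (hF.differentiableAt (by simp)).hasFDerivAt
  have key : ∀ a b : E, fderiv ℝ (fun z => covD G F ξ z b) y a =
      fderiv ℝ (fderiv ℝ ξ) y a b
      + (fderiv ℝ (christoffelL G) (F y) (fderiv ℝ F y a) (fderiv ℝ F y b) (ξ y)
        + christoffelL G (F y) (fderiv ℝ (fderiv ℝ F) y a b) (ξ y)
        + christoffelL G (F y) (fderiv ℝ F y b) (fderiv ℝ ξ y a)) := by
    intro a b
    simp only [covD_apply]
    have h1 := (hd'.hasFDerivAt.clm_apply (hasFDerivAt_const b y)).add
      ((hΓ.clm_apply (hd.hasFDerivAt.clm_apply (hasFDerivAt_const b y))).clm_apply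
        (hξ.differentiableAt (by simp)).hasFDerivAt)
    have h2 := h1.fderiv
    refine (DFunLike.congr_fun h2 a).trans ?_
    simp
    abel
  rw [covD_apply G F (fun z => covD G F ξ z b), covD_apply G F (fun z => covD G F ξ z a), key, key,
    h.curvature_eq hy, hs a b, hs' a b]
  simp only [covD_apply, map_add]
  abel

end Along

/-! ### Hessian and Laplacian -/

section Laplacian

variable {E : Type*} [NormedAddCommGroup E] [NormedSpace ℝ E]

/-- The covariant Hessian `∂_a ∂_b f - df(Γ(a, b))` of the function `f` for the metric `g`. -/
def hess (g : E → E →L[ℝ] E →L[ℝ] ℝ) (f : E → ℝ) (y : E) : E →L[ℝ] E →L[ℝ] ℝ :=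
  fderiv ℝ (fderiv ℝ f) y
    - (ContinuousLinearMap.compL ℝ E E ℝ (fderiv ℝ f y)).comp (christoffelL g y)

lemma hess_apply (g : E → E →L[ℝ] E →L[ℝ] ℝ) (f : E → ℝ) (y a b : E) :
    hess g f y a b = fderiv ℝ (fderiv ℝ f) y a b - fderiv ℝ f y (christoffelL g y a b) := rfl

/-- The trace of the bilinear form `B` with respect to the metric form `g`. -/
def traceForm (g B : E →L[ℝ] E →L[ℝ] ℝ) : ℝ :=
  LinearMap.trace ℝ E ((g.inverse.comp B : E →L[ℝ] E) : E →ₗ[ℝ] E)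

/-- The Laplacian of the function `f` for the metric `g`. -/
def lap (g : E → E →L[ℝ] E →L[ℝ] ℝ) (f : E → ℝ) (y : E) : ℝ := traceForm (g y) (hess g f y)

lemma traceForm_add (g B C : E →L[ℝ] E →L[ℝ] ℝ) :
    traceForm g (B + C) = traceForm g B + traceForm g C := by
  simp [traceForm, ContinuousLinearMap.comp_add]

lemma traceForm_smul (g B : E →L[ℝ] E →L[ℝ] ℝ) (c : ℝ) :
    traceForm g (c • B) = c * traceForm g B := by
  simp [traceForm]

/-- A bilinear form given by an endomorphism `S` through `g` has trace `tr S`. -/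
lemma traceForm_eq_trace [FiniteDimensional ℝ E] {g B : E →L[ℝ] E →L[ℝ] ℝ}
    (hg : ∀ a, a ≠ 0 → 0 < g a a) {S : E →ₗ[ℝ] E} (h : ∀ a b, B a b = g (S a) b) :
    traceForm g B = LinearMap.trace ℝ E S := by
  unfold traceForm
  congr 1
  ext a
  exact inverse_eq_of_pos hg fun c => (h a c).symm

end Laplacian

/-! ### Hypersurfaces in coordinates -/

section Hypersurface

variable {E : Type*} [NormedAddCommGroup E] [NormedSpace ℝ E]
  {W : Type*} [NormedAddCommGroup W] [NormedSpace ℝ W]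

/-- The map `F : E → W` is, on the open set `U`, an immersed hypersurface with unit normal field `η`
for the metric `G` on the open subset `V` of `W`. -/
structure IsHypersurface (G : W → W →L[ℝ] W →L[ℝ] ℝ) (V : Set W) (F η : E → W) (U : Set E) :
    Prop where
  metric : IsMetricOn G V
  isOpen : IsOpen U
  mapsTo : MapsTo F U V
  contDiffOn : ContDiffOn ℝ ∞ F U
  contDiffOn_normal : ContDiffOn ℝ ∞ η U
  injective : ∀ y ∈ U, Function.Injective (fderiv ℝ F y)
  unit : ∀ y ∈ U, G (F y) (η y) (η y) = 1
  normal : ∀ y ∈ U, ∀ a, G (F y) (η y) (fderiv ℝ F y a) = 0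
  finrank_eq : Module.finrank ℝ W = Module.finrank ℝ E + 1

/-- The induced metric `F^* G`. -/
def inducedMetric (G : W → W →L[ℝ] W →L[ℝ] ℝ) (F : E → W) (y : E) : E →L[ℝ] E →L[ℝ] ℝ :=
  (G (F y)).bilinearComp (fderiv ℝ F y) (fderiv ℝ F y)

lemma inducedMetric_apply (G : W → W →L[ℝ] W →L[ℝ] ℝ) (F : E → W) (y a b : E) :
    inducedMetric G F y a b = G (F y) (fderiv ℝ F y a) (fderiv ℝ F y b) := rfl

/-- The coordinates of the tangential part of a vector at `F y`: the vector `t` with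
`G(v, dF a) = G(dF t, dF a)` for all `a`. -/
def tanProj (G : W → W →L[ℝ] W →L[ℝ] ℝ) (F : E → W) (y : E) : W →L[ℝ] E :=
  (inducedMetric G F y).inverse.comp (((G (F y)).flip.comp (fderiv ℝ F y)).flip)

/-- The shape operator `a ↦ D_a η` of the hypersurface `F` with unit normal field `η`, as an
endomorphism of the coordinate space. -/
def shape (G : W → W →L[ℝ] W →L[ℝ] ℝ) (F η : E → W) (y : E) : E →L[ℝ] E :=
  (tanProj G F y).comp (covD G F η y)

/-- The covariant derivative `(∇_a W) b` of the shape operator `W`. -/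
def nablaShape (G : W → W →L[ℝ] W →L[ℝ] ℝ) (F η : E → W) (y a : E) : E →L[ℝ] E :=
  fderiv ℝ (shape G F η) y a
    + (christoffelL (inducedMetric G F) y a).comp (shape G F η y)
    - (shape G F η y).comp (christoffelL (inducedMetric G F) y a)

lemma nablaShape_apply (G : W → W →L[ℝ] W →L[ℝ] ℝ) (F η : E → W) (y a b : E) :
    nablaShape G F η y a b = fderiv ℝ (shape G F η) y a b
      + christoffelL (inducedMetric G F) y a (shape G F η y b)
      - shape G F η y (christoffelL (inducedMetric G F) y a b) := rfl

variable {G : W → W →L[ℝ] W →L[ℝ] ℝ} {V : Set W} {F η : E → W} {U : Set E}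

namespace IsHypersurface

lemma mem_nhds (h : IsHypersurface G V F η U) {y : E} (hy : y ∈ U) : U ∈ 𝓝 y :=
  h.isOpen.mem_nhds hy

lemma contDiffAt (h : IsHypersurface G V F η U) {y : E} (hy : y ∈ U) : ContDiffAt ℝ ∞ F y :=
  h.contDiffOn.contDiffAt (h.mem_nhds hy)

lemma contDiffAt_fderiv (h : IsHypersurface G V F η U) {y : E} (hy : y ∈ U) :
    ContDiffAt ℝ ∞ (fderiv ℝ F) y :=
  (h.contDiffAt hy).fderiv_right (by simp)

lemma differentiableAt_fderiv (h : IsHypersurface G V F η U) {y : E} (hy : y ∈ U) :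
    DifferentiableAt ℝ (fderiv ℝ F) y :=
  (h.contDiffAt_fderiv hy).differentiableAt (by simp)

lemma contDiffAt_fderiv_apply (h : IsHypersurface G V F η U) {y : E} (hy : y ∈ U) (a : E) :
    ContDiffAt ℝ ∞ (fun z => fderiv ℝ F z a) y :=
  (h.contDiffAt_fderiv hy).clm_apply contDiffAt_const

lemma differentiableAt_fderiv_apply (h : IsHypersurface G V F η U) {y : E} (hy : y ∈ U) (a : E) :
    DifferentiableAt ℝ (fun z => fderiv ℝ F z a) y :=
  (h.contDiffAt_fderiv_apply hy a).differentiableAt (by simp)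

lemma contDiffAt_normal (h : IsHypersurface G V F η U) {y : E} (hy : y ∈ U) :
    ContDiffAt ℝ ∞ η y :=
  h.contDiffOn_normal.contDiffAt (h.mem_nhds hy)

lemma differentiableAt_normal (h : IsHypersurface G V F η U) {y : E} (hy : y ∈ U) :
    DifferentiableAt ℝ η y :=
  (h.contDiffAt_normal hy).differentiableAt (by simp)

lemma contDiffAt_metric (h : IsHypersurface G V F η U) {y : E} (hy : y ∈ U) :
    ContDiffAt ℝ ∞ (fun z => G (F z)) y :=
  (h.metric.contDiffAt (h.mapsTo hy)).comp y (h.contDiffAt hy)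

lemma pos (h : IsHypersurface G V F η U) {y : E} (hy : y ∈ U) (a : E) (ha : a ≠ 0) :
    0 < inducedMetric G F y a a := by
  refine h.metric.pos _ (h.mapsTo hy) _ fun h0 => ha ?_
  exact h.injective y hy (by simpa using h0)

lemma isMetricOn (h : IsHypersurface G V F η U) : IsMetricOn (inducedMetric G F) U where
  isOpen := h.isOpen
  contDiffOn := by
    intro y hy
    apply ContDiffAt.contDiffWithinAt
    have h1 := h.contDiffAt_fderiv hy
    have h2 : ContDiffAt ℝ ∞ (fun z => ((G (F z)).comp (fderiv ℝ F z)).flip) y :=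
      (ContinuousLinearMap.flipₗᵢ ℝ E W ℝ).contDiff.contDiffAt.comp y
        ((h.contDiffAt_metric hy).clm_comp h1)
    exact (ContinuousLinearMap.flipₗᵢ ℝ E E ℝ).contDiff.contDiffAt.comp y (h2.clm_comp h1)
  symm y hy a b := h.metric.symm _ (h.mapsTo hy) _ _
  pos y hy a ha := h.pos hy a ha

variable [FiniteDimensional ℝ E]

lemma inducedMetric_tanProj (h : IsHypersurface G V F η U) {y : E} (hy : y ∈ U) (v : W) (a : E) :
    inducedMetric G F y (tanProj G F y v) a = G (F y) v (fderiv ℝ F y a) := by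
  simp only [tanProj, ContinuousLinearMap.comp_apply]
  rw [apply_inverse_of_pos (h.pos hy)]
  rfl

lemma tanProj_fderiv (h : IsHypersurface G V F η U) {y : E} (hy : y ∈ U) (a : E) :
    tanProj G F y (fderiv ℝ F y a) = a := by
  apply eq_of_form_eq (h.pos hy)
  intro c
  rw [h.inducedMetric_tanProj hy]; rfl

lemma tanProj_normal (h : IsHypersurface G V F η U) {y : E} (hy : y ∈ U) :
    tanProj G F y (η y) = 0 := by
  apply eq_of_form_eq (h.pos hy)
  intro c
  rw [h.inducedMetric_tanProj hy, h.normal y hy]; simp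

variable [FiniteDimensional ℝ W]

/-- In codimension one every vector is the sum of its tangential and normal parts. -/
lemma decomp (h : IsHypersurface G V F η U) {y : E} (hy : y ∈ U) (v : W) :
    v = fderiv ℝ F y (tanProj G F y v) + G (F y) v (η y) • η y := by
  have hV := h.mapsTo hy
  let L : E × ℝ →ₗ[ℝ] W := (fderiv ℝ F y : E →ₗ[ℝ] W).coprod (LinearMap.toSpanSingleton ℝ W (η y))
  have hL : ∀ p : E × ℝ, L p = fderiv ℝ F y p.1 + p.2 • η y := fun p => by simp [L]
  have hinj : Function.Injective L := by
    rw [injective_iff_map_eq_zero]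
    rintro ⟨a, t⟩ h0
    rw [hL] at h0
    have h1 : G (F y) (η y) (fderiv ℝ F y a + t • η y) = 0 := by simp only at h0; rw [h0]; simp
    simp only [map_add, map_smul, h.normal y hy, h.unit y hy, smul_eq_mul] at h1
    have ht : t = 0 := by linarith
    subst ht
    have : fderiv ℝ F y a = fderiv ℝ F y 0 := by simpa using h0
    rw [h.injective y hy this]; rfl
  have hsurj : Function.Surjective L :=
    (LinearMap.injective_iff_surjective_of_finrank_eq_finrank
      (by rw [h.finrank_eq]; simp)).1 hinj
  obtain ⟨⟨a, t⟩, hat⟩ := hsurj v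
  rw [hL] at hat
  simp only at hat
  have e1 : tanProj G F y v = a := by
    apply eq_of_form_eq (h.pos hy)
    intro c
    rw [h.inducedMetric_tanProj hy, ← hat]
    simp [h.normal y hy, inducedMetric_apply]
  have e2 : G (F y) v (η y) = t := by
    rw [← hat]
    simp [h.metric.symm _ hV _ (η y), h.normal y hy, h.unit y hy]
  rw [e1, e2, hat]

/-- Trace of an ambient endomorphism over the tangent space of the hypersurface. -/
lemma trace_tanProj (h : IsHypersurface G V F η U) {y : E} (hy : y ∈ U) (Q : W →ₗ[ℝ] W) :
    LinearMap.trace ℝ E ((tanProj G F y : W →ₗ[ℝ] E) ∘ₗ Q ∘ₗ (fderiv ℝ F y : E →ₗ[ℝ] W)) =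
      LinearMap.trace ℝ W Q - G (F y) (Q (η y)) (η y) := by
  have hQ : Q = (fderiv ℝ F y : E →ₗ[ℝ] W) ∘ₗ ((tanProj G F y : W →ₗ[ℝ] E) ∘ₗ Q)
      + LinearMap.smulRight (((G (F y)).flip (η y) : W →ₗ[ℝ] ℝ) ∘ₗ Q) (η y) := by
    ext v
    exact h.decomp hy (Q v)
  conv_rhs => enter [1]; rw [hQ]
  rw [map_add, LinearMap.trace_smulRight, ← LinearMap.comp_assoc, LinearMap.trace_comp_comm'
    (fderiv ℝ F y : E →ₗ[ℝ] W)]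
  simp

lemma contDiffAt_shape (h : IsHypersurface G V F η U) {y : E} (hy : y ∈ U) :
    ContDiffAt ℝ ∞ (shape G F η) y := by
  have h1 := h.contDiffAt_fderiv hy
  have h2 : ContDiffAt ℝ ∞ (fun z => (G (F z)).flip) y :=
    (ContinuousLinearMap.flipₗᵢ ℝ W W ℝ).contDiff.contDiffAt.comp y (h.contDiffAt_metric hy)
  have h3 : ContDiffAt ℝ ∞ (fun z => ((G (F z)).flip.comp (fderiv ℝ F z)).flip) y :=
    (ContinuousLinearMap.flipₗᵢ ℝ E W ℝ).contDiff.contDiffAt.comp y (h2.clm_comp h1)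
  exact ((h.isMetricOn.contDiffAt_inverse hy).clm_comp h3).clm_comp
    (contDiffAt_covD h.metric (h.contDiffAt hy) (h.mapsTo hy) (h.contDiffAt_normal hy))

/-- The derivative of the unit normal field is tangential. -/
lemma covD_normal (h : IsHypersurface G V F η U) {y : E} (hy : y ∈ U) (a : E) :
    covD G F η y a = fderiv ℝ F y (shape G F η y a) := by
  have h1 := fderiv_form h.metric (h.contDiffAt hy) (h.mapsTo hy) (h.differentiableAt_normal hy)
    (h.differentiableAt_normal hy) a
  have h2 : (fun z => G (F z) (η z) (η z)) =ᶠ[𝓝 y] fun _ => 1 := by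
    filter_upwards [h.mem_nhds hy] with z hz using h.unit z hz
  rw [h2.fderiv_eq, h.metric.symm _ (h.mapsTo hy) (η y)] at h1
  have h3 : G (F y) (covD G F η y a) (η y) = 0 := by
    simp at h1; linarith
  have h4 := h.decomp hy (covD G F η y a)
  rw [h3, zero_smul, add_zero] at h4
  exact h4

lemma form_covD_normal (h : IsHypersurface G V F η U) {y : E} (hy : y ∈ U) (a b : E) :
    G (F y) (covD G F η y a) (fderiv ℝ F y b) = inducedMetric G F y (shape G F η y a) b := by
  rw [h.covD_normal hy]; rfl

lemma normal_covD_fderiv (h : IsHypersurface G V F η U) {y : E} (hy : y ∈ U) (a b : E) :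
    G (F y) (η y) (covD G F (fun z => fderiv ℝ F z b) y a) =
      - inducedMetric G F y (shape G F η y a) b := by
  have h1 := fderiv_form h.metric (h.contDiffAt hy) (h.mapsTo hy) (h.differentiableAt_normal hy)
    (h.differentiableAt_fderiv_apply hy b) a
  have h2 : (fun z => G (F z) (η z) (fderiv ℝ F z b)) =ᶠ[𝓝 y] fun _ => 0 := by
    filter_upwards [h.mem_nhds hy] with z hz using h.normal z hz b
  rw [h2.fderiv_eq, h.form_covD_normal hy] at h1
  simp at h1
  linarith

/-- The shape operator is self-adjoint. -/
lemma shape_symm (h : IsHypersurface G V F η U) {y : E} (hy : y ∈ U) (a b : E) :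
    inducedMetric G F y (shape G F η y a) b = inducedMetric G F y a (shape G F η y b) := by
  have h1 := h.normal_covD_fderiv hy a b
  rw [covD_fderiv_symm h.metric (h.contDiffAt hy) (h.mapsTo hy), h.normal_covD_fderiv hy] at h1
  rw [h.isMetricOn.symm y hy a]
  linarith

/-- The Gauss formula. The tangential part of `D_a dF b` is a symmetric metric connection, hence the
Levi-Civita connection of the induced metric. -/
lemma gauss (h : IsHypersurface G V F η U) {y : E} (hy : y ∈ U) (a b : E) :
    covD G F (fun z => fderiv ℝ F z b) y a =
      fderiv ℝ F y (christoffelL (inducedMetric G F) y a b)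
        - inducedMetric G F y (shape G F η y a) b • η y := by
  have hV := h.mapsTo hy
  have key : christoffelL (inducedMetric G F) y a b =
      tanProj G F y (covD G F (fun z => fderiv ℝ F z b) y a) := by
    rw [christoffelL_apply]
    refine h.isMetricOn.christoffel_unique hy
      (C := fun a b => tanProj G F y (covD G F (fun z => fderiv ℝ F z b) y a)) ?_ ?_ a b
    · intro a b
      simp only [covD_fderiv_symm h.metric (h.contDiffAt hy) hV a b]
    · intro a b c
      rw [h.inducedMetric_tanProj hy, h.isMetricOn.symm y hy b, h.inducedMetric_tanProj hy,
        h.metric.symm _ hV _ (fderiv ℝ F y b)]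
      rw [← fderiv_form h.metric (h.contDiffAt hy) hV (h.differentiableAt_fderiv_apply hy b)
        (h.differentiableAt_fderiv_apply hy c) a]
      have hg := h.isMetricOn.differentiableAt hy
      have h2 := (hg.hasFDerivAt.clm_apply (hasFDerivAt_const b y)).clm_apply
        (hasFDerivAt_const c y)
      change _ = fderiv ℝ (fun z => inducedMetric G F z b c) y a
      rw [h2.fderiv]; simp
  have h1 := h.decomp hy (covD G F (fun z => fderiv ℝ F z b) y a)
  rw [← key, h.metric.symm _ hV _ (η y), h.normal_covD_fderiv hy] at h1
  rw [h1, neg_smul, sub_eq_add_neg]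

/-- The covariant derivative of the shape operator is self-adjoint. -/
lemma nablaShape_symm (h : IsHypersurface G V F η U) {y : E} (hy : y ∈ U) (a b c : E) :
    inducedMetric G F y (nablaShape G F η y a b) c =
      inducedMetric G F y b (nablaShape G F η y a c) := by
  have hg := (h.isMetricOn.differentiableAt hy).hasFDerivAt
  have hS := ((h.contDiffAt_shape hy).differentiableAt (by simp)).hasFDerivAt
  have hconst : ∀ v : E, HasFDerivAt (fun _ : E => v) (0 : E →L[ℝ] E) y :=
    fun v => hasFDerivAt_const v y
  have h1 := (hg.clm_apply (hS.clm_apply (hconst b))).clm_apply (hconst c)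
  have h2 := (hg.clm_apply (hconst b)).clm_apply (hS.clm_apply (hconst c))
  have h3 : (fun z => inducedMetric G F z (shape G F η z b) c) =ᶠ[𝓝 y]
      fun z => inducedMetric G F z b (shape G F η z c) := by
    filter_upwards [h.mem_nhds hy] with z hz using h.shape_symm hz b c
  have h4 := h3.fderiv_eq (𝕜 := ℝ)
  rw [h1.fderiv, h2.fderiv] at h4
  have h5 := DFunLike.congr_fun h4 a
  simp [h.isMetricOn.fderiv_apply hy, ← christoffelL_apply] at h5
  simp only [nablaShape_apply, map_add, map_sub, add_apply, sub_apply]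
  have h6 := h.shape_symm hy (christoffelL (inducedMetric G F) y a b) c
  have h7 := h.shape_symm hy b (christoffelL (inducedMetric G F) y a c)
  linarith

/-- The Codazzi equation, the tangential part of the commutator of second covariant derivatives of
`η`. -/
lemma codazzi (h : IsHypersurface G V F η U) {y : E} (hy : y ∈ U) (a b : E) :
    nablaShape G F η y a b - nablaShape G F η y b a =
      tanProj G F y (curvature G (F y) (fderiv ℝ F y a) (fderiv ℝ F y b) (η y)) := by
  have hV := h.mapsTo hy
  have hS := ((h.contDiffAt_shape hy).differentiableAt (by simp)).hasFDerivAt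
  -- differentiate `D_b η = dF (W b)` and split the result by the Gauss formula
  have key : ∀ a b : E, covD G F (fun z => covD G F η z b) y a =
      fderiv ℝ F y (fderiv ℝ (shape G F η) y a b
        + christoffelL (inducedMetric G F) y a (shape G F η y b))
        - inducedMetric G F y (shape G F η y a) (shape G F η y b) • η y := by
    intro a b
    have h1 : (fun z => covD G F η z b) =ᶠ[𝓝 y] fun z => fderiv ℝ F z (shape G F η z b) := by
      filter_upwards [h.mem_nhds hy] with z hz using h.covD_normal hz b
    rw [covD_congr h1, map_add, add_sub_assoc, ← h.gauss hy, covD_apply, covD_apply]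
    have h2 := (h.differentiableAt_fderiv hy).hasFDerivAt.clm_apply
      (hS.clm_apply (hasFDerivAt_const b y))
    have h3 := (h.differentiableAt_fderiv hy).hasFDerivAt.clm_apply
      (hasFDerivAt_const (shape G F η y b) y)
    rw [h2.fderiv, h3.fderiv]
    simp
    abel
  rw [← covD_covD_sub h.metric (h.contDiffAt hy) hV (h.contDiffAt_normal hy), key, key]
  simp only [map_sub, h.tanProj_fderiv hy, map_smul, h.tanProj_normal hy, nablaShape_apply,
    christoffelL_apply, h.isMetricOn.christoffel_symm hy a b]
  simp

end IsHypersurface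

end Hypersurface

/-! ### The support function of a hypersurface with respect to a closed conformal field -/

section Support

variable {E : Type*} [NormedAddCommGroup E] [NormedSpace ℝ E]
  {W : Type*} [NormedAddCommGroup W] [NormedSpace ℝ W]

/-- The field `Y` along `F` satisfies `D_a Y = κ dF a`, and `Φ` is a potential of its tangential
part. This holds for the restriction to a hypersurface of a closed conformal vector field. -/
structure IsConformalAlong (G : W → W →L[ℝ] W →L[ℝ] ℝ) (F Y : E → W) (κ Φ : E → ℝ) (U : Set E) :
    Prop where
  contDiffAt : ∀ y ∈ U, ContDiffAt ℝ ∞ Y y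
  covD_eq : ∀ y ∈ U, ∀ a, covD G F Y y a = κ y • fderiv ℝ F y a
  contDiffAt_potential : ∀ y ∈ U, ContDiffAt ℝ ∞ Φ y
  fderiv_potential : ∀ y ∈ U, ∀ a, fderiv ℝ Φ y a = G (F y) (Y y) (fderiv ℝ F y a)

/-- The trace of the shape operator. -/
def traceShape (G : W → W →L[ℝ] W →L[ℝ] ℝ) (F η : E → W) (y : E) : ℝ :=
  LinearMap.trace ℝ E (shape G F η y : E →ₗ[ℝ] E)

variable {G : W → W →L[ℝ] W →L[ℝ] ℝ} {V : Set W} {F η Y : E → W} {U : Set E} {κ Φ : E → ℝ} {y : E}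

namespace IsConformalAlong

lemma differentiableAt_field (hY : IsConformalAlong G F Y κ Φ U) (hy : y ∈ U) :
    DifferentiableAt ℝ Y y := (hY.contDiffAt y hy).differentiableAt (by simp)

lemma differentiableAt_fderiv_potential (hY : IsConformalAlong G F Y κ Φ U) (hy : y ∈ U) :
    DifferentiableAt ℝ (fderiv ℝ Φ) y :=
  ((hY.contDiffAt_potential y hy).fderiv_right (m := ∞) (by simp)).differentiableAt (by simp)

lemma contDiffAt_support (hY : IsConformalAlong G F Y κ Φ U) (h : IsHypersurface G V F η U)
    (hy : y ∈ U) : ContDiffAt ℝ ∞ (fun z => G (F z) (Y z) (η z)) y :=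
  ((h.contDiffAt_metric hy).clm_apply (hY.contDiffAt y hy)).clm_apply (h.contDiffAt_normal hy)

variable [FiniteDimensional ℝ E] [FiniteDimensional ℝ W]

lemma hess_potential (hY : IsConformalAlong G F Y κ Φ U) (h : IsHypersurface G V F η U)
    (hy : y ∈ U) (a b : E) :
    hess (inducedMetric G F) Φ y a b = κ y * inducedMetric G F y a b
      - G (F y) (Y y) (η y) * inducedMetric G F y (shape G F η y a) b := by
  have h1 : (fun z => fderiv ℝ Φ z b) =ᶠ[𝓝 y] fun z => G (F z) (Y z) (fderiv ℝ F z b) := by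
    filter_upwards [h.mem_nhds hy] with z hz using hY.fderiv_potential z hz b
  rw [hess_apply, ← fderiv_clm_apply_const (hY.differentiableAt_fderiv_potential hy), h1.fderiv_eq,
    fderiv_form h.metric (h.contDiffAt hy) (h.mapsTo hy) (hY.differentiableAt_field hy)
      (h.differentiableAt_fderiv_apply hy b), hY.covD_eq y hy, h.gauss hy,
    hY.fderiv_potential y hy]
  simp [inducedMetric_apply]
  ring

/-- As `D_a Y` is tangential, the support function changes only through the rotation of the normal:
`du(a) = dΦ(W a)`. -/
lemma fderiv_support (hY : IsConformalAlong G F Y κ Φ U) (h : IsHypersurface G V F η U)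
    (hy : y ∈ U) (a : E) :
    fderiv ℝ (fun z => G (F z) (Y z) (η z)) y a = fderiv ℝ Φ y (shape G F η y a) := by
  rw [fderiv_form h.metric (h.contDiffAt hy) (h.mapsTo hy) (hY.differentiableAt_field hy)
    (h.differentiableAt_normal hy), hY.covD_eq y hy, h.covD_normal hy, hY.fderiv_potential y hy,
    h.metric.symm _ (h.mapsTo hy) _ (η y)]
  simp [h.normal y hy]

lemma hess_support (hY : IsConformalAlong G F Y κ Φ U) (h : IsHypersurface G V F η U)
    (hy : y ∈ U) (a b : E) :
    hess (inducedMetric G F) (fun z => G (F z) (Y z) (η z)) y a b =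
      hess (inducedMetric G F) Φ y a (shape G F η y b)
        + fderiv ℝ Φ y (nablaShape G F η y a b) := by
  have hS := ((h.contDiffAt_shape hy).differentiableAt (by simp)).hasFDerivAt
  have hu : DifferentiableAt ℝ (fderiv ℝ (fun z => G (F z) (Y z) (η z))) y :=
    ((hY.contDiffAt_support h hy).fderiv_right (m := ∞) (by simp)).differentiableAt (by simp)
  have h1 : (fun z => fderiv ℝ (fun z => G (F z) (Y z) (η z)) z b) =ᶠ[𝓝 y]
      fun z => fderiv ℝ Φ z (shape G F η z b) := by
    filter_upwards [h.mem_nhds hy] with z hz using hY.fderiv_support h hz b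
  have h2 := (hY.differentiableAt_fderiv_potential hy).hasFDerivAt.clm_apply
    (hS.clm_apply (hasFDerivAt_const b y))
  rw [hess_apply, ← fderiv_clm_apply_const hu, h1.fderiv_eq, h2.fderiv, hY.fderiv_support h hy,
    hess_apply, nablaShape_apply]
  simp
  ring

/-- The Laplacian of the potential. -/
lemma lap_potential (hY : IsConformalAlong G F Y κ Φ U) (h : IsHypersurface G V F η U)
    (hy : y ∈ U) :
    lap (inducedMetric G F) Φ y = κ y * Module.finrank ℝ E
      - G (F y) (Y y) (η y) * traceShape G F η y := by
  unfold lap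
  rw [traceForm_eq_trace (h.pos hy)
    (S := κ y • LinearMap.id - G (F y) (Y y) (η y) • (shape G F η y : E →ₗ[ℝ] E))]
  · simp [traceShape]
  · intro a b
    rw [hY.hess_potential h hy]
    simp

lemma trace_nablaShape (h : IsHypersurface G V F η U) (hy : y ∈ U) (a : E) :
    LinearMap.trace ℝ E (nablaShape G F η y a : E →ₗ[ℝ] E) = fderiv ℝ (traceShape G F η) y a := by
  have hS := ((h.contDiffAt_shape hy).differentiableAt (by simp)).hasFDerivAt
  let T : (E →L[ℝ] E) →L[ℝ] ℝ := LinearMap.toContinuousLinearMap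
    (LinearMap.trace ℝ E ∘ₗ ContinuousLinearMap.coeLM ℝ)
  have h1 : fderiv ℝ (traceShape G F η) y = T.comp (fderiv ℝ (shape G F η) y) :=
    (T.hasFDerivAt.comp y hS).fderiv
  rw [h1]
  simp only [nablaShape, ContinuousLinearMap.toLinearMap_sub, ContinuousLinearMap.toLinearMap_add,
    map_add, map_sub, ContinuousLinearMap.toLinearMap_comp,
    LinearMap.trace_comp_comm' (shape G F η y : E →ₗ[ℝ] E)]
  simp [T]

/-- The Laplacian of the support function, where `Q` is the endomorphism `A ↦ R(A, Yᵀ) η`. The last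
term is the Ricci curvature `Ric(Yᵀ, η)`, as the trace of `Q` over the tangent space. -/
lemma lap_support (hY : IsConformalAlong G F Y κ Φ U) (h : IsHypersurface G V F η U)
    (hy : y ∈ U) {Q : W →ₗ[ℝ] W}
    (hQ : ∀ A, Q A = curvature G (F y) A (fderiv ℝ F y (tanProj G F y (Y y))) (η y)) :
    lap (inducedMetric G F) (fun z => G (F z) (Y z) (η z)) y = κ y * traceShape G F η y
      - G (F y) (Y y) (η y) *
          LinearMap.trace ℝ E ((shape G F η y : E →ₗ[ℝ] E) * (shape G F η y : E →ₗ[ℝ] E))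
      + fderiv ℝ (traceShape G F η) y (tanProj G F y (Y y))
      + (LinearMap.trace ℝ W Q - G (F y) (Q (η y)) (η y)) := by
  set T := tanProj G F y (Y y) with hT
  unfold lap
  rw [traceForm_eq_trace (h.pos hy)
    (S := κ y • (shape G F η y : E →ₗ[ℝ] E)
      - G (F y) (Y y) (η y) • ((shape G F η y : E →ₗ[ℝ] E) * (shape G F η y : E →ₗ[ℝ] E))
      + (nablaShape G F η y T : E →ₗ[ℝ] E)
      + (tanProj G F y : W →ₗ[ℝ] E) ∘ₗ Q ∘ₗ (fderiv ℝ F y : E →ₗ[ℝ] W))]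
  · rw [map_add, map_add, map_sub, map_smul, map_smul, h.trace_tanProj hy, trace_nablaShape h hy]
    rfl
  · -- by Codazzi and the symmetry of `∇W`, `dΦ((∇_a W) b) = ⟨(∇_T W) a + R(a, T) η, b⟩`
    intro a b
    have hdΦ : ∀ v, fderiv ℝ Φ y v = inducedMetric G F y T v := fun v => by
      rw [hY.fderiv_potential y hy, hT, h.inducedMetric_tanProj hy]
    have hc := h.codazzi hy a T
    rw [← hQ, sub_eq_iff_eq_add'] at hc
    rw [hY.hess_support h hy, hY.hess_potential h hy, hdΦ, ← h.nablaShape_symm hy, hc,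
      ← h.shape_symm hy a b, ← h.shape_symm hy (shape G F η y a) b]
    simp
    ring

end IsConformalAlong

end Support

/-! ### Traces with respect to a positive definite form -/

section Trace

/-- A positive definite symmetric form has an orthonormal basis. -/
lemma exists_basis_repr_eq_form {V : Type*} [AddCommGroup V] [Module ℝ V] [FiniteDimensional ℝ V]
    {g : V →ₗ[ℝ] V →ₗ[ℝ] ℝ} (hs : ∀ a b, g a b = g b a) (hg : ∀ a, a ≠ 0 → 0 < g a a) :
    ∃ e : Module.Basis (Fin (Module.finrank ℝ V)) ℝ V, (∀ i, g (e i) (e i) = 1) ∧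
      ∀ v i, e.repr v i = g v (e i) := by
  let c : InnerProductSpace.Core ℝ V :=
    { inner := fun a b => g a b
      conj_inner_symm := fun a b => by simpa using hs b a
      re_inner_nonneg := fun a => by
        by_cases h : a = 0
        · simp [h]
        · exact (hg a h).le
      add_left := fun a b d => by simp
      smul_left := fun a b r => by simp
      definite := fun a h => by
        by_contra h0
        exact (hg a h0).ne' h }
  let : NormedAddCommGroup V := c.toNormedAddCommGroup
  let : InnerProductSpace ℝ V := InnerProductSpace.ofCore c.toCore
  let e := stdOrthonormalBasis ℝ V
  refine ⟨e.toBasis, fun i => ?_, fun v i => ?_⟩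
  · have h1 : inner ℝ (e i) (e i) = (1 : ℝ) := by
      rw [real_inner_self_eq_norm_sq, e.norm_eq_one]; norm_num
    rw [e.coe_toBasis]
    exact h1
  · rw [e.coe_toBasis_repr_apply, e.repr_apply_apply, e.coe_toBasis]
    exact hs _ _

variable {E : Type*} [NormedAddCommGroup E] [NormedSpace ℝ E]
  {g : E →L[ℝ] E →L[ℝ] ℝ}

lemma trace_eq_sum_form {ι : Type*} [Fintype ι] {e : Module.Basis ι ℝ E}
    (he : ∀ v i, e.repr v i = g v (e i)) (S : E →ₗ[ℝ] E) :
    LinearMap.trace ℝ E S = ∑ i, g (S (e i)) (e i) := by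
  classical
  rw [LinearMap.trace_eq_matrix_trace ℝ e, Matrix.trace]
  simp [LinearMap.toMatrix_apply, he]

/-- The form `ξ ⊗ ζ`. -/
def tensorForm (ξ ζ : E →L[ℝ] ℝ) : E →L[ℝ] E →L[ℝ] ℝ := ξ.smulRight ζ

variable [FiniteDimensional ℝ E]

lemma traceForm_tensorForm (ξ ζ : E →L[ℝ] ℝ) :
    traceForm g (tensorForm ξ ζ) = ξ (g.inverse ζ) := by
  have h : ((g.inverse.comp (tensorForm ξ ζ) : E →L[ℝ] E) : E →ₗ[ℝ] E) =
      LinearMap.smulRight (ξ : E →ₗ[ℝ] ℝ) (g.inverse ζ) := by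
    ext a
    simp [tensorForm]
  rw [traceForm, h, LinearMap.trace_smulRight]
  rfl

lemma exists_orthonormal_basis (hs : ∀ a b, g a b = g b a) (hg : ∀ a, a ≠ 0 → 0 < g a a) :
    ∃ e : Module.Basis (Fin (Module.finrank ℝ E)) ℝ E, (∀ i, g (e i) (e i) = 1) ∧
      ∀ v i, e.repr v i = g v (e i) :=
  exists_basis_repr_eq_form (g := ContinuousLinearMap.coeLM ℝ ∘ₗ (g : E →ₗ[ℝ] E →L[ℝ] ℝ)) hs hg

/-- Cauchy's inequality `(tr S)² ≤ n tr S²` for a self-adjoint endomorphism. -/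
lemma trace_sq_le (hs : ∀ a b, g a b = g b a) (hg : ∀ a, a ≠ 0 → 0 < g a a) {S : E →ₗ[ℝ] E}
    (hS : ∀ a b, g (S a) b = g a (S b)) :
    LinearMap.trace ℝ E S ^ 2 ≤ Module.finrank ℝ E * LinearMap.trace ℝ E (S * S) := by
  obtain ⟨e, he1, he⟩ := exists_orthonormal_basis hs hg
  rw [trace_eq_sum_form he, trace_eq_sum_form he]
  refine (sq_sum_le_card_mul_sum_sq (s := Finset.univ)).trans ?_
  rw [Finset.card_univ, Fintype.card_fin]
  gcongr with i
  rw [Module.End.mul_apply, hS (S (e i))]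
  have h0 : 0 ≤ g (S (e i) - g (S (e i)) (e i) • e i) (S (e i) - g (S (e i)) (e i) • e i) := by
    by_cases h : S (e i) - g (S (e i)) (e i) • e i = 0
    · rw [h]; simp
    · exact (hg _ h).le
  simp only [map_sub, map_smul, sub_apply, smul_apply, smul_eq_mul, he1 i, hs (e i) (S (e i))] at h0
  linarith

lemma traceForm_nonneg (hs : ∀ a b, g a b = g b a) (hg : ∀ a, a ≠ 0 → 0 < g a a)
    {B : E →L[ℝ] E →L[ℝ] ℝ} (hB : ∀ a, 0 ≤ B a a) : 0 ≤ traceForm g B := by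
  obtain ⟨e, he1, he⟩ := exists_orthonormal_basis hs hg
  rw [traceForm, trace_eq_sum_form he]
  refine Finset.sum_nonneg fun i _ => ?_
  simp only [ContinuousLinearMap.coe_coe, ContinuousLinearMap.comp_apply]
  rw [apply_inverse_of_pos hg]
  exact hB _

/-- The squared length of a covector. -/
lemma traceForm_tensorForm_self_eq (hg : ∀ a, a ≠ 0 → 0 < g a a) (ξ : E →L[ℝ] ℝ) :
    traceForm g (tensorForm ξ ξ) = g (g.inverse ξ) (g.inverse ξ) := by
  rw [traceForm_tensorForm, apply_inverse_of_pos hg]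

lemma traceForm_tensorForm_self_pos (hg : ∀ a, a ≠ 0 → 0 < g a a) {ξ : E →L[ℝ] ℝ} (hξ : ξ ≠ 0) :
    0 < traceForm g (tensorForm ξ ξ) := by
  rw [traceForm_tensorForm_self_eq hg]
  refine hg _ fun h => hξ ?_
  rw [← apply_inverse_of_pos hg ξ, h, map_zero]

lemma IsHypersurface.traceShape_sq_le {W : Type*} [NormedAddCommGroup W] [NormedSpace ℝ W]
    [FiniteDimensional ℝ W] {G : W → W →L[ℝ] W →L[ℝ] ℝ} {V : Set W} {F η : E → W} {U : Set E}
    (h : IsHypersurface G V F η U) {y : E} (hy : y ∈ U) :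
    traceShape G F η y ^ 2 ≤ Module.finrank ℝ E *
      LinearMap.trace ℝ E ((shape G F η y : E →ₗ[ℝ] E) * (shape G F η y : E →ₗ[ℝ] E)) :=
  trace_sq_le (h.isMetricOn.symm y hy) (h.pos hy) (h.shape_symm hy)

end Trace

/-! ### The strong maximum principle -/

section HessCalculus

variable {E : Type*} [NormedAddCommGroup E] [NormedSpace ℝ E]
  {g : E → E →L[ℝ] E →L[ℝ] ℝ} {y : E}

lemma eventually_differentiableAt {Z : Type*} [NormedAddCommGroup Z] [NormedSpace ℝ Z] {f : E → Z}
    (hf : ContDiffAt ℝ ∞ f y) : ∀ᶠ z in 𝓝 y, DifferentiableAt ℝ f z :=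
  ((hf.of_le (m := 1) (by simp)).eventually (by simp)).mono fun _ hz =>
    hz.differentiableAt (by simp)

lemma hess_comp {q : E → ℝ} {ψ : ℝ → ℝ} (hq : ContDiffAt ℝ ∞ q y)
    (hψ : ContDiffAt ℝ ∞ ψ (q y)) :
    hess g (fun z => ψ (q z)) y = deriv ψ (q y) • hess g q y
      + deriv (deriv ψ) (q y) • tensorForm (fderiv ℝ q y) (fderiv ℝ q y) := by
  have h1 : ∀ᶠ z in 𝓝 y, fderiv ℝ (fun z => ψ (q z)) z = deriv ψ (q z) • fderiv ℝ q z := by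
    filter_upwards [eventually_differentiableAt hq,
      hq.continuousAt.eventually (eventually_differentiableAt hψ)] with z hz1 hz2
    exact (hz2.hasDerivAt.comp_hasFDerivAt z hz1.hasFDerivAt).fderiv
  have hdψ : DifferentiableAt ℝ (deriv ψ) (q y) :=
    (hψ.fderiv_right (m := ∞) (by simp)).differentiableAt (by simp) |>.clm_apply
      (differentiableAt_const (1 : ℝ))
  have hq1 : HasFDerivAt q (fderiv ℝ q y) y := (hq.differentiableAt (by simp)).hasFDerivAt
  have hq2 : DifferentiableAt ℝ (fderiv ℝ q) y :=
    (hq.fderiv_right (m := ∞) (by simp)).differentiableAt (by simp)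
  have h2 : fderiv ℝ (fderiv ℝ fun z => ψ (q z)) y =
      fderiv ℝ (fun z => deriv ψ (q z) • fderiv ℝ q z) y := EventuallyEq.fderiv_eq h1
  have h3 : HasFDerivAt (fun z => deriv ψ (q z)) (deriv (deriv ψ) (q y) • fderiv ℝ q y) y :=
    hdψ.hasDerivAt.comp_hasFDerivAt y hq1
  ext a b
  rw [hess_apply, h2, h1.self_of_nhds, (h3.fun_smul hq2.hasFDerivAt).fderiv]
  simp [hess_apply, tensorForm]
  ring

lemma hess_sub {f q : E → ℝ} (hf : ContDiffAt ℝ ∞ f y) (hq : ContDiffAt ℝ ∞ q y) :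
    hess g (fun z => f z - q z) y = hess g f y - hess g q y := by
  have h1 : fderiv ℝ (fun z => f z - q z) =ᶠ[𝓝 y] fun z => fderiv ℝ f z - fderiv ℝ q z := by
    filter_upwards [eventually_differentiableAt hf, eventually_differentiableAt hq] with z hz1 hz2
    exact fderiv_fun_sub hz1 hz2
  have hf2 : DifferentiableAt ℝ (fderiv ℝ f) y :=
    (hf.fderiv_right (m := ∞) (by simp)).differentiableAt (by simp)
  have hq2 : DifferentiableAt ℝ (fderiv ℝ q) y :=
    (hq.fderiv_right (m := ∞) (by simp)).differentiableAt (by simp)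
  ext a b
  rw [hess_apply, h1.fderiv_eq, h1.self_of_nhds, fderiv_fun_sub hf2 hq2]
  simp [hess_apply]
  ring

lemma lap_comp {q : E → ℝ} {ψ : ℝ → ℝ} (hq : ContDiffAt ℝ ∞ q y)
    (hψ : ContDiffAt ℝ ∞ ψ (q y)) :
    lap g (fun z => ψ (q z)) y = deriv ψ (q y) * lap g q y
      + deriv (deriv ψ) (q y) * traceForm (g y) (tensorForm (fderiv ℝ q y) (fderiv ℝ q y)) := by
  rw [lap, hess_comp hq hψ, traceForm_add, traceForm_smul, traceForm_smul, lap]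

lemma lap_sub {f q : E → ℝ} (hf : ContDiffAt ℝ ∞ f y) (hq : ContDiffAt ℝ ∞ q y) :
    lap g (fun z => f z - q z) y = lap g f y - lap g q y := by
  rw [lap, hess_sub hf hq, sub_eq_add_neg, ← neg_one_smul ℝ (hess g q y), traceForm_add,
    traceForm_smul, lap, lap]
  ring

/-- The second derivative is nonnegative at a local minimum. -/
lemma fderiv_fderiv_nonneg_of_isLocalMin {f : E → ℝ} (hf : ContDiffAt ℝ ∞ f y)
    (hmin : IsLocalMin f y) (a : E) : 0 ≤ fderiv ℝ (fderiv ℝ f) y a a := by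
  by_contra! hneg
  have hline : ∀ t : ℝ, HasDerivAt (fun t : ℝ => y + t • a) a t := fun t => by
    simpa using ((hasDerivAt_id t).smul_const a).const_add y
  have hcont : ContinuousAt (fun t : ℝ => y + t • a) 0 := (hline 0).continuousAt
  have h0 : y + (0 : ℝ) • a = y := by simp
  have htend : Tendsto (fun t : ℝ => y + t • a) (𝓝 0) (𝓝 y) := by simpa [h0] using hcont.tendsto
  have hev : ∀ᶠ t in 𝓝 (0 : ℝ), DifferentiableAt ℝ f (y + t • a) :=
    htend.eventually (eventually_differentiableAt hf)
  have hd1 : deriv (fun t : ℝ => f (y + t • a)) =ᶠ[𝓝 0] fun t => fderiv ℝ f (y + t • a) a := by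
    filter_upwards [hev] with t ht
    exact (ht.hasFDerivAt.comp_hasDerivAt t (hline t)).deriv
  have hf2 : DifferentiableAt ℝ (fderiv ℝ f) (y + (0 : ℝ) • a) := by
    rw [h0]; exact (hf.fderiv_right (m := ∞) (by simp)).differentiableAt (by simp)
  have hd2 : deriv (deriv fun t : ℝ => f (y + t • a)) 0 = fderiv ℝ (fderiv ℝ f) y a a := by
    rw [hd1.deriv_eq]
    have h1 : HasDerivAt (fun t : ℝ => fderiv ℝ f (y + t • a))
        (fderiv ℝ (fderiv ℝ f) (y + (0 : ℝ) • a) a) 0 :=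
      hf2.hasFDerivAt.comp_hasDerivAt (0 : ℝ) (hline 0)
    rw [(h1.clm_apply (hasDerivAt_const (0 : ℝ) a)).deriv, h0]
    simp
  have hmin' : IsLocalMin (fun t : ℝ => f (y + t • a)) 0 := by
    have : ∀ᶠ t in 𝓝 (0 : ℝ), f y ≤ f (y + t • a) := htend.eventually hmin
    simpa [IsLocalMin, IsMinFilter] using this
  have hmax : IsLocalMax (fun t : ℝ => f (y + t • a)) 0 := by
    refine isLocalMax_of_deriv_deriv_neg (by rw [hd2]; exact hneg) hmin'.deriv_eq_zero ?_
    exact ContinuousAt.comp (g := f) (by rw [h0]; exact hf.continuousAt) hcont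
  -- a function with a local minimum and a local maximum at the same point is locally constant
  have hconst : (fun t : ℝ => f (y + t • a)) =ᶠ[𝓝 0] fun _ => f (y + (0 : ℝ) • a) := by
    filter_upwards [hmin', hmax] with t h1 h2 using le_antisymm h2 h1
  have hz : deriv (deriv fun t : ℝ => f (y + t • a)) 0 = 0 := by
    rw [hconst.deriv.deriv_eq]; simp
  rw [hd2] at hz
  exact hneg.ne hz

variable [FiniteDimensional ℝ E]

lemma continuousAt_lap {V : Set E} (hg : IsMetricOn g V) (hy : y ∈ V) {f : E → ℝ}
    (hf : ContDiffAt ℝ ∞ f y) : ContinuousAt (lap g f) y := by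
  let T : (E →L[ℝ] E) →L[ℝ] ℝ := LinearMap.toContinuousLinearMap
    (LinearMap.trace ℝ E ∘ₗ ContinuousLinearMap.coeLM ℝ)
  have h1 : ContDiffAt ℝ ∞ (fderiv ℝ f) y := hf.fderiv_right (by simp)
  have h2 : ContinuousAt (fderiv ℝ (fderiv ℝ f)) y :=
    (h1.fderiv_right (m := ∞) (by simp)).continuousAt
  have h3 : ContinuousAt (hess g f) y :=
    h2.sub (((ContinuousLinearMap.compL ℝ E E ℝ).continuous.continuousAt.comp
      h1.continuousAt).clm_comp (hg.contDiffAt_christoffelL hy).continuousAt)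
  exact T.continuous.continuousAt.comp ((hg.contDiffAt_inverse hy).continuousAt.clm_comp h3)

/-- At a local minimum the Laplacian is nonnegative. -/
lemma lap_nonneg_of_isLocalMin {V : Set E} (hg : IsMetricOn g V) (hy : y ∈ V) {f : E → ℝ}
    (hf : ContDiffAt ℝ ∞ f y) (hmin : IsLocalMin f y) : 0 ≤ lap g f y := by
  refine traceForm_nonneg (hg.symm y hy) (hg.pos y hy) fun a => ?_
  rw [hess_apply, hmin.fderiv_eq_zero]
  simpa using fderiv_fderiv_nonneg_of_isLocalMin hf hmin a

end HessCalculus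

section MaximumPrinciple

variable {E : Type*} [NormedAddCommGroup E] [InnerProductSpace ℝ E] [FiniteDimensional ℝ E]
  {g : E → E →L[ℝ] E →L[ℝ] ℝ} {U : Set E} {Z : E → E} {f : E → ℝ}

/-- The barrier `exp(-k |y - z|²)` is, for large `k`, a strict subsolution near a point `p ≠ z`. -/
lemma exists_barrier (hg : IsMetricOn g U) (hZ : ContinuousOn Z U) {p z : E} (hp : p ∈ U)
    (hpz : p ≠ z) : ∃ k : ℝ, 0 < k ∧ ∀ᶠ y in 𝓝 p,
      0 < lap g (fun x => Real.exp (-k * ‖x - z‖ ^ 2)) y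
        + fderiv ℝ (fun x => Real.exp (-k * ‖x - z‖ ^ 2)) y (Z y) := by
  set q : E → ℝ := fun x => ‖x - z‖ ^ 2 with hqdef
  have hq : ∀ y, ContDiffAt ℝ ∞ q y := fun y =>
    ((contDiff_id.sub contDiff_const).norm_sq ℝ).contDiffAt
  have hdq : fderiv ℝ q p ≠ 0 := by
    intro h0
    have h1 : HasFDerivAt q (2 • (innerSL ℝ (p - z)).comp (ContinuousLinearMap.id ℝ E)) p :=
      ((hasFDerivAt_id p).sub_const z).norm_sq
    have h2 := DFunLike.congr_fun (h1.fderiv.symm.trans h0) (p - z)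
    have h3 : inner ℝ (p - z) (p - z) = (0 : ℝ) := by rw [inner_sub_left]; simpa using h2
    exact hpz (sub_eq_zero.1 (inner_self_eq_zero.1 h3))
  have hc := traceForm_tensorForm_self_pos (hg.pos p hp) hdq
  -- the operator applied to `exp(-k q)` at `p` is `k exp(-k q) (k |dq|² - L q)`
  set c := traceForm (g p) (tensorForm (fderiv ℝ q p) (fderiv ℝ q p)) with hcdef
  obtain ⟨k, hk0, hk⟩ : ∃ k : ℝ, 0 < k ∧ lap g q p + fderiv ℝ q p (Z p) < k * c := by
    refine ⟨(|lap g q p + fderiv ℝ q p (Z p)| + 1) / c, by positivity, ?_⟩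
    rw [div_mul_cancel₀ _ hc.ne']
    linarith [le_abs_self (lap g q p + fderiv ℝ q p (Z p))]
  refine ⟨k, hk0, ?_⟩
  have hψ : ∀ t, HasDerivAt (fun t : ℝ => Real.exp (-k * t)) (-k * Real.exp (-k * t)) t := by
    intro t
    have := ((hasDerivAt_id t).const_mul (-k)).exp
    simpa [mul_comm] using this
  have hψ1 : deriv (fun t : ℝ => Real.exp (-k * t)) = fun t => -k * Real.exp (-k * t) :=
    funext fun t => (hψ t).deriv
  have hψ2 : ∀ t, deriv (deriv (fun t : ℝ => Real.exp (-k * t))) t = k ^ 2 * Real.exp (-k * t) := by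
    intro t
    rw [hψ1, ((hψ t).const_mul (-k)).deriv]; ring
  have hψc : ContDiff ℝ ∞ (fun t : ℝ => Real.exp (-k * t)) := by fun_prop
  have hw : ContDiffAt ℝ ∞ (fun x => Real.exp (-k * q x)) p := hψc.contDiffAt.comp p (hq p)
  have hcont : ContinuousAt (fun y => lap g (fun x => Real.exp (-k * q x)) y
      + fderiv ℝ (fun x => Real.exp (-k * q x)) y (Z y)) p :=
    (continuousAt_lap hg hp hw).add ((hw.fderiv_right (m := ∞) (by simp)).continuousAt.clm_apply
      (hZ.continuousAt (hg.mem_nhds hp)))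
  refine hcont.eventually (lt_mem_nhds ?_)
  beta_reduce
  have hfd : fderiv ℝ (fun x => Real.exp (-k * q x)) p =
      (-k * Real.exp (-k * q p)) • fderiv ℝ q p :=
    ((hψ (q p)).comp_hasFDerivAt p ((hq p).differentiableAt (by simp)).hasFDerivAt).fderiv
  rw [lap_comp (ψ := fun t : ℝ => Real.exp (-k * t)) (hq p) hψc.contDiffAt, hψ2, hψ1, hfd]
  simp only [smul_apply, smul_eq_mul]
  have : 0 < k * Real.exp (-k * q p) * (k * c - (lap g q p + fderiv ℝ q p (Z p))) := by
    have := sub_pos.2 hk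
    positivity
  calc (0 : ℝ) < _ := this
    _ = _ := by ring

/-- Hopf's strong maximum principle: a supersolution of the Laplacian with a continuous drift which
attains its minimum is constant near the minimum point. -/
theorem eventually_eq_of_lap_nonpos (hg : IsMetricOn g U) (hZ : ContinuousOn Z U)
    (hf : ∀ y ∈ U, ContDiffAt ℝ ∞ f y) (hL : ∀ y ∈ U, lap g f y + fderiv ℝ f y (Z y) ≤ 0)
    {y₀ : E} (hy₀ : y₀ ∈ U) (hmin : ∀ y ∈ U, f y₀ ≤ f y) : ∀ᶠ y in 𝓝 y₀, f y = f y₀ := by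
  obtain ⟨R', hR', hRU'⟩ := Metric.nhds_basis_closedBall.mem_iff.1 (hg.mem_nhds hy₀)
  set R := R' / 2 with hRdef
  have hR : 0 < R := by positivity
  have hRU : Metric.closedBall y₀ (2 * R) ⊆ U := by
    rwa [show 2 * R = R' by rw [hRdef]; ring]
  filter_upwards [Metric.ball_mem_nhds y₀ hR] with z hz
  by_contra hne
  have hcf : ContinuousOn f U := fun y hy => (hf y hy).continuousAt.continuousWithinAt
  -- `p` is a minimum point of `f` nearest to `z`
  have hK : IsCompact (Metric.closedBall y₀ (2 * R) ∩ f ⁻¹' {f y₀}) :=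
    (isCompact_closedBall y₀ (2 * R)).of_isClosed_subset
      ((hcf.mono hRU).preimage_isClosed_of_isClosed Metric.isClosed_closedBall isClosed_singleton)
      inter_subset_left
  obtain ⟨p, ⟨hpb, hpm⟩, hpmin⟩ := hK.exists_isMinOn
    ⟨y₀, Metric.mem_closedBall_self (by positivity), rfl⟩
    (continuous_id.dist continuous_const : Continuous fun y => dist y z).continuousOn
  have hpm : f p = f y₀ := hpm
  have hpU : p ∈ U := hRU hpb
  have hpz : p ≠ z := by rintro rfl; exact hne hpm
  set d := dist p z with hd
  have hd0 : 0 < d := dist_pos.2 hpz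
  have hdR : d < R := by
    have h1 : dist p z ≤ dist y₀ z :=
      hpmin (a := y₀) ⟨Metric.mem_closedBall_self (by positivity), rfl⟩
    rw [Metric.mem_ball'] at hz
    linarith
  set z' := midpoint ℝ z p with hz'
  have hpz' : p ≠ z' := by
    intro h
    exact hpz ((midpoint_eq_right_iff (R := ℝ)).1 h.symm).symm
  have hdz' : dist p z' = d / 2 := by
    rw [hz', dist_right_midpoint, dist_comm z p, ← hd]; simp; ring
  -- the closed ball with centre `z'` through `p` meets the minimum set only in `p`
  have htouch : ∀ y, dist y z' ≤ d / 2 → y ≠ p → f y₀ < f y := by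
    intro y hy hyp
    have hz'z : dist z' z = d / 2 := by
      rw [hz', dist_midpoint_left, dist_comm z p, ← hd]; simp; ring
    have h1 : dist y z ≤ d := by linarith [dist_triangle y z' z]
    have hyb : y ∈ Metric.closedBall y₀ (2 * R) := by
      rw [Metric.mem_closedBall]
      rw [Metric.mem_ball] at hz
      linarith [dist_triangle y z y₀]
    refine lt_of_le_of_ne (hmin y (hRU hyb)) fun heq => hyp ?_
    have h2 : d ≤ dist y z := hpmin (a := y) ⟨hyb, heq.symm⟩
    have h3 := parallelogram_law_with_norm ℝ (y - z') (z' - z)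
    rw [sub_add_sub_cancel, ← dist_eq_norm y z, ← dist_eq_norm y z', ← dist_eq_norm z' z,
      hz'z] at h3
    have h4 : ‖y - z' - (z' - z)‖ = 0 := by
      have h5 := dist_nonneg (x := y) (y := z')
      nlinarith [norm_nonneg (y - z' - (z' - z))]
    have h6 : z' = (1 / 2 : ℝ) • (z + p) := by
      rw [hz', midpoint_eq_smul_add]; simp
    have h7 : y = z' + z' - z := by
      have := norm_eq_zero.1 h4
      rw [sub_sub, sub_eq_zero] at this
      rw [this]; abel
    rw [h7, h6, ← add_smul]
    norm_num
  obtain ⟨k, hk0, hk⟩ := exists_barrier hg hZ hpU hpz'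
  obtain ⟨δ, hδ, hδU⟩ := Metric.nhds_basis_closedBall.mem_iff.1 (hk.and (hg.mem_nhds hpU))
  set w : E → ℝ := fun x => Real.exp (-k * ‖x - z'‖ ^ 2) with hw
  have hwc : ContDiff ℝ ∞ w :=
    Real.contDiff_exp.comp (contDiff_const.mul ((contDiff_id.sub contDiff_const).norm_sq ℝ))
  have hδU1 : Metric.closedBall p δ ⊆ U := fun y hy => (hδU hy).2
  -- on the part of the sphere about `p` inside the ball about `z'`, `f` exceeds its minimum by `c`
  obtain ⟨c, hc0, hc⟩ : ∃ c : ℝ, 0 < c ∧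
      ∀ y ∈ Metric.sphere p δ ∩ Metric.closedBall z' (d / 2), f y₀ + c ≤ f y := by
    rcases (Metric.sphere p δ ∩ Metric.closedBall z' (d / 2)).eq_empty_or_nonempty with h | h
    · exact ⟨1, one_pos, by simp [h]⟩
    · obtain ⟨y1, hy1, hy1m⟩ := ((isCompact_sphere p δ).inter_right
        Metric.isClosed_closedBall).exists_isMinOn h
        (hcf.mono fun y hy => hδU1 (Metric.sphere_subset_closedBall hy.1))
      refine ⟨f y1 - f y₀, sub_pos.2 (htouch y1 hy1.2 ?_), fun y hy => ?_⟩
      · rintro rfl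
        have := hy1.1
        simp at this
        exact hδ.ne this
      · have : f y1 ≤ f y := hy1m hy
        linarith
  -- `h` is `f` minus a small multiple of the barrier, which vanishes at `p`
  set h : E → ℝ := fun y => f y - c * (w y - w p) with hh
  have hbc : ContDiff ℝ ∞ fun y => c * (w y - w p) := contDiff_const.mul (hwc.sub contDiff_const)
  have hhc : ∀ y ∈ U, ContDiffAt ℝ ∞ h y := fun y hy => (hf y hy).sub hbc.contDiffAt
  have hhp : h p = f y₀ := by simp [hh, hpm]
  have hwp : w p = Real.exp (-k * (d / 2) ^ 2) := by
    simp only [hw]; rw [← dist_eq_norm, hdz']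
  have hsph : ∀ y ∈ Metric.sphere p δ, f y₀ ≤ h y := by
    intro y hy
    by_cases hyz : dist y z' ≤ d / 2
    · have h1 := hc y ⟨hy, hyz⟩
      have h2 : w y ≤ 1 := by
        simp only [hw]
        rw [Real.exp_le_one_iff]
        have := mul_nonneg hk0.le (sq_nonneg ‖y - z'‖)
        linarith
      have h3 : 0 < w p := Real.exp_pos _
      have h4 : c * (w y - w p) ≤ c * 1 := mul_le_mul_of_nonneg_left (by linarith) hc0.le
      simp only [hh]
      linarith
    · push Not at hyz
      have h1 := hmin y (hδU1 (Metric.sphere_subset_closedBall hy))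
      have h2 : w y ≤ w p := by
        rw [hwp]
        simp only [hw]
        rw [Real.exp_le_exp, ← dist_eq_norm]
        have : (d / 2) ^ 2 ≤ dist y z' ^ 2 := by gcongr
        nlinarith
      have h4 : c * (w y - w p) ≤ 0 := mul_nonpos_of_nonneg_of_nonpos hc0.le (by linarith)
      simp only [hh]
      linarith
  -- `h` is a strict supersolution near `p`, so it has no interior minimum
  have hno : ∀ y ∈ Metric.ball p δ, ¬ ∀ x ∈ Metric.closedBall p δ, h y ≤ h x := by
    intro y hy hymin
    have hyc := Metric.ball_subset_closedBall hy
    have hyU := hδU1 hyc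
    have hloc : IsLocalMin h y := by
      filter_upwards [Metric.isOpen_ball.mem_nhds hy] with x hx
        using hymin x (Metric.ball_subset_closedBall hx)
    have h1 := lap_nonneg_of_isLocalMin hg hyU (hhc y hyU) hloc
    have h2 := hloc.fderiv_eq_zero
    have h3 := hL y hyU
    have h4 := (hδU hyc).1
    have hψ : ∀ t, HasDerivAt (fun t : ℝ => c * (t - w p)) c t := fun t => by
      simpa using ((hasDerivAt_id t).sub_const (w p)).const_mul c
    have hψ1 : deriv (fun t : ℝ => c * (t - w p)) = fun _ => c := funext fun t => (hψ t).deriv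
    have h5 : lap g (fun x => c * (w x - w p)) y = c * lap g w y := by
      rw [lap_comp (ψ := fun t : ℝ => c * (t - w p)) hwc.contDiffAt (by fun_prop), hψ1]
      simp
    have hwd : DifferentiableAt ℝ w y := hwc.contDiffAt.differentiableAt (by simp)
    have h6 : fderiv ℝ (fun x => c * (w x - w p)) y = c • fderiv ℝ w y :=
      ((hψ _).comp_hasFDerivAt y hwd.hasFDerivAt).fderiv
    rw [lap_sub (hf y hyU) hbc.contDiffAt, h5] at h1
    rw [hh, fderiv_fun_sub ((hf y hyU).differentiableAt (by simp))
      (hbc.contDiffAt.differentiableAt (by simp)), h6, sub_eq_zero] at h2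
    rw [h2] at h3
    simp only [smul_apply, smul_eq_mul] at h3
    nlinarith
  obtain ⟨y1, hy1, hy1m⟩ := (isCompact_closedBall p δ).exists_isMinOn
    ⟨p, Metric.mem_closedBall_self hδ.le⟩
    (fun y hy => (hhc y (hδU1 hy)).continuousAt.continuousWithinAt)
  by_cases hy1b : y1 ∈ Metric.ball p δ
  · exact hno y1 hy1b fun x hx => hy1m hx
  · have hs : y1 ∈ Metric.sphere p δ := by
      rw [Metric.mem_closedBall] at hy1
      rw [Metric.mem_ball, not_lt] at hy1b
      exact le_antisymm hy1 hy1b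
    refine hno p (Metric.mem_ball_self hδ) fun x hx => ?_
    rw [hhp]
    exact (hsph y1 hs).trans (hy1m hx)

end MaximumPrinciple

/-! ### Warped products in coordinates -/

section WarpedCoordinates

variable {E : Type*} [NormedAddCommGroup E] [NormedSpace ℝ E]

/-- The warped product metric `dr ⊗ dr + lam(r)² G` on `ℝ × E`. -/
def warpedForm (lam : ℝ → ℝ) (G : E → E →L[ℝ] E →L[ℝ] ℝ) (q : ℝ × E) :
    ℝ × E →L[ℝ] ℝ × E →L[ℝ] ℝ :=
  (ContinuousLinearMap.mul ℝ ℝ).bilinearComp (ContinuousLinearMap.fst ℝ ℝ E)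
      (ContinuousLinearMap.fst ℝ ℝ E)
    + lam q.1 ^ 2 • (G q.2).bilinearComp (ContinuousLinearMap.snd ℝ ℝ E)
      (ContinuousLinearMap.snd ℝ ℝ E)

lemma warpedForm_apply (lam : ℝ → ℝ) (G : E → E →L[ℝ] E →L[ℝ] ℝ) (q A B : ℝ × E) :
    warpedForm lam G q A B = A.1 * B.1 + lam q.1 ^ 2 * G q.2 A.2 B.2 := rfl

/-- The endomorphism `a ↦ R(a, b) c`. -/
def curvatureEnd (G : E → E →L[ℝ] E →L[ℝ] ℝ) (y b c : E) : E →L[ℝ] E :=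
  ((fderiv ℝ (christoffelL G) y).flip b).flip c - (fderiv ℝ (christoffelL G) y b).flip c
    + (christoffelL G y).flip (christoffelL G y b c)
    - (christoffelL G y b).comp ((christoffelL G y).flip c)

variable {lam : ℝ → ℝ} {G : E → E →L[ℝ] E →L[ℝ] ℝ} {I : Set ℝ} {V : Set E}

lemma IsMetricOn.curvatureEnd_apply [FiniteDimensional ℝ E] (h : IsMetricOn G V) {y : E}
    (hy : y ∈ V) (a b c : E) : curvatureEnd G y b c a = curvature G y a b c := by
  rw [h.curvature_eq hy]; rfl

/-- `lam` is a smooth positive function on the open set `I`. -/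
structure IsWarpingOn (lam : ℝ → ℝ) (I : Set ℝ) : Prop where
  isOpen : IsOpen I
  contDiffOn : ContDiffOn ℝ ∞ lam I
  pos : ∀ r ∈ I, 0 < lam r

namespace IsWarpingOn

lemma contDiffAt (hl : IsWarpingOn lam I) {r : ℝ} (hr : r ∈ I) : ContDiffAt ℝ ∞ lam r :=
  hl.contDiffOn.contDiffAt (hl.isOpen.mem_nhds hr)

lemma hasDerivAt (hl : IsWarpingOn lam I) {r : ℝ} (hr : r ∈ I) :
    HasDerivAt lam (deriv lam r) r :=
  ((hl.contDiffAt hr).differentiableAt (by simp)).hasDerivAt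

lemma hasDerivAt_deriv (hl : IsWarpingOn lam I) {r : ℝ} (hr : r ∈ I) :
    HasDerivAt (deriv lam) (deriv (deriv lam) r) r := by
  have h1 : ContDiffAt ℝ ∞ (fderiv ℝ lam) r := (hl.contDiffAt hr).fderiv_right (by simp)
  have h2 : DifferentiableAt ℝ (deriv lam) r :=
    (h1.differentiableAt (by simp)).clm_apply (differentiableAt_const (1 : ℝ))
  exact h2.hasDerivAt

end IsWarpingOn

lemma isMetricOn_warpedForm (hl : IsWarpingOn lam I) (hG : IsMetricOn G V) :
    IsMetricOn (warpedForm lam G) (I ×ˢ V) where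
  isOpen := hl.isOpen.prod hG.isOpen
  contDiffOn := by
    have h1 : ContDiffOn ℝ ∞ (fun q : ℝ × E => lam q.1 ^ 2) (I ×ˢ V) :=
      (hl.contDiffOn.comp contDiff_fst.contDiffOn fun q hq => hq.1).pow 2
    have h2 : ContDiffOn ℝ ∞ (fun q : ℝ × E => G q.2) (I ×ˢ V) :=
      hG.contDiffOn.comp contDiff_snd.contDiffOn fun q hq => hq.2
    have h3 : ContDiffOn ℝ ∞ (fun q : ℝ × E => ((G q.2).comp (ContinuousLinearMap.snd ℝ ℝ E)).flip)
        (I ×ˢ V) :=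
      (ContinuousLinearMap.flipₗᵢ ℝ (ℝ × E) E ℝ).contDiff.comp_contDiffOn
        (h2.clm_comp contDiffOn_const)
    have h4 : ContDiffOn ℝ ∞ (fun q : ℝ × E => (G q.2).bilinearComp
        (ContinuousLinearMap.snd ℝ ℝ E) (ContinuousLinearMap.snd ℝ ℝ E)) (I ×ˢ V) :=
      (ContinuousLinearMap.flipₗᵢ ℝ (ℝ × E) (ℝ × E) ℝ).contDiff.comp_contDiffOn
        (h3.clm_comp contDiffOn_const)
    exact contDiffOn_const.add (h1.smul h4)
  symm q hq A B := by
    rw [warpedForm_apply, warpedForm_apply, hG.symm _ hq.2]; ring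
  pos q hq A hA := by
    rw [warpedForm_apply]
    have hl2 := pow_pos (hl.pos _ hq.1) 2
    by_cases h : A.2 = 0
    · have h1 : A.1 ≠ 0 := fun h1 => hA (Prod.ext h1 h)
      rw [h, map_zero, mul_zero, add_zero]
      exact mul_self_pos.2 h1
    · have := mul_pos hl2 (hG.pos _ hq.2 _ h)
      nlinarith [mul_self_nonneg A.1]

/-- The components of the warped product metric on constant fields. -/
lemma fderiv_warpedForm_apply (hl : IsWarpingOn lam I) (hG : IsMetricOn G V) {q : ℝ × E}
    (hq : q ∈ I ×ˢ V) (A B C : ℝ × E) :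
    fderiv ℝ (warpedForm lam G) q A B C = 2 * lam q.1 * deriv lam q.1 * A.1 * G q.2 B.2 C.2
      + lam q.1 ^ 2 * fderiv ℝ G q.2 A.2 B.2 C.2 := by
  have hd := (isMetricOn_warpedForm hl hG).differentiableAt hq
  have h0 : fderiv ℝ (fun z => warpedForm lam G z B C) q A =
      fderiv ℝ (warpedForm lam G) q A B C := by
    rw [((hd.hasFDerivAt.clm_apply (hasFDerivAt_const B q)).clm_apply
      (hasFDerivAt_const C q)).fderiv]
    simp
  have h1 : HasFDerivAt (fun z : ℝ × E => lam z.1)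
      (deriv lam q.1 • ContinuousLinearMap.fst ℝ ℝ E) q :=
    (hl.hasDerivAt hq.1).comp_hasFDerivAt q hasFDerivAt_fst
  have h2 : HasFDerivAt (fun z : ℝ × E => G z.2)
      ((fderiv ℝ G q.2).comp (ContinuousLinearMap.snd ℝ ℝ E)) q :=
    (hG.differentiableAt hq.2).hasFDerivAt.comp q hasFDerivAt_snd
  have h3 := ((h1.pow 2).mul ((h2.clm_apply (hasFDerivAt_const B.2 q)).clm_apply
    (hasFDerivAt_const C.2 q))).const_add (B.1 * C.1)
  rw [← h0]
  change fderiv ℝ (fun z : ℝ × E => B.1 * C.1 + lam z.1 ^ 2 * G z.2 B.2 C.2) q A = _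
  refine (DFunLike.congr_fun h3.fderiv A).trans ?_
  simp
  ring

variable [FiniteDimensional ℝ E]

lemma christoffel_warpedForm (hl : IsWarpingOn lam I) (hG : IsMetricOn G V) {q : ℝ × E}
    (hq : q ∈ I ×ˢ V) (A B : ℝ × E) :
    christoffel (warpedForm lam G) q A B =
      (-(lam q.1 * deriv lam q.1 * G q.2 A.2 B.2),
        christoffel G q.2 A.2 B.2 + (deriv lam q.1 / lam q.1) • (A.1 • B.2 + B.1 • A.2)) := by
  have hpos := (hl.pos _ hq.1).ne'
  refine (isMetricOn_warpedForm hl hG).christoffel_unique hq (C := fun A B =>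
    (-(lam q.1 * deriv lam q.1 * G q.2 A.2 B.2),
      christoffel G q.2 A.2 B.2 + (deriv lam q.1 / lam q.1) • (A.1 • B.2 + B.1 • A.2))) ?_ ?_ A B
  · intro A B
    simp only [hG.symm _ hq.2 A.2, hG.christoffel_symm hq.2 A.2, add_comm]
  · intro A B C
    rw [fderiv_warpedForm_apply hl hG hq, hG.fderiv_apply hq.2]
    simp only [warpedForm_apply, map_add, map_smul, add_apply, smul_apply, smul_eq_mul]
    rw [hG.symm _ hq.2 B.2 A.2]
    field_simp
    ring

/-- The curvature tensor of the warped product. -/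
lemma curvature_warpedForm (hl : IsWarpingOn lam I) (hG : IsMetricOn G V) {q : ℝ × E}
    (hq : q ∈ I ×ˢ V) (A B C : ℝ × E) :
    curvature (warpedForm lam G) q A B C =
      (-(lam q.1 * deriv (deriv lam) q.1 * (A.1 * G q.2 B.2 C.2 - B.1 * G q.2 A.2 C.2)),
        curvature G q.2 A.2 B.2 C.2
          + (deriv (deriv lam) q.1 / lam q.1 * C.1) • (A.1 • B.2 - B.1 • A.2)
          - deriv lam q.1 ^ 2 • (G q.2 B.2 C.2 • A.2 - G q.2 A.2 C.2 • B.2)) := by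
  have hpos := (hl.pos _ hq.1).ne'
  -- the derivative of the Christoffel symbol `christoffel_warpedForm`
  have key : ∀ A B C : ℝ × E, fderiv ℝ (fun z => christoffel (warpedForm lam G) z B C) q A =
      (-((deriv lam q.1 ^ 2 + lam q.1 * deriv (deriv lam) q.1) * A.1 * G q.2 B.2 C.2
          + lam q.1 * deriv lam q.1 * fderiv ℝ G q.2 A.2 B.2 C.2),
        fderiv ℝ (fun z => christoffel G z B.2 C.2) q.2 A.2
          + (A.1 * (deriv (deriv lam) q.1 / lam q.1 - (deriv lam q.1 / lam q.1) ^ 2)) •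
            (B.1 • C.2 + C.1 • B.2)) := by
    intro A B C
    have h0 : (fun z => christoffel (warpedForm lam G) z B C) =ᶠ[𝓝 q] fun z =>
        (-(lam z.1 * deriv lam z.1 * G z.2 B.2 C.2),
          christoffel G z.2 B.2 C.2 + (deriv lam z.1 / lam z.1) • (B.1 • C.2 + C.1 • B.2)) := by
      filter_upwards [(isMetricOn_warpedForm hl hG).mem_nhds hq] with z hz
        using christoffel_warpedForm hl hG hz B C
    have h1 : HasFDerivAt (fun z : ℝ × E => lam z.1)
        (deriv lam q.1 • ContinuousLinearMap.fst ℝ ℝ E) q :=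
      (hl.hasDerivAt hq.1).comp_hasFDerivAt q hasFDerivAt_fst
    have h2 : HasFDerivAt (fun z : ℝ × E => deriv lam z.1)
        (deriv (deriv lam) q.1 • ContinuousLinearMap.fst ℝ ℝ E) q :=
      (hl.hasDerivAt_deriv hq.1).comp_hasFDerivAt q hasFDerivAt_fst
    have h3 : HasFDerivAt (fun z : ℝ × E => deriv lam z.1 / lam z.1)
        (((deriv (deriv lam) q.1 * lam q.1 - deriv lam q.1 * deriv lam q.1) / lam q.1 ^ 2) •
          ContinuousLinearMap.fst ℝ ℝ E) q :=
      ((hl.hasDerivAt_deriv hq.1).div (hl.hasDerivAt hq.1) hpos).comp_hasFDerivAt q hasFDerivAt_fst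
    have h4 : HasFDerivAt (fun z : ℝ × E => G z.2)
        ((fderiv ℝ G q.2).comp (ContinuousLinearMap.snd ℝ ℝ E)) q :=
      (hG.differentiableAt hq.2).hasFDerivAt.comp q hasFDerivAt_snd
    have h5 : HasFDerivAt (fun z : ℝ × E => christoffel G z.2 B.2 C.2)
        ((fderiv ℝ (fun z => christoffel G z B.2 C.2) q.2).comp
          (ContinuousLinearMap.snd ℝ ℝ E)) q :=
      ((hG.contDiffAt_christoffel hq.2 B.2 C.2).differentiableAt (by simp)).hasFDerivAt.comp q
        hasFDerivAt_snd
    have h6 := (((h1.mul h2).mul ((h4.clm_apply (hasFDerivAt_const B.2 q)).clm_apply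
      (hasFDerivAt_const C.2 q))).neg).prodMk (h5.add (h3.smul_const (B.1 • C.2 + C.1 • B.2)))
    rw [h0.fderiv_eq]
    refine (DFunLike.congr_fun h6.fderiv A).trans ?_
    refine Prod.ext ?_ ?_
    · simp
      ring
    · simp only [ContinuousLinearMap.prod_apply, add_apply, ContinuousLinearMap.smulRight_apply,
        smul_apply, ContinuousLinearMap.comp_apply, ContinuousLinearMap.coe_fst',
        ContinuousLinearMap.coe_snd', smul_eq_mul]
      congr 2
      field_simp
  have hL : ∀ a b : E, christoffelL G q.2 a b = christoffel G q.2 a b := christoffelL_apply G q.2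
  rw [curvature, key, key, christoffel_warpedForm hl hG hq, christoffel_warpedForm hl hG hq,
    christoffel_warpedForm hl hG hq, christoffel_warpedForm hl hG hq]
  refine Prod.ext ?_ ?_
  · simp only [Prod.fst_add, Prod.fst_sub, hG.fderiv_apply hq.2, map_add, map_smul, smul_eq_mul]
    rw [hG.symm _ hq.2 B.2 A.2, hG.christoffel_symm hq.2 B.2 A.2,
      hG.symm _ hq.2 A.2 (christoffel G q.2 B.2 C.2),
      hG.symm _ hq.2 B.2 (christoffel G q.2 A.2 C.2),
      hG.symm _ hq.2 (christoffel G q.2 A.2 B.2) C.2]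
    field_simp
    ring
  · simp only [Prod.snd_add, Prod.snd_sub, curvature]
    simp only [← hL, map_add, map_smul]
    rw [hL A.2 B.2, hL B.2 A.2, hG.christoffel_symm hq.2 B.2 A.2]
    generalize G q.2 B.2 C.2 = x1
    generalize G q.2 A.2 C.2 = x2
    match_scalars <;> field_simp <;> ring

end WarpedCoordinates

/-! ### Hypersurfaces of warped products -/

section WarpedHypersurface

lemma trace_prod {E : Type*} [AddCommGroup E] [Module ℝ E] [FiniteDimensional ℝ E]
    (Q : ℝ × E →ₗ[ℝ] ℝ × E) :
    LinearMap.trace ℝ (ℝ × E) Q = (Q (1, 0)).1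
      + LinearMap.trace ℝ E (LinearMap.snd ℝ ℝ E ∘ₗ Q ∘ₗ LinearMap.inr ℝ ℝ E) := by
  have hQ : Q = (Q ∘ₗ LinearMap.inl ℝ ℝ E) ∘ₗ LinearMap.fst ℝ ℝ E
      + (Q ∘ₗ LinearMap.inr ℝ ℝ E) ∘ₗ LinearMap.snd ℝ ℝ E := by
    refine LinearMap.ext fun v => ?_
    simp [← map_add]
  conv_lhs => rw [hQ]
  rw [map_add, LinearMap.trace_comp_comm' (LinearMap.fst ℝ ℝ E) (Q ∘ₗ LinearMap.inl ℝ ℝ E),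
    LinearMap.trace_comp_comm' (LinearMap.snd ℝ ℝ E) (Q ∘ₗ LinearMap.inr ℝ ℝ E)]
  congr 1
  rw [LinearMap.trace_eq_matrix_trace ℝ (Module.Basis.singleton Unit ℝ)]
  simp [Matrix.trace, LinearMap.toMatrix_apply]

variable {n : ℕ}

lemma trace_eq_sum_single (S : EuclideanSpace ℝ (Fin n) →ₗ[ℝ] EuclideanSpace ℝ (Fin n)) :
    LinearMap.trace ℝ _ S = ∑ i, S (EuclideanSpace.single i 1) i := by
  rw [LinearMap.trace_eq_matrix_trace ℝ (EuclideanSpace.basisFun (Fin n) ℝ).toBasis]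
  simp [Matrix.trace, LinearMap.toMatrix_apply]

variable {lam P : ℝ → ℝ}
  {G : EuclideanSpace ℝ (Fin n) →
    EuclideanSpace ℝ (Fin n) →L[ℝ] EuclideanSpace ℝ (Fin n) →L[ℝ] ℝ}
  {I : Set ℝ} {V : Set (EuclideanSpace ℝ (Fin n))}
  {F η : EuclideanSpace ℝ (Fin n) → ℝ × EuclideanSpace ℝ (Fin n)}
  {U : Set (EuclideanSpace ℝ (Fin n))} {y : EuclideanSpace ℝ (Fin n)}

lemma coordRicci_eq_trace (hG : IsMetricOn G V) (hy : y ∈ V) (b c : EuclideanSpace ℝ (Fin n)) :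
    coordRicci G y b c = LinearMap.trace ℝ _
      (curvatureEnd G y b c : EuclideanSpace ℝ (Fin n) →ₗ[ℝ] EuclideanSpace ℝ (Fin n)) := by
  rw [trace_eq_sum_single, coordRicci]
  simp only [ContinuousLinearMap.coe_coe, hG.curvatureEnd_apply hy]

/-- The endomorphism `A ↦ R(A, B) C` of the warped product, defined by the formula of
`curvature_warpedForm`. -/
def warpedCurvatureEnd (lam : ℝ → ℝ) (G : EuclideanSpace ℝ (Fin n) →
    EuclideanSpace ℝ (Fin n) →L[ℝ] EuclideanSpace ℝ (Fin n) →L[ℝ] ℝ)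
    (q B C : ℝ × EuclideanSpace ℝ (Fin n)) :
    ℝ × EuclideanSpace ℝ (Fin n) →ₗ[ℝ] ℝ × EuclideanSpace ℝ (Fin n) where
  toFun A := (-(lam q.1 * deriv (deriv lam) q.1 * (A.1 * G q.2 B.2 C.2 - B.1 * G q.2 A.2 C.2)),
    curvatureEnd G q.2 B.2 C.2 A.2
      + (deriv (deriv lam) q.1 / lam q.1 * C.1) • (A.1 • B.2 - B.1 • A.2)
      - deriv lam q.1 ^ 2 • (G q.2 B.2 C.2 • A.2 - G q.2 A.2 C.2 • B.2))
  map_add' A A' := by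
    refine Prod.ext ?_ ?_
    · simp; ring
    · simp only [Prod.fst_add, Prod.snd_add, map_add, add_apply]
      module
  map_smul' t A := by
    refine Prod.ext ?_ ?_
    · simp; ring
    · simp only [Prod.smul_fst, Prod.smul_snd, map_smul, smul_apply, smul_eq_mul, RingHom.id_apply]
      module

lemma warpedCurvatureEnd_apply (q B C A : ℝ × EuclideanSpace ℝ (Fin n)) :
    warpedCurvatureEnd lam G q B C A =
    (-(lam q.1 * deriv (deriv lam) q.1 * (A.1 * G q.2 B.2 C.2 - B.1 * G q.2 A.2 C.2)),
    curvatureEnd G q.2 B.2 C.2 A.2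
      + (deriv (deriv lam) q.1 / lam q.1 * C.1) • (A.1 • B.2 - B.1 • A.2)
      - deriv lam q.1 ^ 2 • (G q.2 B.2 C.2 • A.2 - G q.2 A.2 C.2 • B.2)) := rfl

/-- The Ricci tensor of the warped product. -/
lemma trace_warpedCurvatureEnd (hG : IsMetricOn G V) {q : ℝ × EuclideanSpace ℝ (Fin n)}
    (hq : q.2 ∈ V) (B C : ℝ × EuclideanSpace ℝ (Fin n)) :
    LinearMap.trace ℝ _ (warpedCurvatureEnd lam G q B C) =
      coordRicci G q.2 B.2 C.2 - n * (deriv (deriv lam) q.1 / lam q.1) * B.1 * C.1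
        - (lam q.1 * deriv (deriv lam) q.1 + (n - 1) * deriv lam q.1 ^ 2) * G q.2 B.2 C.2 := by
  have h1 : LinearMap.snd ℝ ℝ _ ∘ₗ warpedCurvatureEnd lam G q B C ∘ₗ LinearMap.inr ℝ ℝ _ =
      (curvatureEnd G q.2 B.2 C.2 : EuclideanSpace ℝ (Fin n) →ₗ[ℝ] EuclideanSpace ℝ (Fin n))
      - (deriv (deriv lam) q.1 / lam q.1 * C.1 * B.1 + deriv lam q.1 ^ 2 * G q.2 B.2 C.2) •
        LinearMap.id
      + deriv lam q.1 ^ 2 • LinearMap.smulRight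
        ((G q.2).flip C.2 : EuclideanSpace ℝ (Fin n) →ₗ[ℝ] ℝ) B.2 := by
    refine LinearMap.ext fun a => ?_
    simp only [LinearMap.comp_apply, LinearMap.inr_apply, warpedCurvatureEnd_apply,
      LinearMap.snd_apply, LinearMap.add_apply, LinearMap.sub_apply, LinearMap.smul_apply,
      ContinuousLinearMap.coe_coe, LinearMap.id_apply, LinearMap.smulRight_apply,
      ContinuousLinearMap.flip_apply]
    module
  rw [trace_prod, h1, map_add, map_sub, map_smul, map_smul, LinearMap.trace_smulRight,
    LinearMap.trace_id, ← coordRicci_eq_trace hG hq, warpedCurvatureEnd_apply]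
  simp
  ring

/-- For a unit normal `C` and the tangential part `B` of `lam ∂_r`, the Ricci term in the Laplacian
of the support function `u` is `-u` times the amount by which the Ricci curvature of `G` exceeds its
lower bound. -/
lemma ricci_term_eq (hl : IsWarpingOn lam I) (hG : IsMetricOn G V)
    {q : ℝ × EuclideanSpace ℝ (Fin n)} (hq : q ∈ I ×ˢ V) {C : ℝ × EuclideanSpace ℝ (Fin n)} {u : ℝ}
    (hC : warpedForm lam G q C C = 1) (hu : warpedForm lam G q (lam q.1, 0) C = u) :
    LinearMap.trace ℝ _ (warpedCurvatureEnd lam G q ((lam q.1, 0) - u • C) C)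
      - warpedForm lam G q (warpedCurvatureEnd lam G q ((lam q.1, 0) - u • C) C C) C =
      -u * (coordRicci G q.2 C.2 C.2
        - (n - 1) * (deriv lam q.1 ^ 2 - lam q.1 * deriv (deriv lam) q.1) * G q.2 C.2 C.2) := by
  have hpos := (hl.pos _ hq.1).ne'
  have hu' : u = lam q.1 * C.1 := by rw [← hu, warpedForm_apply]; simp
  have hRic : ∀ b c : EuclideanSpace ℝ (Fin n), coordRicci G q.2 (-(u • b)) c =
      -u * coordRicci G q.2 b c := by
    intro b c
    have h1 : curvatureEnd G q.2 (-(u • b)) c = -u • curvatureEnd G q.2 b c := by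
      ext a
      simp [curvatureEnd]
      ring
    rw [coordRicci_eq_trace hG hq.2, coordRicci_eq_trace hG hq.2, h1]
    simp
  have hR : curvatureEnd G q.2 (-(u • C.2)) C.2 C.2 = 0 := by
    rw [hG.curvatureEnd_apply hq.2, hG.curvature_eq hq.2]
    simp
  rw [warpedForm_apply] at hC
  rw [trace_warpedCurvatureEnd hG hq.2, warpedForm_apply, warpedCurvatureEnd_apply]
  simp only [Prod.fst_sub, Prod.snd_sub, Prod.smul_fst, Prod.smul_snd, zero_sub, hRic, hR, zero_add,
    map_neg, map_smul, map_sub, sub_apply, smul_apply, neg_apply, smul_eq_mul]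
  have h2 : lam q.1 ^ 2 * G q.2 C.2 C.2 = 1 - C.1 * C.1 := by linarith
  rw [hu']
  field_simp
  linear_combination (C.1 * n * deriv (deriv lam) q.1) * h2

lemma contDiffOn_potential (hl : IsWarpingOn lam I) (hP : ∀ r ∈ I, HasDerivAt P (lam r) r) :
    ContDiffOn ℝ ∞ P I := by
  have h0 : DifferentiableOn ℝ P I := fun r hr => (hP r hr).differentiableAt.differentiableWithinAt
  refine (contDiffOn_infty_iff_deriv_of_isOpen hl.isOpen).2 ⟨h0, ?_⟩
  exact hl.contDiffOn.congr fun r hr => (hP r hr).deriv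

/-- The field `lam ∂_r` of the warped product satisfies `∇_a (lam ∂_r) = lam' a`. -/
lemma covD_radial (hl : IsWarpingOn lam I) (hG : IsMetricOn G V)
    (h : IsHypersurface (warpedForm lam G) (I ×ˢ V) F η U) (hy : y ∈ U)
    (a : EuclideanSpace ℝ (Fin n)) :
    covD (warpedForm lam G) F (fun z => (lam (F z).1, 0)) y a =
      deriv lam (F y).1 • fderiv ℝ F y a := by
  have hr := (h.mapsTo hy).1
  have hF1 : HasFDerivAt (fun z => (F z).1)
      ((ContinuousLinearMap.fst ℝ ℝ (EuclideanSpace ℝ (Fin n))).comp (fderiv ℝ F y)) y :=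
    hasFDerivAt_fst.comp y ((h.contDiffAt hy).differentiableAt (by simp)).hasFDerivAt
  have h2 : HasFDerivAt (fun z => lam (F z).1) (deriv lam (F y).1 •
      (ContinuousLinearMap.fst ℝ ℝ (EuclideanSpace ℝ (Fin n))).comp (fderiv ℝ F y)) y :=
    (hl.hasDerivAt hr).comp_hasFDerivAt y hF1
  have h1 := h2.prodMk (hasFDerivAt_const (0 : EuclideanSpace ℝ (Fin n)) y)
  have hpos := (hl.pos _ hr).ne'
  rw [covD_apply, h1.fderiv, christoffelL_apply, christoffel_warpedForm hl hG (h.mapsTo hy),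
    ← christoffelL_apply]
  refine Prod.ext ?_ ?_
  · simp
  · simp [smul_smul, div_mul_cancel₀ _ hpos]

/-- The field `lam ∂_r` is closed and conformal; its potential is an antiderivative of `lam`. -/
lemma isConformalAlong_radial (hl : IsWarpingOn lam I) (hP : ∀ r ∈ I, HasDerivAt P (lam r) r)
    (hG : IsMetricOn G V) (h : IsHypersurface (warpedForm lam G) (I ×ˢ V) F η U) :
    IsConformalAlong (warpedForm lam G) F (fun z => (lam (F z).1, 0))
      (fun z => deriv lam (F z).1) (fun z => P (F z).1) U where
  contDiffAt y hy := by
    have h1 : ContDiffAt ℝ ∞ (fun z => (F z).1) y := contDiffAt_fst.comp y (h.contDiffAt hy)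
    have h2 : ContDiffAt ℝ ∞ (fun z => lam (F z).1) y := (hl.contDiffAt (h.mapsTo hy).1).comp y h1
    exact h2.prodMk contDiffAt_const
  covD_eq y hy a := covD_radial hl hG h hy a
  contDiffAt_potential y hy := by
    have h1 : ContDiffAt ℝ ∞ (fun z => (F z).1) y := contDiffAt_fst.comp y (h.contDiffAt hy)
    have h2 := (contDiffOn_potential hl hP).contDiffAt (hl.isOpen.mem_nhds (h.mapsTo hy).1)
    exact h2.comp y h1
  fderiv_potential y hy a := by
    have hF1 : HasFDerivAt (fun z => (F z).1)
        ((ContinuousLinearMap.fst ℝ ℝ (EuclideanSpace ℝ (Fin n))).comp (fderiv ℝ F y)) y :=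
      hasFDerivAt_fst.comp y ((h.contDiffAt hy).differentiableAt (by simp)).hasFDerivAt
    have h1 : HasFDerivAt (fun z => P (F z).1) (lam (F y).1 •
        (ContinuousLinearMap.fst ℝ ℝ (EuclideanSpace ℝ (Fin n))).comp (fderiv ℝ F y)) y :=
      (hP _ (h.mapsTo hy).1).comp_hasFDerivAt y hF1
    rw [h1.fderiv, warpedForm_apply]
    simp

/-- Under the lower Ricci bound, the Laplacian of a positive support function `u` is at most
`λ' τ - u τ² / n + dτ(∇Φ)`, where `τ` is the trace of the shape operator. -/
lemma lap_support_le (hn : 0 < n) (hl : IsWarpingOn lam I) (hP : ∀ r ∈ I, HasDerivAt P (lam r) r)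
    (hG : IsMetricOn G V) (h : IsHypersurface (warpedForm lam G) (I ×ˢ V) F η U) (hy : y ∈ U)
    (hu : 0 < warpedForm lam G (F y) (lam (F y).1, 0) (η y))
    (hRic : ∀ c, (n - 1) * (deriv lam (F y).1 ^ 2 - lam (F y).1 * deriv (deriv lam) (F y).1) *
      G (F y).2 c c ≤ coordRicci G (F y).2 c c) :
    lap (inducedMetric (warpedForm lam G) F)
        (fun z => warpedForm lam G (F z) (lam (F z).1, 0) (η z)) y ≤
      deriv lam (F y).1 * traceShape (warpedForm lam G) F η y
        - warpedForm lam G (F y) (lam (F y).1, 0) (η y) *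
            (traceShape (warpedForm lam G) F η y ^ 2 / n)
        + fderiv ℝ (traceShape (warpedForm lam G) F η) y
            (tanProj (warpedForm lam G) F y (lam (F y).1, 0)) := by
  have hY := isConformalAlong_radial hl hP hG h
  have hq := h.mapsTo hy
  have hB : fderiv ℝ F y (tanProj (warpedForm lam G) F y (lam (F y).1, 0)) =
      (lam (F y).1, 0) - warpedForm lam G (F y) (lam (F y).1, 0) (η y) • η y :=
    eq_sub_of_add_eq (h.decomp hy (lam (F y).1, 0)).symm
  have h1 := hY.lap_support h hy (Q := warpedCurvatureEnd lam G (F y)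
    ((lam (F y).1, 0) - warpedForm lam G (F y) (lam (F y).1, 0) (η y) • η y) (η y)) (by
      intro A
      rw [hB, curvature_warpedForm hl hG hq, warpedCurvatureEnd_apply, hG.curvatureEnd_apply hq.2])
  rw [ricci_term_eq hl hG hq (h.unit y hy) rfl] at h1
  have h2 := h.traceShape_sq_le hy
  rw [finrank_euclideanSpace_fin] at h2
  have hn' : (0 : ℝ) < n := by exact_mod_cast hn
  have h3 : traceShape (warpedForm lam G) F η y ^ 2 / n ≤ LinearMap.trace ℝ _
      ((shape (warpedForm lam G) F η y : EuclideanSpace ℝ (Fin n) →ₗ[ℝ] EuclideanSpace ℝ (Fin n)) *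
        (shape (warpedForm lam G) F η y : _ →ₗ[ℝ] _)) := by
    rw [div_le_iff₀' hn']; exact h2
  have h4 := mul_le_mul_of_nonneg_left h3 hu.le
  have h5 := mul_nonneg hu.le (sub_nonneg.2 (hRic (η y).2))
  rw [h1]
  linarith

/-- If the mean curvature is the power `u ^ (-p)` of the support function `u`, then the function
`f = u ^ (p + 1) / (p + 1) - P(r)` is a supersolution of a Laplace equation with drift; the excess
`(n - 1) p u ^ (p - 1) |du|²` is what makes `u` constant once `f` is. -/
lemma lap_add_drift_le (hn : 0 < n) (hl : IsWarpingOn lam I) (hP : ∀ r ∈ I, HasDerivAt P (lam r) r)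
    (hG : IsMetricOn G V) (h : IsHypersurface (warpedForm lam G) (I ×ˢ V) F η U) (hy : y ∈ U)
    {u : EuclideanSpace ℝ (Fin n) → ℝ}
    (hu : ∀ z, u z = warpedForm lam G (F z) (lam (F z).1, 0) (η z)) (hpos : 0 < u y)
    (hRic : ∀ c, (n - 1) * (deriv lam (F y).1 ^ 2 - lam (F y).1 * deriv (deriv lam) (F y).1) *
      G (F y).2 c c ≤ coordRicci G (F y).2 c c) {p : ℝ} (hp : 0 < p)
    (hτ : ∀ᶠ z in 𝓝 y, traceShape (warpedForm lam G) F η z = n * u z ^ (-p)) :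
    lap (inducedMetric (warpedForm lam G) F) (fun z => u z ^ (p + 1) / (p + 1) - P (F z).1) y
      + fderiv ℝ (fun z => u z ^ (p + 1) / (p + 1) - P (F z).1) y
        (-(n * p / u y) • (inducedMetric (warpedForm lam G) F y).inverse (fderiv ℝ u y)) ≤
      -((n - 1) * p * u y ^ (p - 1) * traceForm (inducedMetric (warpedForm lam G) F y)
        (tensorForm (fderiv ℝ u y) (fderiv ℝ u y))) := by
  have hY := isConformalAlong_radial hl hP hG h
  obtain rfl : u = fun z => warpedForm lam G (F z) (lam (F z).1, 0) (η z) := funext hu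
  have hle := lap_support_le hn hl hP hG h hy hpos hRic
  have hpot := hY.lap_potential h hy
  have huc := hY.contDiffAt_support h hy
  have hΦc := hY.contDiffAt_potential y hy
  have hdΦ := hY.fderiv_potential y hy
  set g := inducedMetric (warpedForm lam G) F with hg
  set u := fun z => warpedForm lam G (F z) (lam (F z).1, 0) (η z) with hudef
  set T := tanProj (warpedForm lam G) F y (lam (F y).1, 0) with hT
  have hux : warpedForm lam G (F y) (lam (F y).1, 0) (η y) = u y := rfl
  rw [hux] at hle hpot
  have hu0 := hpos.ne'
  have hpow : ∀ q t : ℝ, 0 < t → HasDerivAt (fun t : ℝ => t ^ q) (q * t ^ (q - 1)) t :=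
    fun q t ht => Real.hasDerivAt_rpow_const (Or.inl ht.ne')
  have hK : ∀ t : ℝ, 0 < t → HasDerivAt (fun t : ℝ => t ^ (p + 1) / (p + 1)) (t ^ p) t := by
    intro t ht
    have := (hpow (p + 1) t ht).div_const (p + 1)
    rw [add_sub_cancel_right, mul_div_cancel_left₀ _ (by positivity)] at this
    exact this
  have hKc : ContDiffAt ℝ ∞ (fun t : ℝ => t ^ (p + 1) / (p + 1)) (u y) :=
    (Real.contDiffAt_rpow_const_of_ne hu0).div_const _
  have hK2 : deriv (deriv (fun t : ℝ => t ^ (p + 1) / (p + 1))) (u y) = p * u y ^ (p - 1) := by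
    have : deriv (fun t : ℝ => t ^ (p + 1) / (p + 1)) =ᶠ[𝓝 (u y)] fun t => t ^ p := by
      filter_upwards [lt_mem_nhds hpos] with t ht using (hK t ht).deriv
    rw [this.deriv_eq, (hpow p _ hpos).deriv]
  have hud := (huc.differentiableAt (by simp)).hasFDerivAt
  -- the derivative of the trace of the shape operator along the gradient `T` of `P(r)`
  have hdτ : fderiv ℝ (traceShape (warpedForm lam G) F η) y T =
      -(n * p * u y ^ (-p - 1) * fderiv ℝ u y T) := by
    have h1 : HasFDerivAt (fun z => n * u z ^ (-p))
        ((n : ℝ) • ((-p * u y ^ (-p - 1)) • fderiv ℝ u y)) y :=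
      ((hpow (-p) _ hpos).comp_hasFDerivAt y hud).const_mul (n : ℝ)
    have h2 : traceShape (warpedForm lam G) F η =ᶠ[𝓝 y] fun z => n * u z ^ (-p) := hτ
    rw [h2.fderiv_eq, h1.fderiv]
    simp
    ring
  have hgT : ∀ v, fderiv ℝ (fun z => P (F z).1) y v = g y T v := fun v => by
    rw [hdΦ, hT, h.inducedMetric_tanProj hy]
  set ξ := (g y).inverse (fderiv ℝ u y) with hξ
  have hgξ : ∀ v, g y ξ v = fderiv ℝ u y v := fun v => by
    rw [hξ, apply_inverse_of_pos (h.pos hy)]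
  have hdu : fderiv ℝ u y ξ = traceForm (g y) (tensorForm (fderiv ℝ u y) (fderiv ℝ u y)) := by
    rw [traceForm_tensorForm]
  have hdf : ∀ v, fderiv ℝ (fun z => u z ^ (p + 1) / (p + 1) - P (F z).1) y v =
      u y ^ p * fderiv ℝ u y v - g y T v := by
    intro v
    have h1 : HasFDerivAt (fun z => u z ^ (p + 1) / (p + 1)) (u y ^ p • fderiv ℝ u y) y :=
      (hK _ hpos).comp_hasFDerivAt y hud
    rw [(h1.fun_sub (hΦc.differentiableAt (by simp)).hasFDerivAt).fderiv, sub_apply, hgT]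
    simp
  have hgTξ : g y T ξ = fderiv ℝ u y T := by
    rw [h.isMetricOn.symm y hy, hgξ]
  have hKu : ContDiffAt ℝ ∞ (fun z => u z ^ (p + 1) / (p + 1)) y := hKc.comp y huc
  rw [lap_sub hKu hΦc, lap_comp (ψ := fun t : ℝ => t ^ (p + 1) / (p + 1)) huc hKc,
    (hK _ hpos).deriv, hK2, hdf, map_smul, map_smul, smul_eq_mul, smul_eq_mul, hgTξ, hpot, hdu]
  rw [hdτ, hτ.self_of_nhds] at hle
  rw [hτ.self_of_nhds, finrank_euclideanSpace_fin]
  set D := traceForm (g y) (tensorForm (fderiv ℝ u y) (fderiv ℝ u y)) with hD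
  set d := fderiv ℝ u y T with hd
  have hup : 0 < u y ^ p := Real.rpow_pos_of_pos hpos p
  have e1 : u y ^ (-p) = (u y ^ p)⁻¹ := Real.rpow_neg hpos.le p
  have e2 : u y ^ (-p - 1) = (u y ^ p)⁻¹ / u y := by rw [Real.rpow_sub_one hu0, e1]
  have e3 : u y ^ (p - 1) = u y ^ p / u y := Real.rpow_sub_one hu0 p
  rw [e1, e2] at hle
  rw [e1, e3]
  have hn' : (0 : ℝ) < n := by exact_mod_cast hn
  have h6 := mul_le_mul_of_nonneg_left hle hup.le
  -- `lap_support_le` multiplied by `u ^ p = 1 / H`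
  have h7 : u y ^ p * (deriv lam (F y).1 * (n * (u y ^ p)⁻¹) - u y * ((n * (u y ^ p)⁻¹) ^ 2 / n)
      + -(n * p * ((u y ^ p)⁻¹ / u y) * d)) =
      n * deriv lam (F y).1 - u y * (n * (u y ^ p)⁻¹) - n * p / u y * d := by
    field_simp
    ring
  rw [h7] at h6
  have h8 : -(n * p / u y) * (u y ^ p * D) = -(n * p * (u y ^ p / u y) * D) := by ring
  linear_combination h6 + h8

end WarpedHypersurface

/-! ### Self-similar hypersurfaces in coordinates -/

section SelfSimilar

lemma hess_congr {E : Type*} [NormedAddCommGroup E] [NormedSpace ℝ E]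
    {g g' : E → E →L[ℝ] E →L[ℝ] ℝ} {f f' : E → ℝ} {y : E} (hg : g =ᶠ[𝓝 y] g') (hf : f =ᶠ[𝓝 y] f') :
    hess g f y = hess g' f' y := by
  simp only [hess, christoffelL, hf.fderiv_eq, hf.fderiv.fderiv_eq, hg.fderiv_eq, hg.eq_of_nhds]

lemma lap_congr {E : Type*} [NormedAddCommGroup E] [NormedSpace ℝ E]
    {g g' : E → E →L[ℝ] E →L[ℝ] ℝ} {f f' : E → ℝ} {y : E} (hg : g =ᶠ[𝓝 y] g') (hf : f =ᶠ[𝓝 y] f') :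
    lap g f y = lap g' f' y := by
  rw [lap, lap, hess_congr hg hf, hg.eq_of_nhds]

variable {n : ℕ}

/-- In suitable coordinates near `y`, the metric `g` is induced by a hypersurface of a warped
product on which `ρ` is the radial coordinate and `u` is the support function. At the point `y`
itself the mean curvature is `u ^ (-p)` and the lower Ricci bound holds. The coordinates `G`, `V` of
the fibre may depend on `y`, whereas `g`, `ρ` and `u` do not, which is why the equation for the mean
curvature is required only at `y`. -/
structure HasWarpedModel (lam : ℝ → ℝ) (I : Set ℝ) (p : ℝ)
    (g : EuclideanSpace ℝ (Fin n) →
      EuclideanSpace ℝ (Fin n) →L[ℝ] EuclideanSpace ℝ (Fin n) →L[ℝ] ℝ)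
    (ρ u : EuclideanSpace ℝ (Fin n) → ℝ) (y : EuclideanSpace ℝ (Fin n))
    (G : EuclideanSpace ℝ (Fin n) →
      EuclideanSpace ℝ (Fin n) →L[ℝ] EuclideanSpace ℝ (Fin n) →L[ℝ] ℝ)
    (V : Set (EuclideanSpace ℝ (Fin n)))
    (F η : EuclideanSpace ℝ (Fin n) → ℝ × EuclideanSpace ℝ (Fin n))
    (U : Set (EuclideanSpace ℝ (Fin n))) : Prop where
  mem : y ∈ U
  metric : IsMetricOn G V
  hypersurface : IsHypersurface (warpedForm lam G) (I ×ˢ V) F η U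
  induced_eq : ∀ z ∈ U, inducedMetric (warpedForm lam G) F z = g z
  radial_eq : ∀ z ∈ U, (F z).1 = ρ z
  support_eq : ∀ z ∈ U, warpedForm lam G (F z) (lam (F z).1, 0) (η z) = u z
  trace_eq : traceShape (warpedForm lam G) F η y = n * u y ^ (-p)
  ricci_le : ∀ c, (n - 1) * (deriv lam (F y).1 ^ 2 - lam (F y).1 * deriv (deriv lam) (F y).1) *
    G (F y).2 c c ≤ coordRicci G (F y).2 c c

variable {lam P : ℝ → ℝ} {I : Set ℝ} {p : ℝ}
  {g : EuclideanSpace ℝ (Fin n) →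
    EuclideanSpace ℝ (Fin n) →L[ℝ] EuclideanSpace ℝ (Fin n) →L[ℝ] ℝ}
  {ρ u : EuclideanSpace ℝ (Fin n) → ℝ} {U : Set (EuclideanSpace ℝ (Fin n))}
  {y : EuclideanSpace ℝ (Fin n)}

namespace HasWarpedModel

variable {G : EuclideanSpace ℝ (Fin n) →
      EuclideanSpace ℝ (Fin n) →L[ℝ] EuclideanSpace ℝ (Fin n) →L[ℝ] ℝ}
    {V : Set (EuclideanSpace ℝ (Fin n))}
    {F η : EuclideanSpace ℝ (Fin n) → ℝ × EuclideanSpace ℝ (Fin n)}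
    {U' : Set (EuclideanSpace ℝ (Fin n))} {z : EuclideanSpace ℝ (Fin n)}

lemma radial_mem (h : HasWarpedModel lam I p g ρ u y G V F η U') (hz : z ∈ U') : ρ z ∈ I := by
  rw [← h.radial_eq z hz]
  exact (h.hypersurface.mapsTo hz).1

lemma induced_eventuallyEq (h : HasWarpedModel lam I p g ρ u y G V F η U') (hz : z ∈ U') :
    inducedMetric (warpedForm lam G) F =ᶠ[𝓝 z] g := by
  filter_upwards [h.hypersurface.mem_nhds hz] with x hx using h.induced_eq x hx

lemma potential_eventuallyEq (h : HasWarpedModel lam I p g ρ u y G V F η U') (hz : z ∈ U') :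
    (fun x => P (F x).1) =ᶠ[𝓝 z] fun x => P (ρ x) := by
  filter_upwards [h.hypersurface.mem_nhds hz] with x hx
  rw [h.radial_eq x hx]

lemma support_eventuallyEq (h : HasWarpedModel lam I p g ρ u y G V F η U') (hz : z ∈ U') :
    (fun x => warpedForm lam G (F x) (lam (F x).1, 0) (η x)) =ᶠ[𝓝 z] u := by
  filter_upwards [h.hypersurface.mem_nhds hz] with x hx using h.support_eq x hx

/-- The trace of the shape operator is determined by the Laplacian of the potential, hence does not
depend on the model. -/
lemma lap_potential_eq (hl : IsWarpingOn lam I) (hP : ∀ r ∈ I, HasDerivAt P (lam r) r)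
    (h : HasWarpedModel lam I p g ρ u y G V F η U') (hz : z ∈ U') :
    lap g (fun x => P (ρ x)) z = deriv lam (ρ z) * n
      - u z * traceShape (warpedForm lam G) F η z := by
  rw [← lap_congr (h.induced_eventuallyEq hz) (h.potential_eventuallyEq hz),
    (isConformalAlong_radial hl hP h.metric h.hypersurface).lap_potential h.hypersurface hz,
    h.support_eq z hz, h.radial_eq z hz, finrank_euclideanSpace_fin]

lemma contDiffAt_support (hl : IsWarpingOn lam I) (hP : ∀ r ∈ I, HasDerivAt P (lam r) r)
    (h : HasWarpedModel lam I p g ρ u y G V F η U') : ContDiffAt ℝ ∞ u y :=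
  ((isConformalAlong_radial hl hP h.metric h.hypersurface).contDiffAt_support h.hypersurface
    h.mem).congr_of_eventuallyEq (h.support_eventuallyEq h.mem).symm

lemma contDiffAt_radial (h : HasWarpedModel lam I p g ρ u y G V F η U') : ContDiffAt ℝ ∞ ρ y := by
  have h1 : ContDiffAt ℝ ∞ (fun x => (F x).1) y :=
    contDiffAt_fst.comp y (h.hypersurface.contDiffAt h.mem)
  exact h1.congr_of_eventuallyEq (h.potential_eventuallyEq (P := id) h.mem).symm

lemma contDiffAt_potential (hl : IsWarpingOn lam I) (hP : ∀ r ∈ I, HasDerivAt P (lam r) r)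
    (h : HasWarpedModel lam I p g ρ u y G V F η U') : ContDiffAt ℝ ∞ (fun x => P (ρ x)) y :=
  ((isConformalAlong_radial hl hP h.metric h.hypersurface).contDiffAt_potential y
    h.mem).congr_of_eventuallyEq (h.potential_eventuallyEq h.mem).symm

end HasWarpedModel

/-- The drift `-(n p / u) ∇u` in the differential inequality for `u ^ (p + 1) / (p + 1) - P(ρ)`. -/
def drift (g : EuclideanSpace ℝ (Fin n) →
      EuclideanSpace ℝ (Fin n) →L[ℝ] EuclideanSpace ℝ (Fin n) →L[ℝ] ℝ)
    (p : ℝ) (u : EuclideanSpace ℝ (Fin n) → ℝ) (y : EuclideanSpace ℝ (Fin n)) :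
    EuclideanSpace ℝ (Fin n) :=
  -(n * p / u y) • (g y).inverse (fderiv ℝ u y)

/-- The function `u` is positive on the open set `U`, and every point of `U` has a warped model. -/
structure IsSelfSimilarOn (lam : ℝ → ℝ) (I : Set ℝ) (p : ℝ)
    (g : EuclideanSpace ℝ (Fin n) →
      EuclideanSpace ℝ (Fin n) →L[ℝ] EuclideanSpace ℝ (Fin n) →L[ℝ] ℝ)
    (ρ u : EuclideanSpace ℝ (Fin n) → ℝ) (U : Set (EuclideanSpace ℝ (Fin n))) : Prop where
  isOpen : IsOpen U
  pos : ∀ y ∈ U, 0 < u y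
  model : ∀ y ∈ U, ∃ G V F η U', HasWarpedModel lam I p g ρ u y G V F η U'

namespace IsSelfSimilarOn

lemma isMetricOn (h : IsSelfSimilarOn lam I p g ρ u U) : IsMetricOn g U where
  isOpen := h.isOpen
  contDiffOn y hy := by
    obtain ⟨G, V, F, η, U', hm⟩ := h.model y hy
    exact ((hm.hypersurface.isMetricOn.contDiffAt hm.mem).congr_of_eventuallyEq
      (hm.induced_eventuallyEq hm.mem).symm).contDiffWithinAt
  symm y hy := by
    obtain ⟨G, V, F, η, U', hm⟩ := h.model y hy
    rw [← hm.induced_eq y hm.mem]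
    exact hm.hypersurface.isMetricOn.symm y hm.mem
  pos y hy := by
    obtain ⟨G, V, F, η, U', hm⟩ := h.model y hy
    rw [← hm.induced_eq y hm.mem]
    exact hm.hypersurface.isMetricOn.pos y hm.mem

/-- In a model at one point, the mean curvature is `u ^ (-p)` also at the nearby points. -/
lemma traceShape_eq (hl : IsWarpingOn lam I) (hP : ∀ r ∈ I, HasDerivAt P (lam r) r)
    (h : IsSelfSimilarOn lam I p g ρ u U)
    {G : EuclideanSpace ℝ (Fin n) →
      EuclideanSpace ℝ (Fin n) →L[ℝ] EuclideanSpace ℝ (Fin n) →L[ℝ] ℝ}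
    {V : Set (EuclideanSpace ℝ (Fin n))}
    {F η : EuclideanSpace ℝ (Fin n) → ℝ × EuclideanSpace ℝ (Fin n)}
    {U' : Set (EuclideanSpace ℝ (Fin n))} (hm : HasWarpedModel lam I p g ρ u y G V F η U')
    {z : EuclideanSpace ℝ (Fin n)} (hz : z ∈ U) (hz' : z ∈ U') :
    traceShape (warpedForm lam G) F η z = n * u z ^ (-p) := by
  obtain ⟨G₁, V₁, F₁, η₁, U₁, hm₁⟩ := h.model z hz
  have h1 := hm.lap_potential_eq hl hP hz'
  rw [hm₁.lap_potential_eq hl hP hm₁.mem, hm₁.trace_eq] at h1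
  have h2 := h.pos z hz
  refine mul_left_cancel₀ h2.ne' ?_
  linarith

lemma contDiffAt_fun (hl : IsWarpingOn lam I) (hP : ∀ r ∈ I, HasDerivAt P (lam r) r)
    (h : IsSelfSimilarOn lam I p g ρ u U) (hy : y ∈ U) :
    ContDiffAt ℝ ∞ (fun z => u z ^ (p + 1) / (p + 1) - P (ρ z)) y := by
  obtain ⟨G, V, F, η, U', hm⟩ := h.model y hy
  exact (((hm.contDiffAt_support hl hP).rpow_const_of_ne (h.pos y hy).ne').div_const _).sub
    (hm.contDiffAt_potential hl hP)

lemma lap_add_drift_le (hn : 0 < n) (hp : 0 < p) (hl : IsWarpingOn lam I)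
    (hP : ∀ r ∈ I, HasDerivAt P (lam r) r) (h : IsSelfSimilarOn lam I p g ρ u U) (hy : y ∈ U) :
    lap g (fun z => u z ^ (p + 1) / (p + 1) - P (ρ z)) y
      + fderiv ℝ (fun z => u z ^ (p + 1) / (p + 1) - P (ρ z)) y (drift g p u y) ≤
      -((n - 1) * p * u y ^ (p - 1) * traceForm (g y)
        (tensorForm (fderiv ℝ u y) (fderiv ℝ u y))) := by
  obtain ⟨G, V, F, η, U', hm⟩ := h.model y hy
  have e1 := hm.support_eventuallyEq hm.mem
  have e2 := hm.potential_eventuallyEq (P := P) hm.mem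
  have e3 : (fun z => (fun x => warpedForm lam G (F x) (lam (F x).1, 0) (η x)) z ^ (p + 1) / (p + 1)
      - P (F z).1) =ᶠ[𝓝 y] fun z => u z ^ (p + 1) / (p + 1) - P (ρ z) := by
    filter_upwards [e1, e2] with z h1 h2
    beta_reduce
    rw [h1, h2]
  have h1 := WarpedProduct.lap_add_drift_le hn hl hP hm.metric hm.hypersurface hm.mem
    (u := fun x => warpedForm lam G (F x) (lam (F x).1, 0) (η x)) (fun _ => rfl)
    (by rw [hm.support_eq y hm.mem]; exact h.pos y hy) hm.ricci_le hp (by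
      filter_upwards [hm.hypersurface.mem_nhds hm.mem, h.isOpen.mem_nhds hy] with z hz hz'
      rw [traceShape_eq hl hP h hm hz' hz, hm.support_eq z hz])
  rw [lap_congr (hm.induced_eventuallyEq hm.mem) e3, e3.fderiv_eq, e1.fderiv_eq,
    hm.induced_eq y hm.mem] at h1
  simp only [e1.eq_of_nhds] at h1
  exact h1

/-- The strong maximum principle for `u ^ (p + 1) / (p + 1) - P(ρ)`. -/
lemma eventually_eq (hn : 0 < n) (hp : 0 < p) (hl : IsWarpingOn lam I)
    (hP : ∀ r ∈ I, HasDerivAt P (lam r) r) (h : IsSelfSimilarOn lam I p g ρ u U) (hy : y ∈ U)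
    (hmin : ∀ z ∈ U, u y ^ (p + 1) / (p + 1) - P (ρ y) ≤ u z ^ (p + 1) / (p + 1) - P (ρ z)) :
    ∀ᶠ z in 𝓝 y, u z ^ (p + 1) / (p + 1) - P (ρ z) = u y ^ (p + 1) / (p + 1) - P (ρ y) := by
  have hg := h.isMetricOn
  refine eventually_eq_of_lap_nonpos (f := fun z => u z ^ (p + 1) / (p + 1) - P (ρ z))
    (Z := drift g p u) hg ?_ (fun z hz => h.contDiffAt_fun hl hP hz) ?_ hy hmin
  · intro z hz
    obtain ⟨G, V, F, η, U', hm⟩ := h.model z hz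
    have huc := hm.contDiffAt_support hl hP
    exact (((continuousAt_const.div huc.continuousAt (h.pos z hz).ne').neg).smul
      ((hg.contDiffAt_inverse hz).continuousAt.clm_apply
        (huc.fderiv_right (m := ∞) (by simp)).continuousAt)).continuousWithinAt
  · intro z hz
    refine (h.lap_add_drift_le hn hp hl hP hz).trans (neg_nonpos.2 ?_)
    have h1 : (1 : ℝ) ≤ n := by exact_mod_cast hn
    have h2 := Real.rpow_nonneg (h.pos z hz).le (p - 1)
    have h3 : 0 ≤ traceForm (g z) (tensorForm (fderiv ℝ u z) (fderiv ℝ u z)) :=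
      traceForm_nonneg (hg.symm z hz) (hg.pos z hz) fun a => mul_self_nonneg _
    have h4 : (0 : ℝ) ≤ n - 1 := by linarith
    positivity

/-- Where `u ^ (p + 1) / (p + 1) - P(ρ)` is locally constant, the radial coordinate is
stationary. -/
lemma fderiv_radial_eq_zero (hn : 2 ≤ n) (hp : 0 < p) (hl : IsWarpingOn lam I)
    (hP : ∀ r ∈ I, HasDerivAt P (lam r) r) (h : IsSelfSimilarOn lam I p g ρ u U) (hy : y ∈ U)
    (hconst : ∀ᶠ z in 𝓝 y,
      u z ^ (p + 1) / (p + 1) - P (ρ z) = u y ^ (p + 1) / (p + 1) - P (ρ y)) :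
    fderiv ℝ ρ y = 0 := by
  have hg := h.isMetricOn
  have hle := h.lap_add_drift_le (by omega) hp hl hP hy
  have hdf : fderiv ℝ (fun z => u z ^ (p + 1) / (p + 1) - P (ρ z)) y = 0 := by
    rw [EventuallyEq.fderiv_eq hconst]; simp
  have hlap : lap g (fun z => u z ^ (p + 1) / (p + 1) - P (ρ z)) y = 0 := by
    rw [lap_congr (f' := fun _ => u y ^ (p + 1) / (p + 1) - P (ρ y)) EventuallyEq.rfl hconst, lap]
    have : hess g (fun _ => u y ^ (p + 1) / (p + 1) - P (ρ y)) y = 0 := by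
      ext a b
      have h0 : fderiv ℝ (fun _ : EuclideanSpace ℝ (Fin n) =>
        u y ^ (p + 1) / (p + 1) - P (ρ y)) = fun _ => 0 := by
        funext z; simp
      rw [hess_apply, h0]; simp
    rw [this]
    simp [traceForm]
  rw [hlap, hdf] at hle
  -- since `n ≥ 2`, the inequality forces `du = 0`
  have hdu : fderiv ℝ u y = 0 := by
    by_contra hne
    have h1 : (0 : ℝ) < n - 1 := by
      have : (2 : ℝ) ≤ n := by exact_mod_cast hn
      linarith
    have h2 := Real.rpow_pos_of_pos (h.pos y hy) (p - 1)
    have h3 := traceForm_tensorForm_self_pos (hg.pos y hy) hne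
    have h4 : 0 < (n - 1) * p * u y ^ (p - 1) *
      traceForm (g y) (tensorForm (fderiv ℝ u y) (fderiv ℝ u y)) := by positivity
    simp at hle
    linarith
  obtain ⟨G, V, F, η, U', hm⟩ := h.model y hy
  have hu1 : HasFDerivAt u (0 : EuclideanSpace ℝ (Fin n) →L[ℝ] ℝ) y := by
    rw [← hdu]
    exact ((hm.contDiffAt_support hl hP).differentiableAt (by simp)).hasFDerivAt
  have hρ1 := (hm.contDiffAt_radial.differentiableAt (by simp)).hasFDerivAt
  have hr := hm.radial_mem hm.mem
  have h1 : HasFDerivAt (fun z => P (ρ z)) (lam (ρ y) • fderiv ℝ ρ y) y :=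
    (hP _ hr).comp_hasFDerivAt y hρ1
  have h2 : HasFDerivAt (fun z => u z ^ (p + 1) / (p + 1)) (0 : EuclideanSpace ℝ (Fin n) →L[ℝ] ℝ)
      y := by
    have hK := (Real.hasDerivAt_rpow_const (p := p + 1) (Or.inl (h.pos y hy).ne')).div_const (p + 1)
    have h3 := hK.comp_hasFDerivAt y hu1
    rw [smul_zero] at h3
    exact h3
  rw [(h2.fun_sub h1).fderiv, zero_sub, neg_eq_zero, smul_eq_zero] at hdf
  exact hdf.resolve_left (hl.pos _ hr).ne'

end IsSelfSimilarOn

end SelfSimilar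

/-! ### Charts of manifolds without boundary -/

section Charts

variable {E : Type*} [NormedAddCommGroup E] [NormedSpace ℝ E] {H : Type*} [TopologicalSpace H]
  (I : ModelWithCorners ℝ E H) {B : Type*} [TopologicalSpace B] [ChartedSpace H B]

/-- The derivative at `q` of the chart at `p`. -/
def chartDeriv (p q : B) : E →L[ℝ] E := mfderiv I 𝓘(ℝ, E) (extChartAt I p) q

/-- The derivative at `y` of the inverse of the chart at `p`. -/
def chartSymmDeriv (p : B) (y : E) : E →L[ℝ] E := mfderiv 𝓘(ℝ, E) I (extChartAt I p).symm y

lemma chartMetric_apply (G : ∀ p : B, TangentSpace I p →L[ℝ] TangentSpace I p →L[ℝ] ℝ) (p : B)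
    (y v w : E) : chartMetric I G p y v w =
      G ((extChartAt I p).symm y) (chartSymmDeriv I p y v) (chartSymmDeriv I p y w) := rfl

variable [IsManifold I ∞ B]

lemma chartMetric_symm
    (g : Bundle.ContMDiffRiemannianMetric I ∞ E (fun p : B => TangentSpace I p)) (p : B)
    (y a b : E) : chartMetric I g.inner p y a b = chartMetric I g.inner p y b a :=
  g.symm ((extChartAt I p).symm y) (chartSymmDeriv I p y a) (chartSymmDeriv I p y b)

lemma chartDeriv_self (p : B) (v : E) : chartDeriv I p p v = v := by
  have : IsManifold I 1 B := IsManifold.of_le (n := ∞) (by simp)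
  exact DFunLike.congr_fun (mfderiv_extChartAt_self (I := I) (x := p)) v

/-- The coordinates of a smooth vector field along a map are smooth. -/
lemma contMDiffOn_chartDeriv {E' : Type*} [NormedAddCommGroup E'] [NormedSpace ℝ E']
    {H' : Type*} [TopologicalSpace H'] (J : ModelWithCorners ℝ E' H') {M : Type*}
    [TopologicalSpace M] [ChartedSpace H' M] {X : M → B} {ν : ∀ x, TangentSpace I (X x)}
    (hν : ContMDiff J I.tangent ∞ (fun x => (⟨X x, ν x⟩ : TangentBundle I B))) (p : B) :
    ContMDiffOn J 𝓘(ℝ, E) ∞ (fun x => chartDeriv I p (X x) (ν x))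
      (X ⁻¹' (chartAt H p).source) := by
  have : IsManifold I 1 B := IsManifold.of_le (n := ∞) (by simp)
  have h1 := ((trivializationAt E (TangentSpace I) p).contMDiffOn_iff
    (f := fun x => (⟨X x, ν x⟩ : TangentBundle I B)) (s := X ⁻¹' (chartAt H p).source)
    (fun x hx => by
      rw [Bundle.Trivialization.mem_source, TangentBundle.trivializationAt_baseSet]; exact hx)).1
    (hν.contMDiffOn)
  refine h1.2.congr fun x hx => ?_
  have h2 := TangentBundle.continuousLinearMapAt_trivializationAt (I := I) hx
  rw [chartDeriv, ← h2]
  exact ((trivializationAt E (TangentSpace I) p).continuousLinearMapAt_apply_of_mem (R := ℝ)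
      (by rw [TangentBundle.trivializationAt_baseSet]; exact hx) _)

variable [I.Boundaryless]

lemma chartDeriv_chartSymmDeriv {p : B} {y : E} (hy : y ∈ (extChartAt I p).target) (v : E) :
    chartDeriv I p ((extChartAt I p).symm y) (chartSymmDeriv I p y v) = v := by
  have : IsManifold I 1 B := IsManifold.of_le (n := ∞) (by simp)
  have h := mfderiv_extChartAt_comp_mfderivWithin_extChartAt_symm (I := I) hy
  rw [I.range_eq_univ, mfderivWithin_univ] at h
  exact DFunLike.congr_fun h v

lemma chartSymmDeriv_chartDeriv {p : B} {y : E} (hy : y ∈ (extChartAt I p).target) (v : E) :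
    chartSymmDeriv I p y (chartDeriv I p ((extChartAt I p).symm y) v) = v := by
  have : IsManifold I 1 B := IsManifold.of_le (n := ∞) (by simp)
  have h := mfderivWithin_extChartAt_symm_comp_mfderiv_extChartAt (I := I) hy
  rw [I.range_eq_univ, mfderivWithin_univ] at h
  exact DFunLike.congr_fun h v

lemma chartSymmDeriv_self (p : B) (v : E) : chartSymmDeriv I p (extChartAt I p p) v = v := by
  have : IsManifold I 1 B := IsManifold.of_le (n := ∞) (by simp)
  have h := mfderivWithin_range_extChartAt_symm (I := I) (x := p)
  rw [I.range_eq_univ, mfderivWithin_univ] at h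
  exact DFunLike.congr_fun h v

/-- The metric in coordinates, evaluated on the coordinates of tangent vectors at `q`. -/
lemma chartMetric_chartDeriv (G : ∀ p : B, TangentSpace I p →L[ℝ] TangentSpace I p →L[ℝ] ℝ)
    {p q : B} (hq : q ∈ (extChartAt I p).source) (v w : E) :
    chartMetric I G p (extChartAt I p q) (chartDeriv I p q v) (chartDeriv I p q w) = G q v w := by
  obtain ⟨y, hy, rfl⟩ : ∃ y ∈ (extChartAt I p).target, (extChartAt I p).symm y = q :=
    ⟨_, (extChartAt I p).map_source hq, (extChartAt I p).left_inv hq⟩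
  rw [(extChartAt I p).right_inv hy, chartMetric_apply, chartSymmDeriv_chartDeriv I hy,
    chartSymmDeriv_chartDeriv I hy]

/-- The constant vector field `a` of the chart at `p` is smooth. -/
lemma contMDiffOn_chartSymmDeriv (p : B) (a : E) :
    ContMDiffOn 𝓘(ℝ, E) I.tangent ∞ (fun y => (⟨(extChartAt I p).symm y, chartSymmDeriv I p y a⟩ :
      TangentBundle I B)) (extChartAt I p).target := by
  have : IsManifold I 1 B := IsManifold.of_le (n := ∞) (by simp)
  have hmem : ∀ y ∈ (extChartAt I p).target,
      (extChartAt I p).symm y ∈ (chartAt H p).source := fun y hy => by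
    rw [← extChartAt_source I]; exact (extChartAt I p).map_target hy
  refine ((trivializationAt E (TangentSpace I) p).contMDiffOn_iff ?_).2
    ⟨contMDiffOn_extChartAt_symm p, ?_⟩
  · intro y hy
    rw [Bundle.Trivialization.mem_source, TangentBundle.trivializationAt_baseSet]
    exact hmem y hy
  · refine (contMDiffOn_const (c := a)).congr fun y hy => ?_
    have h1 := TangentBundle.continuousLinearMapAt_trivializationAt (I := I) (hmem y hy)
    have h2 := chartDeriv_chartSymmDeriv I hy a
    rw [chartDeriv, ← h1] at h2
    refine Eq.trans ?_ h2
    exact ((trivializationAt E (TangentSpace I) p).continuousLinearMapAt_apply_of_mem (R := ℝ)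
      (by rw [TangentBundle.trivializationAt_baseSet]; exact hmem y hy)
      (chartSymmDeriv I p y a)).symm

lemma contDiffOn_chartMetric_apply
    (g : Bundle.ContMDiffRiemannianMetric I ∞ E (fun p : B => TangentSpace I p)) (p : B) (a b : E) :
    ContDiffOn ℝ ∞ (fun y => chartMetric I g.inner p y a b) (extChartAt I p).target := by
  rw [← contMDiffOn_iff_contDiffOn]
  intro y hy
  have h1 : ContMDiffWithinAt 𝓘(ℝ, E) (I.prod 𝓘(ℝ, ℝ)) ∞
      (fun y => Bundle.TotalSpace.mk' ℝ (E := Bundle.Trivial B ℝ) ((extChartAt I p).symm y)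
        (g.inner ((extChartAt I p).symm y) (chartSymmDeriv I p y a) (chartSymmDeriv I p y b)))
      (extChartAt I p).target y := by
    apply ContMDiffWithinAt.clm_bundle_apply₂ (F₁ := E) (F₂ := E)
    · exact ContMDiffAt.comp_contMDiffWithinAt y g.contMDiff.contMDiffAt
        (contMDiffOn_extChartAt_symm p y hy)
    · exact contMDiffOn_chartSymmDeriv I p a y hy
    · exact contMDiffOn_chartSymmDeriv I p b y hy
  simp only [Bundle.contMDiffWithinAt_totalSpace] at h1
  exact h1.2

lemma contDiffOn_chartMetric [FiniteDimensional ℝ E]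
    (g : Bundle.ContMDiffRiemannianMetric I ∞ E (fun p : B => TangentSpace I p)) (p : B) :
    ContDiffOn ℝ ∞ (chartMetric I g.inner p) (extChartAt I p).target := by
  refine contDiffOn_clm_apply.2 fun a => ?_
  refine contDiffOn_clm_apply.2 fun b => ?_
  exact contDiffOn_chartMetric_apply I g p a b

lemma chartMetric_pos
    (g : Bundle.ContMDiffRiemannianMetric I ∞ E (fun p : B => TangentSpace I p)) (p : B)
    {y : E} (hy : y ∈ (extChartAt I p).target) {a : E} (ha : a ≠ 0) :
    0 < chartMetric I g.inner p y a a := by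
  have h0 : chartSymmDeriv I p y a ≠ 0 := fun h0 => ha <| by
    rw [← chartDeriv_chartSymmDeriv I hy a, h0, map_zero]
  exact g.pos ((extChartAt I p).symm y) (chartSymmDeriv I p y a) h0

/-- A Riemannian metric in coordinates. -/
lemma isMetricOn_chartMetric [FiniteDimensional ℝ E]
    (g : Bundle.ContMDiffRiemannianMetric I ∞ E (fun p : B => TangentSpace I p)) (p : B) :
    IsMetricOn (chartMetric I g.inner p) (extChartAt I p).target where
  isOpen := isOpen_extChartAt_target p
  contDiffOn := contDiffOn_chartMetric I g p
  symm y _ := chartMetric_symm I g p y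
  pos _ hy _ ha := chartMetric_pos I g p hy ha

end Charts

/-! ### The warped product manifold in charts -/

section WarpedCharts

variable {n : ℕ} {N : Type*} [TopologicalSpace N] [ChartedSpace (EuclideanSpace ℝ (Fin n)) N]

lemma extChartAt_warped_apply (p q : ℝ × N) :
    extChartAt (𝓘(ℝ, ℝ).prod (𝓡 n)) p q = (q.1, extChartAt (𝓡 n) p.2 q.2) := by
  rw [extChartAt_prod]
  simp [chartAt_self_eq]

lemma mem_extChartAt_warped_source {p q : ℝ × N} :
    q ∈ (extChartAt (𝓘(ℝ, ℝ).prod (𝓡 n)) p).source ↔ q.2 ∈ (extChartAt (𝓡 n) p.2).source := by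
  rw [extChartAt_prod]
  simp [chartAt_self_eq]

lemma warpedMetric_apply (lam : ℝ → ℝ)
    (g : ∀ p : N, TangentSpace (𝓡 n) p →L[ℝ] TangentSpace (𝓡 n) p →L[ℝ] ℝ) (q : ℝ × N)
    (v w : ℝ × EuclideanSpace ℝ (Fin n)) :
    warpedMetric lam g q v w = v.1 * w.1 + lam q.1 ^ 2 * g q.2 v.2 w.2 := rfl

variable [IsManifold (𝓡 n) ∞ N]

lemma chartDeriv_warped_apply {p q : ℝ × N}
    (hq : q ∈ (extChartAt (𝓘(ℝ, ℝ).prod (𝓡 n)) p).source) (v : ℝ × EuclideanSpace ℝ (Fin n)) :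
    chartDeriv (𝓘(ℝ, ℝ).prod (𝓡 n)) p q v = (v.1, chartDeriv (𝓡 n) p.2 q.2 v.2) := by
  have : IsManifold (𝓡 n) 1 N := IsManifold.of_le (n := ∞) (by simp)
  have h0 := mem_extChartAt_warped_source.1 hq
  rw [extChartAt_source] at hq h0
  have hC := (mdifferentiableAt_extChartAt (I := 𝓘(ℝ, ℝ).prod (𝓡 n)) hq).hasMFDerivAt
  have hN := (mdifferentiableAt_extChartAt (I := 𝓡 n) h0).hasMFDerivAt
  refine Prod.ext ?_ ?_
  · have h1 := ((ContinuousLinearMap.fst ℝ ℝ (EuclideanSpace ℝ (Fin n))).hasMFDerivAt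
      (x := extChartAt (𝓘(ℝ, ℝ).prod (𝓡 n)) p q)).comp q hC
    have h2 : (ContinuousLinearMap.fst ℝ ℝ (EuclideanSpace ℝ (Fin n))) ∘
        extChartAt (𝓘(ℝ, ℝ).prod (𝓡 n)) p = Prod.fst := by
      funext z
      simp only [Function.comp_apply, extChartAt_warped_apply]
      rfl
    rw [h2] at h1
    exact DFunLike.congr_fun (hasMFDerivAt_unique h1 (hasMFDerivAt_fst q)) v
  · have h1 := ((ContinuousLinearMap.snd ℝ ℝ (EuclideanSpace ℝ (Fin n))).hasMFDerivAt
      (x := extChartAt (𝓘(ℝ, ℝ).prod (𝓡 n)) p q)).comp q hC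
    have h2 : (ContinuousLinearMap.snd ℝ ℝ (EuclideanSpace ℝ (Fin n))) ∘
        extChartAt (𝓘(ℝ, ℝ).prod (𝓡 n)) p = extChartAt (𝓡 n) p.2 ∘ Prod.snd := by
      funext z
      simp only [Function.comp_apply, extChartAt_warped_apply]
      rfl
    rw [h2] at h1
    exact DFunLike.congr_fun (hasMFDerivAt_unique h1 (hN.comp q (hasMFDerivAt_snd q))) v

/-- The warped product metric in coordinates, evaluated on the coordinates of tangent vectors. -/
lemma warpedForm_chartDeriv (lam : ℝ → ℝ)
    (g : ∀ p : N, TangentSpace (𝓡 n) p →L[ℝ] TangentSpace (𝓡 n) p →L[ℝ] ℝ) {p q : ℝ × N}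
    (hq : q ∈ (extChartAt (𝓘(ℝ, ℝ).prod (𝓡 n)) p).source) (v w : ℝ × EuclideanSpace ℝ (Fin n)) :
    warpedForm lam (chartMetric (𝓡 n) g p.2) (extChartAt (𝓘(ℝ, ℝ).prod (𝓡 n)) p q)
      (chartDeriv (𝓘(ℝ, ℝ).prod (𝓡 n)) p q v) (chartDeriv (𝓘(ℝ, ℝ).prod (𝓡 n)) p q w) =
        warpedMetric lam g q v w := by
  rw [chartDeriv_warped_apply hq, chartDeriv_warped_apply hq, extChartAt_warped_apply,
    warpedForm_apply, warpedMetric_apply]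
  rw [chartMetric_chartDeriv (𝓡 n) g (mem_extChartAt_warped_source.1 hq)]

lemma chartMetric_warpedMetric (lam : ℝ → ℝ)
    (g : ∀ p : N, TangentSpace (𝓡 n) p →L[ℝ] TangentSpace (𝓡 n) p →L[ℝ] ℝ) {p : ℝ × N}
    {y : ℝ × EuclideanSpace ℝ (Fin n)}
    (hy : y ∈ (extChartAt (𝓘(ℝ, ℝ).prod (𝓡 n)) p).target) :
    chartMetric (𝓘(ℝ, ℝ).prod (𝓡 n)) (warpedMetric lam g) p y =
      warpedForm lam (chartMetric (𝓡 n) g p.2) y := by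
  refine ContinuousLinearMap.ext fun v => ContinuousLinearMap.ext fun w => ?_
  rw [chartMetric_apply, ← warpedForm_chartDeriv lam g ((extChartAt _ p).map_target hy),
    (extChartAt _ p).right_inv hy, chartDeriv_chartSymmDeriv _ hy, chartDeriv_chartSymmDeriv _ hy]

end WarpedCharts

/-! ### Immersed hypersurfaces in charts -/

section ImmersionCharts

variable {n : ℕ} {N : Type*} [TopologicalSpace N] [ChartedSpace (EuclideanSpace ℝ (Fin n)) N]
  {M : Type*} [TopologicalSpace M] [ChartedSpace (EuclideanSpace ℝ (Fin n)) M]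

/-- The map `X` in the charts at `x₀` and `p`. -/
def localMap (X : M → ℝ × N) (x₀ : M) (p : ℝ × N) (y : EuclideanSpace ℝ (Fin n)) :
    ℝ × EuclideanSpace ℝ (Fin n) :=
  extChartAt (𝓘(ℝ, ℝ).prod (𝓡 n)) p (X ((extChartAt (𝓡 n) x₀).symm y))

/-- The components of the vector field `ν` along `X` in the charts at `x₀` and `p`. -/
def localField (X : M → ℝ × N) (ν : ∀ x : M, TangentSpace (𝓘(ℝ, ℝ).prod (𝓡 n)) (X x)) (x₀ : M)
    (p : ℝ × N) (y : EuclideanSpace ℝ (Fin n)) : ℝ × EuclideanSpace ℝ (Fin n) :=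
  chartDeriv (𝓘(ℝ, ℝ).prod (𝓡 n)) p (X ((extChartAt (𝓡 n) x₀).symm y))
    (ν ((extChartAt (𝓡 n) x₀).symm y))

/-- The domain on which `X` is defined in the charts at `x₀` and `p`. -/
def localDomain (X : M → ℝ × N) (x₀ : M) (p : ℝ × N) : Set (EuclideanSpace ℝ (Fin n)) :=
  (extChartAt (𝓡 n) x₀).target ∩
    (fun y => X ((extChartAt (𝓡 n) x₀).symm y)) ⁻¹' (extChartAt (𝓘(ℝ, ℝ).prod (𝓡 n)) p).source

/-- The differential of `X` as a linear map between the model spaces. -/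
def diffMap (X : M → ℝ × N) (x : M) :
    EuclideanSpace ℝ (Fin n) →L[ℝ] ℝ × EuclideanSpace ℝ (Fin n) :=
  mfderiv (𝓡 n) (𝓘(ℝ, ℝ).prod (𝓡 n)) X x

/-- The metric induced by `X` in the chart at `x₀`. Unlike `localMap`, it does not involve a
chart of the warped product. -/
def localMetric (lam : ℝ → ℝ)
    (g : ∀ p : N, TangentSpace (𝓡 n) p →L[ℝ] TangentSpace (𝓡 n) p →L[ℝ] ℝ) (X : M → ℝ × N)
    (x₀ : M) (y : EuclideanSpace ℝ (Fin n)) :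
    EuclideanSpace ℝ (Fin n) →L[ℝ] EuclideanSpace ℝ (Fin n) →L[ℝ] ℝ :=
  pullbackForm (𝓘(ℝ, ℝ).prod (𝓡 n)) (warpedMetric lam g (X ((extChartAt (𝓡 n) x₀).symm y)))
    ((diffMap X ((extChartAt (𝓡 n) x₀).symm y)).comp (chartSymmDeriv (𝓡 n) x₀ y))

lemma localMetric_apply (lam : ℝ → ℝ)
    (g : ∀ p : N, TangentSpace (𝓡 n) p →L[ℝ] TangentSpace (𝓡 n) p →L[ℝ] ℝ) (X : M → ℝ × N)
    (x₀ : M) (y a b : EuclideanSpace ℝ (Fin n)) :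
    localMetric lam g X x₀ y a b = warpedMetric lam g (X ((extChartAt (𝓡 n) x₀).symm y))
      (diffMap X ((extChartAt (𝓡 n) x₀).symm y) (chartSymmDeriv (𝓡 n) x₀ y a))
      (diffMap X ((extChartAt (𝓡 n) x₀).symm y) (chartSymmDeriv (𝓡 n) x₀ y b)) := rfl

lemma mapsTo_localDomain {X : M → ℝ × N} {x₀ : M} {p : ℝ × N} :
    MapsTo (fun y => X ((extChartAt (𝓡 n) x₀).symm y)) (localDomain (n := n) X x₀ p)
    (chartAt (ModelProd ℝ (EuclideanSpace ℝ (Fin n))) p).source := fun y hy => by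
  rw [← extChartAt_source (𝓘(ℝ, ℝ).prod (𝓡 n))]; exact hy.2

lemma isOpen_localDomain {X : M → ℝ × N} {x₀ : M} {p : ℝ × N}
    (hX : Continuous X) : IsOpen (localDomain (n := n) X x₀ p) :=
  (hX.comp_continuousOn (continuousOn_extChartAt_symm x₀)).isOpen_inter_preimage
    (isOpen_extChartAt_target x₀) (isOpen_extChartAt_source p)

/-- `X` is an immersed hypersurface, with smooth unit normal field `ν`, of the warped product
`I ×_lam N`. -/
structure IsWarpedHypersurface [IsManifold (𝓡 n) ∞ N] (lam : ℝ → ℝ) (I : Set ℝ)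
    (g : Bundle.ContMDiffRiemannianMetric (𝓡 n) ∞ (EuclideanSpace ℝ (Fin n))
      (fun p : N => TangentSpace (𝓡 n) p)) (X : M → ℝ × N)
    (ν : ∀ x : M, TangentSpace (𝓘(ℝ, ℝ).prod (𝓡 n)) (X x)) : Prop where
  warping : IsWarpingOn lam I
  mem : ∀ x, (X x).1 ∈ I
  contMDiff : ContMDiff (𝓡 n) (𝓘(ℝ, ℝ).prod (𝓡 n)) ∞ X
  injective : ∀ x, Function.Injective (mfderiv (𝓡 n) (𝓘(ℝ, ℝ).prod (𝓡 n)) X x)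
  contMDiff_normal : ContMDiff (𝓡 n) (𝓘(ℝ, ℝ).prod (𝓡 n)).tangent ∞
    (fun x => (⟨X x, ν x⟩ : TangentBundle (𝓘(ℝ, ℝ).prod (𝓡 n)) (ℝ × N)))
  unit : ∀ x, warpedMetric lam g.inner (X x) (ν x) (ν x) = 1
  normal : ∀ (x : M) (v : TangentSpace (𝓡 n) x), warpedMetric lam g.inner (X x) (ν x)
    (mfderiv (𝓡 n) (𝓘(ℝ, ℝ).prod (𝓡 n)) X x v) = 0

variable [IsManifold (𝓡 n) ∞ N] {X : M → ℝ × N} {x₀ : M} {p : ℝ × N}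
  {y : EuclideanSpace ℝ (Fin n)} {ν : ∀ x : M, TangentSpace (𝓘(ℝ, ℝ).prod (𝓡 n)) (X x)}
  {lam : ℝ → ℝ} {I : Set ℝ}
  {g : Bundle.ContMDiffRiemannianMetric (𝓡 n) ∞ (EuclideanSpace ℝ (Fin n))
      (fun p : N => TangentSpace (𝓡 n) p)}

/-- The support function in coordinates. -/
lemma warpedForm_localField (hy : y ∈ localDomain X x₀ p) :
    warpedForm lam (chartMetric (𝓡 n) g.inner p.2) (localMap X x₀ p y)
      (lam (localMap X x₀ p y).1, 0) (localField X ν x₀ p y) =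
    warpedMetric lam g.inner (X ((extChartAt (𝓡 n) x₀).symm y))
      (radialField lam (X ((extChartAt (𝓡 n) x₀).symm y))) (ν ((extChartAt (𝓡 n) x₀).symm y)) := by
  have hq : X ((extChartAt (𝓡 n) x₀).symm y) ∈
    (extChartAt (𝓘(ℝ, ℝ).prod (𝓡 n)) p).source := hy.2
  have h1 : chartDeriv (𝓘(ℝ, ℝ).prod (𝓡 n)) p (X ((extChartAt (𝓡 n) x₀).symm y))
      (lam (X ((extChartAt (𝓡 n) x₀).symm y)).1, 0) =
      (lam (localMap X x₀ p y).1, 0) := by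
    rw [chartDeriv_warped_apply hq, map_zero, localMap, extChartAt_warped_apply]
  rw [← h1]
  exact warpedForm_chartDeriv lam g.inner hq _ _

variable [IsManifold (𝓡 n) ∞ M]

lemma contDiffOn_localMap (hX : ContMDiff (𝓡 n) (𝓘(ℝ, ℝ).prod (𝓡 n)) ∞ X) :
    ContDiffOn ℝ ∞ (localMap (n := n) X x₀ p) (localDomain X x₀ p) := by
  rw [← contMDiffOn_iff_contDiffOn]
  have h1 : ContMDiffOn 𝓘(ℝ, EuclideanSpace ℝ (Fin n)) (𝓘(ℝ, ℝ).prod (𝓡 n)) ∞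
      (fun y => X ((extChartAt (𝓡 n) x₀).symm y)) (localDomain X x₀ p) :=
    hX.comp_contMDiffOn ((contMDiffOn_extChartAt_symm x₀).mono inter_subset_left)
  exact (contMDiffOn_extChartAt (I := 𝓘(ℝ, ℝ).prod (𝓡 n)) (x := p)).comp h1 mapsTo_localDomain

lemma contDiffOn_localField
    (hν : ContMDiff (𝓡 n) (𝓘(ℝ, ℝ).prod (𝓡 n)).tangent ∞
      (fun x => (⟨X x, ν x⟩ : TangentBundle (𝓘(ℝ, ℝ).prod (𝓡 n)) (ℝ × N)))) :
    ContDiffOn ℝ ∞ (localField X ν x₀ p) (localDomain X x₀ p) := by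
  rw [← contMDiffOn_iff_contDiffOn]
  have h1 : ContMDiffOn 𝓘(ℝ, EuclideanSpace ℝ (Fin n)) (𝓡 n) ∞
      (extChartAt (𝓡 n) x₀).symm (localDomain X x₀ p) :=
    (contMDiffOn_extChartAt_symm x₀).mono inter_subset_left
  exact (contMDiffOn_chartDeriv (𝓘(ℝ, ℝ).prod (𝓡 n)) (𝓡 n) hν p).comp h1 mapsTo_localDomain

lemma hasFDerivAt_localMap (hX : ContMDiff (𝓡 n) (𝓘(ℝ, ℝ).prod (𝓡 n)) ∞ X)
    (hy : y ∈ localDomain X x₀ p) :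
    HasFDerivAt (localMap X x₀ p)
      ((chartDeriv (𝓘(ℝ, ℝ).prod (𝓡 n)) p (X ((extChartAt (𝓡 n) x₀).symm y))).comp
        ((diffMap X ((extChartAt (𝓡 n) x₀).symm y)).comp (chartSymmDeriv (𝓡 n) x₀ y))) y := by
  have i1 : IsManifold (𝓡 n) 1 N := IsManifold.of_le (n := ∞) (by simp)
  have i2 : IsManifold (𝓡 n) 1 M := IsManifold.of_le (n := ∞) (by simp)
  have h1 := (mdifferentiableAt_extChartAt (I := 𝓘(ℝ, ℝ).prod (𝓡 n))
    (mapsTo_localDomain hy)).hasMFDerivAt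
  have h2 := (hX.mdifferentiable (by simp) ((extChartAt (𝓡 n) x₀).symm y)).hasMFDerivAt
  have h3 := mdifferentiableWithinAt_extChartAt_symm (I := 𝓡 n) hy.1
  rw [(𝓡 n).range_eq_univ, mdifferentiableWithinAt_univ] at h3
  exact (h1.comp y (h2.comp y h3.hasMFDerivAt)).hasFDerivAt

lemma fderiv_localMap_apply (hX : ContMDiff (𝓡 n) (𝓘(ℝ, ℝ).prod (𝓡 n)) ∞ X)
    (hy : y ∈ localDomain X x₀ p) (a : EuclideanSpace ℝ (Fin n)) :
    fderiv ℝ (localMap X x₀ p) y a =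
      chartDeriv (𝓘(ℝ, ℝ).prod (𝓡 n)) p (X ((extChartAt (𝓡 n) x₀).symm y))
        (diffMap X ((extChartAt (𝓡 n) x₀).symm y) (chartSymmDeriv (𝓡 n) x₀ y a)) := by
  rw [(hasFDerivAt_localMap hX hy).fderiv]; rfl

lemma inducedMetric_localMap (hX : ContMDiff (𝓡 n) (𝓘(ℝ, ℝ).prod (𝓡 n)) ∞ X)
    (hy : y ∈ localDomain X x₀ p) :
    inducedMetric (warpedForm lam (chartMetric (𝓡 n) g.inner p.2)) (localMap X x₀ p) y =
      localMetric lam g.inner X x₀ y := by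
  refine ContinuousLinearMap.ext fun a => ContinuousLinearMap.ext fun b => ?_
  rw [inducedMetric_apply, fderiv_localMap_apply hX hy, fderiv_localMap_apply hX hy,
    localMetric_apply, localMap, warpedForm_chartDeriv lam g.inner hy.2]

lemma injective_chartDeriv {p q : ℝ × N}
    (hq : q ∈ (extChartAt (𝓘(ℝ, ℝ).prod (𝓡 n)) p).source) :
    Function.Injective (chartDeriv (𝓘(ℝ, ℝ).prod (𝓡 n)) p q) := by
  obtain ⟨y, hy, rfl⟩ : ∃ y ∈ (extChartAt (𝓘(ℝ, ℝ).prod (𝓡 n)) p).target,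
      (extChartAt (𝓘(ℝ, ℝ).prod (𝓡 n)) p).symm y = q :=
    ⟨_, (extChartAt _ p).map_source hq, (extChartAt _ p).left_inv hq⟩
  intro v w hvw
  rw [← chartSymmDeriv_chartDeriv (𝓘(ℝ, ℝ).prod (𝓡 n)) hy v, hvw,
    chartSymmDeriv_chartDeriv (𝓘(ℝ, ℝ).prod (𝓡 n)) hy w]

/-- A hypersurface of a warped product is a hypersurface in coordinates. -/
lemma IsWarpedHypersurface.isHypersurface_localMap (h : IsWarpedHypersurface lam I g X ν) :
    IsHypersurface (warpedForm lam (chartMetric (𝓡 n) g.inner p.2))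
      (I ×ˢ (extChartAt (𝓡 n) p.2).target) (localMap X x₀ p) (localField X ν x₀ p)
      (localDomain X x₀ p) where
  metric := isMetricOn_warpedForm h.warping (isMetricOn_chartMetric (𝓡 n) g p.2)
  isOpen := isOpen_localDomain h.contMDiff.continuous
  mapsTo y hy := by
    rw [localMap, extChartAt_warped_apply]
    exact ⟨h.mem _, (extChartAt (𝓡 n) p.2).map_source (mem_extChartAt_warped_source.1 hy.2)⟩
  contDiffOn := contDiffOn_localMap h.contMDiff
  contDiffOn_normal := contDiffOn_localField h.contMDiff_normal
  injective y hy := by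
    rw [injective_iff_map_eq_zero]
    intro a ha
    rw [fderiv_localMap_apply h.contMDiff hy] at ha
    have h1 := injective_chartDeriv hy.2 (ha.trans (map_zero _).symm)
    have h2 : chartSymmDeriv (𝓡 n) x₀ y a = 0 := h.injective _ (h1.trans (map_zero _).symm)
    rw [← chartDeriv_chartSymmDeriv (𝓡 n) hy.1 a, h2, map_zero]
  unit y hy := by
    have hq : X ((extChartAt (𝓡 n) x₀).symm y) ∈
      (extChartAt (𝓘(ℝ, ℝ).prod (𝓡 n)) p).source := hy.2
    exact (warpedForm_chartDeriv lam g.inner hq _ _).trans (h.unit _)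
  normal y hy a := by
    have hq : X ((extChartAt (𝓡 n) x₀).symm y) ∈
      (extChartAt (𝓘(ℝ, ℝ).prod (𝓡 n)) p).source := hy.2
    rw [fderiv_localMap_apply h.contMDiff hy]
    exact (warpedForm_chartDeriv lam g.inner hq _ _).trans (h.normal _ _)
  finrank_eq := by
    rw [Module.finrank_prod, Module.finrank_self, add_comm]

end ImmersionCharts

/-! ### The mean curvature in charts -/

section MeanCurvature

variable {n : ℕ} {N : Type*} [TopologicalSpace N] [ChartedSpace (EuclideanSpace ℝ (Fin n)) N]
  {M : Type*} [TopologicalSpace M] [ChartedSpace (EuclideanSpace ℝ (Fin n)) M]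

/-- The derivative at `x` of the components of the vector field `ν` in the chart at `p`. -/
def fieldDeriv (X : M → ℝ × N) (ν : ∀ x : M, TangentSpace (𝓘(ℝ, ℝ).prod (𝓡 n)) (X x))
    (p : ℝ × N) (x : M) : EuclideanSpace ℝ (Fin n) →L[ℝ] ℝ × EuclideanSpace ℝ (Fin n) :=
  mfderiv (𝓡 n) 𝓘(ℝ, ℝ × EuclideanSpace ℝ (Fin n))
    (fun x' => chartDeriv (𝓘(ℝ, ℝ).prod (𝓡 n)) p (X x') (ν x')) x

lemma self_mem_localDomain {X : M → ℝ × N} {x₀ : M} {y : EuclideanSpace ℝ (Fin n)}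
    (hy : y ∈ (extChartAt (𝓡 n) x₀).target) :
    y ∈ localDomain X x₀ (X ((extChartAt (𝓡 n) x₀).symm y)) :=
  ⟨hy, mem_extChartAt_source _⟩

variable [IsManifold (𝓡 n) ∞ N] [IsManifold (𝓡 n) ∞ M] {X : M → ℝ × N} {x₀ : M} {p : ℝ × N}
  {y : EuclideanSpace ℝ (Fin n)} {ν : ∀ x : M, TangentSpace (𝓘(ℝ, ℝ).prod (𝓡 n)) (X x)}
  {lam : ℝ → ℝ} {I : Set ℝ}
  {g : Bundle.ContMDiffRiemannianMetric (𝓡 n) ∞ (EuclideanSpace ℝ (Fin n))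
      (fun p : N => TangentSpace (𝓡 n) p)}

/-- The right-hand side depends on the chart at `x₀` only through the vector. -/
lemma fderiv_localField_apply
    (hX : Continuous X)
    (hν : ContMDiff (𝓡 n) (𝓘(ℝ, ℝ).prod (𝓡 n)).tangent ∞
      (fun x => (⟨X x, ν x⟩ : TangentBundle (𝓘(ℝ, ℝ).prod (𝓡 n)) (ℝ × N))))
    (hy : y ∈ localDomain X x₀ p) (a : EuclideanSpace ℝ (Fin n)) :
    fderiv ℝ (localField X ν x₀ p) y a =
      fieldDeriv X ν p ((extChartAt (𝓡 n) x₀).symm y) (chartSymmDeriv (𝓡 n) x₀ y a) := by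
  have i2 : IsManifold (𝓡 n) 1 M := IsManifold.of_le (n := ∞) (by simp)
  have hmem : X ((extChartAt (𝓡 n) x₀).symm y) ∈
    (chartAt (ModelProd ℝ (EuclideanSpace ℝ (Fin n))) p).source := mapsTo_localDomain hy
  have hopen : IsOpen (X ⁻¹' (chartAt (ModelProd ℝ (EuclideanSpace ℝ (Fin n))) p).source) :=
    (chartAt _ p).open_source.preimage hX
  have h1 := ((contMDiffOn_chartDeriv (𝓘(ℝ, ℝ).prod (𝓡 n)) (𝓡 n) hν p).contMDiffAt
    (hopen.mem_nhds hmem)).mdifferentiableAt (by simp)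
  have h3 := mdifferentiableWithinAt_extChartAt_symm (I := 𝓡 n) hy.1
  rw [(𝓡 n).range_eq_univ, mdifferentiableWithinAt_univ] at h3
  have h4 : HasFDerivAt (localField X ν x₀ p) ((fieldDeriv X ν p
      ((extChartAt (𝓡 n) x₀).symm y)).comp (chartSymmDeriv (𝓡 n) x₀ y)) y :=
    (h1.hasMFDerivAt.comp y h3.hasMFDerivAt).hasFDerivAt
  rw [h4.fderiv]
  rfl

lemma christoffel_chartMetric_warpedMetric (p : ℝ × N) (a b : ℝ × EuclideanSpace ℝ (Fin n)) :
    christoffel (chartMetric (𝓘(ℝ, ℝ).prod (𝓡 n)) (warpedMetric lam g.inner) p)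
      (extChartAt (𝓘(ℝ, ℝ).prod (𝓡 n)) p p) a b =
    christoffel (warpedForm lam (chartMetric (𝓡 n) g.inner p.2))
      (extChartAt (𝓘(ℝ, ℝ).prod (𝓡 n)) p p) a b := by
  have h : chartMetric (𝓘(ℝ, ℝ).prod (𝓡 n)) (warpedMetric lam g.inner) p
      =ᶠ[𝓝 (extChartAt (𝓘(ℝ, ℝ).prod (𝓡 n)) p p)]
      warpedForm lam (chartMetric (𝓡 n) g.inner p.2) := by
    filter_upwards [extChartAt_target_mem_nhds (I := 𝓘(ℝ, ℝ).prod (𝓡 n)) p] with z hz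
    exact chartMetric_warpedMetric lam g.inner hz
  rw [christoffel, christoffel, h.fderiv_eq, h.eq_of_nhds]

/-- The covariant derivative of the normal field, in the chart of `M` at `x₀` and the chart of the
warped product at the image point. -/
lemma covD_localField (hX : ContMDiff (𝓡 n) (𝓘(ℝ, ℝ).prod (𝓡 n)) ∞ X)
    (hν : ContMDiff (𝓡 n) (𝓘(ℝ, ℝ).prod (𝓡 n)).tangent ∞
      (fun x => (⟨X x, ν x⟩ : TangentBundle (𝓘(ℝ, ℝ).prod (𝓡 n)) (ℝ × N))))
    (hy : y ∈ (extChartAt (𝓡 n) x₀).target) {x : M} (hx : (extChartAt (𝓡 n) x₀).symm y = x)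
    (a : EuclideanSpace ℝ (Fin n)) :
    covD (warpedForm lam (chartMetric (𝓡 n) g.inner (X x).2)) (localMap X x₀ (X x))
      (localField X ν x₀ (X x)) y a =
    covDerivAlong (𝓘(ℝ, ℝ).prod (𝓡 n)) (𝓡 n) (warpedMetric lam g.inner) X ν x
      (chartSymmDeriv (𝓡 n) x₀ y a) := by
  subst hx
  set x := (extChartAt (𝓡 n) x₀).symm y with hx
  have hself : (extChartAt (𝓡 n) x).symm (extChartAt (𝓡 n) x x) = x := extChartAt_to_inv x
  have hdom : extChartAt (𝓡 n) x x ∈ localDomain X x (X x) := by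
    refine ⟨mem_extChartAt_target x, ?_⟩
    rw [mem_preimage, hself]
    exact mem_extChartAt_source _
  have h1 : fderiv ℝ (localField X ν x₀ (X x)) y a =
      fderiv ℝ (chartField (𝓘(ℝ, ℝ).prod (𝓡 n)) (𝓡 n) X ν x) (extChartAt (𝓡 n) x x)
        (chartSymmDeriv (𝓡 n) x₀ y a) := by
    have e := fderiv_localField_apply hX.continuous hν hdom (chartSymmDeriv (𝓡 n) x₀ y a)
    rw [chartSymmDeriv_self, hself] at e
    exact (fderiv_localField_apply hX.continuous hν (self_mem_localDomain hy) a).trans e.symm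
  have h2 : fderiv ℝ (localMap X x₀ (X x)) y a =
      diffMap X x (chartSymmDeriv (𝓡 n) x₀ y a) := by
    rw [fderiv_localMap_apply hX (self_mem_localDomain hy), chartDeriv_self]
  have h3 : localField X ν x₀ (X x) y = ν x := 
    chartDeriv_self (𝓘(ℝ, ℝ).prod (𝓡 n)) (X x) _
  rw [covD_apply, christoffelL_apply, h1, h2, h3]
  exact congrArg _ (christoffel_chartMetric_warpedMetric (X x) _ _).symm

/-- The shape operator, in the chart of `M` at `x₀` and the chart of the warped product at the
image point. -/
lemma IsWarpedHypersurface.shapeOperator_chartSymmDeriv (h : IsWarpedHypersurface lam I g X ν)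
    (hy : y ∈ (extChartAt (𝓡 n) x₀).target) {x : M} (hx : (extChartAt (𝓡 n) x₀).symm y = x)
    (a : EuclideanSpace ℝ (Fin n)) :
    shapeOperator (𝓘(ℝ, ℝ).prod (𝓡 n)) (𝓡 n) (warpedMetric lam g.inner) X ν x
      (chartSymmDeriv (𝓡 n) x₀ y a) =
    chartSymmDeriv (𝓡 n) x₀ y (shape (warpedForm lam (chartMetric (𝓡 n) g.inner (X x).2))
      (localMap X x₀ (X x)) (localField X ν x₀ (X x)) y a) := by
  have hyd : y ∈ localDomain X x₀ (X x) := hx ▸ self_mem_localDomain hy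
  have hH := h.isHypersurface_localMap (x₀ := x₀) (p := X x)
  have hsurj : ∀ c, ∃ b, chartSymmDeriv (𝓡 n) x₀ y b = c := fun c =>
    ⟨_, chartSymmDeriv_chartDeriv (𝓡 n) hy c⟩
  have hind : ∀ b c, warpedMetric lam g.inner (X x) (diffMap X x (chartSymmDeriv (𝓡 n) x₀ y b))
      (diffMap X x (chartSymmDeriv (𝓡 n) x₀ y c)) =
      inducedMetric (warpedForm lam (chartMetric (𝓡 n) g.inner (X x).2))
        (localMap X x₀ (X x)) y b c := fun b c => by
    rw [inducedMetric_localMap h.contMDiff hyd, localMetric_apply, hx]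
  have hpos : ∀ c : EuclideanSpace ℝ (Fin n), c ≠ 0 →
      0 < pullbackForm (𝓘(ℝ, ℝ).prod (𝓡 n)) (warpedMetric lam g.inner (X x)) (diffMap X x) c c := by
    intro c hc
    obtain ⟨b, rfl⟩ := hsurj c
    have hb : b ≠ 0 := fun hb => hc (by rw [hb, map_zero])
    exact (hH.pos hyd b hb).trans_eq (hind b b).symm
  refine inverse_eq_of_pos hpos fun c => ?_
  obtain ⟨b, rfl⟩ := hsurj c
  refine (hind _ b).trans ?_
  rw [← hH.form_covD_normal hyd, covD_localField h.contMDiff h.contMDiff_normal hy hx,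
    fderiv_localMap_apply h.contMDiff hyd, localMap, hx, chartDeriv_self]
  have key : ∀ v w : ℝ × EuclideanSpace ℝ (Fin n),
      warpedForm lam (chartMetric (𝓡 n) g.inner (X x).2)
        (extChartAt (𝓘(ℝ, ℝ).prod (𝓡 n)) (X x) (X x)) v w =
      warpedMetric lam g.inner (X x) v w := fun v w => by
    have := warpedForm_chartDeriv lam g.inner (mem_extChartAt_source (X x)) v w
    rwa [chartDeriv_self, chartDeriv_self] at this
  exact key _ _

/-- The mean curvature in charts. -/
lemma IsWarpedHypersurface.traceShape_eq (h : IsWarpedHypersurface lam I g X ν) (hn : n ≠ 0)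
    (hy : y ∈ (extChartAt (𝓡 n) x₀).target) {x : M} (hx : (extChartAt (𝓡 n) x₀).symm y = x) :
    traceShape (warpedForm lam (chartMetric (𝓡 n) g.inner (X x).2))
      (localMap X x₀ (X x)) (localField X ν x₀ (X x)) y =
    n * meanCurvature n (𝓘(ℝ, ℝ).prod (𝓡 n)) (warpedMetric lam g.inner) X ν x := by
  set S := shape (warpedForm lam (chartMetric (𝓡 n) g.inner (X x).2))
      (localMap X x₀ (X x)) (localField X ν x₀ (X x)) y with hS
  set D := chartSymmDeriv (𝓡 n) x₀ y
  set D' := chartDeriv (𝓡 n) x₀ x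
  have hDD : ∀ c, D (D' c) = c := fun c => by
    have := chartSymmDeriv_chartDeriv (𝓡 n) hy c
    rwa [hx] at this
  have hDD' : ∀ c, D' (D c) = c := fun c => by
    have := chartDeriv_chartSymmDeriv (𝓡 n) hy c
    rwa [hx] at this
  have h1 : ∀ c, shapeOperator (𝓘(ℝ, ℝ).prod (𝓡 n)) (𝓡 n) (warpedMetric lam g.inner) X ν x c =
      D (S (D' c)) := fun c => by
    have := h.shapeOperator_chartSymmDeriv hy hx (D' c)
    rwa [hDD c] at this
  have h2 : LinearMap.trace ℝ _ (S : EuclideanSpace ℝ (Fin n) →ₗ[ℝ] EuclideanSpace ℝ (Fin n)) =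
      LinearMap.trace ℝ _ ((D : EuclideanSpace ℝ (Fin n) →ₗ[ℝ] EuclideanSpace ℝ (Fin n)) ∘ₗ
        ((S : EuclideanSpace ℝ (Fin n) →ₗ[ℝ] EuclideanSpace ℝ (Fin n)) ∘ₗ
        (D' : EuclideanSpace ℝ (Fin n) →ₗ[ℝ] EuclideanSpace ℝ (Fin n)))) := by
    rw [LinearMap.trace_comp_comm', LinearMap.comp_assoc]
    congr 1
    refine LinearMap.ext fun c => ?_
    simp [hDD']
  rw [traceShape, ← hS, h2, trace_eq_sum_single, meanCurvature, mul_div_cancel₀ _ (by simpa)]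
  refine Finset.sum_congr rfl fun i _ => ?_
  rw [h1]
  rfl

end MeanCurvature

/-! ### Closed hypersurfaces -/

section Closed

/-- A primitive of a continuous function on an interval. -/
lemma exists_hasDerivAt_of_continuousOn {I : Set ℝ} (hI : IsOpen I) (hc : I.OrdConnected)
    {f : ℝ → ℝ} (hf : ContinuousOn f I) : ∃ P : ℝ → ℝ, ∀ r ∈ I, HasDerivAt P (f r) r := by
  rcases I.eq_empty_or_nonempty with rfl | ⟨c, hcI⟩
  · exact ⟨0, fun r hr => hr.elim⟩
  · refine ⟨fun r => ∫ t in c..r, f t, fun r hr => ?_⟩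
    refine intervalIntegral.integral_hasDerivAt_right
      (hf.mono (hc.uIcc_subset hcI hr)).intervalIntegrable
      (hf.stronglyMeasurableAtFilter hI r hr) (hf.continuousAt (hI.mem_nhds hr))

variable {n : ℕ} {N : Type*} [TopologicalSpace N] [ChartedSpace (EuclideanSpace ℝ (Fin n)) N]
  {M : Type*} [TopologicalSpace M] [ChartedSpace (EuclideanSpace ℝ (Fin n)) M]

lemma eventually_of_eventually_extChartAt_symm {x : M} {q : M → Prop}
    (h : ∀ᶠ z in 𝓝 (extChartAt (𝓡 n) x x), q ((extChartAt (𝓡 n) x).symm z)) :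
    ∀ᶠ x' in 𝓝 x, q x' := by
  filter_upwards [(continuousAt_extChartAt (I := 𝓡 n) x).eventually h,
    extChartAt_source_mem_nhds (I := 𝓡 n) x] with x' h1 h2
  rwa [(extChartAt (𝓡 n) x).left_inv h2] at h1

/-- The support function `⟨λ ∂_r, ν⟩`. -/
def supportFunction (lam : ℝ → ℝ)
    (g : ∀ p : N, TangentSpace (𝓡 n) p →L[ℝ] TangentSpace (𝓡 n) p →L[ℝ] ℝ) (X : M → ℝ × N)
    (ν : ∀ x : M, TangentSpace (𝓘(ℝ, ℝ).prod (𝓡 n)) (X x)) (x : M) : ℝ :=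
  warpedMetric lam g (X x) (radialField lam (X x)) (ν x)

variable [IsManifold (𝓡 n) ∞ N] [IsManifold (𝓡 n) ∞ M]

/-- The hypersurface satisfies `H = u ^ (-p)`, where `u > 0` is the support function, in a warped
product with the lower Ricci bound. -/
structure IsSelfSimilar (lam : ℝ → ℝ) (I : Set ℝ) (p : ℝ)
    (g : Bundle.ContMDiffRiemannianMetric (𝓡 n) ∞ (EuclideanSpace ℝ (Fin n))
      (fun p : N => TangentSpace (𝓡 n) p)) (X : M → ℝ × N)
    (ν : ∀ x : M, TangentSpace (𝓘(ℝ, ℝ).prod (𝓡 n)) (X x)) : Prop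
    extends IsWarpedHypersurface lam I g X ν where
  support_pos : ∀ x, 0 < supportFunction lam g.inner X ν x
  meanCurvature_eq : ∀ x, meanCurvature n (𝓘(ℝ, ℝ).prod (𝓡 n)) (warpedMetric lam g.inner) X ν x =
    supportFunction lam g.inner X ν x ^ (-p)
  ricci_le : ∀ r ∈ I, ∀ (q : N) (v : TangentSpace (𝓡 n) q),
    ((n : ℝ) - 1) * (deriv lam r ^ 2 - lam r * deriv (deriv lam) r) * g.inner q v v ≤
      ricci g.inner q v v

variable {X : M → ℝ × N} {ν : ∀ x : M, TangentSpace (𝓘(ℝ, ℝ).prod (𝓡 n)) (X x)}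
  {lam P : ℝ → ℝ} {I : Set ℝ} {p : ℝ}
  {g : Bundle.ContMDiffRiemannianMetric (𝓡 n) ∞ (EuclideanSpace ℝ (Fin n))
      (fun p : N => TangentSpace (𝓡 n) p)}

lemma chartMetric_self (q : N) (c : EuclideanSpace ℝ (Fin n)) :
    chartMetric (𝓡 n) g.inner q (extChartAt (𝓡 n) q q) c c = g.inner q c c := by
  have := chartMetric_chartDeriv (𝓡 n) g.inner (mem_extChartAt_source q) c c
  rwa [chartDeriv_self] at this

namespace IsSelfSimilar

lemma isSelfSimilarOn (h : IsSelfSimilar lam I p g X ν) (hn : n ≠ 0) (x₀ : M) :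
    IsSelfSimilarOn lam I p (localMetric lam g.inner X x₀)
      (fun y => (X ((extChartAt (𝓡 n) x₀).symm y)).1)
      (fun y => supportFunction lam g.inner X ν ((extChartAt (𝓡 n) x₀).symm y))
      (extChartAt (𝓡 n) x₀).target where
  isOpen := isOpen_extChartAt_target x₀
  pos y _ := h.support_pos _
  model y hy := by
    set x := (extChartAt (𝓡 n) x₀).symm y with hx
    refine ⟨chartMetric (𝓡 n) g.inner (X x).2, (extChartAt (𝓡 n) (X x).2).target,
      localMap X x₀ (X x), localField X ν x₀ (X x), localDomain X x₀ (X x),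
      self_mem_localDomain hy, isMetricOn_chartMetric (𝓡 n) g _,
      h.isHypersurface_localMap, fun z hz => inducedMetric_localMap h.contMDiff hz,
      fun z _ => ?_, fun z hz => warpedForm_localField hz, ?_, fun c => ?_⟩
    · rw [localMap, extChartAt_warped_apply]
    · rw [h.traceShape_eq hn hy hx.symm, h.meanCurvature_eq]
    · have hF : localMap X x₀ (X x) y = ((X x).1, extChartAt (𝓡 n) (X x).2 (X x).2) := by
        rw [localMap, extChartAt_warped_apply]
      rw [hF, chartMetric_self]
      exact h.ricci_le _ (h.mem x) (X x).2 c

end IsSelfSimilar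

end Closed

section Closed

variable {n : ℕ} {N : Type*} [TopologicalSpace N] [ChartedSpace (EuclideanSpace ℝ (Fin n)) N]
  {M : Type*} [TopologicalSpace M] [ChartedSpace (EuclideanSpace ℝ (Fin n)) M]
  [IsManifold (𝓡 n) ∞ N] [IsManifold (𝓡 n) ∞ M]
  {X : M → ℝ × N} {ν : ∀ x : M, TangentSpace (𝓘(ℝ, ℝ).prod (𝓡 n)) (X x)}
  {lam P : ℝ → ℝ} {I : Set ℝ} {p : ℝ}
  {g : Bundle.ContMDiffRiemannianMetric (𝓡 n) ∞ (EuclideanSpace ℝ (Fin n))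
      (fun p : N => TangentSpace (𝓡 n) p)}

namespace IsSelfSimilar

/-- On a compact connected hypersurface, the function to which the maximum principle applies is
constant. -/
lemma exists_eq_const [CompactSpace M] [ConnectedSpace M] (h : IsSelfSimilar lam I p g X ν)
    (hn : 0 < n) (hp : 0 < p) (hP : ∀ r ∈ I, HasDerivAt P (lam r) r) :
    ∃ m, ∀ x, supportFunction lam g.inner X ν x ^ (p + 1) / (p + 1) - P (X x).1 = m := by
  set f : M → ℝ := fun x =>
    supportFunction lam g.inner X ν x ^ (p + 1) / (p + 1) - P (X x).1 with hf
  have hcont : Continuous f := continuous_iff_continuousAt.2 fun x => by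
    have h1 := ((h.isSelfSimilarOn hn.ne' x).contDiffAt_fun h.warping hP
      (mem_extChartAt_target x)).continuousAt
    refine (h1.comp (continuousAt_extChartAt (I := 𝓡 n) x)).congr ?_
    filter_upwards [extChartAt_source_mem_nhds (I := 𝓡 n) x] with x' hx'
    simp only [hf, Function.comp_apply, (extChartAt (𝓡 n) x).left_inv hx']
  obtain ⟨x₁, -, hx₁⟩ := isCompact_univ.exists_isMinOn univ_nonempty hcont.continuousOn
  have hmin : ∀ x, f x₁ ≤ f x := fun x => hx₁ (mem_univ x)
  have hopen : IsOpen {x | f x = f x₁} := isOpen_iff_mem_nhds.2 fun x hx => by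
    refine eventually_of_eventually_extChartAt_symm (n := n) (q := fun x' => f x' = f x₁) ?_
    have hx0 : f ((extChartAt (𝓡 n) x).symm (extChartAt (𝓡 n) x x)) = f x₁ := by
      rw [extChartAt_to_inv]; exact hx
    have h2 := (h.isSelfSimilarOn hn.ne' x).eventually_eq hn hp h.warping hP
      (mem_extChartAt_target x) (fun z _ => hx0.le.trans (hmin _))
    filter_upwards [h2] with z hz using hz.trans hx0
  have huniv := IsClopen.eq_univ ⟨isClosed_eq hcont continuous_const, hopen⟩ ⟨x₁, rfl⟩
  exact ⟨f x₁, fun x => (huniv ▸ mem_univ x : x ∈ {x | f x = f x₁})⟩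

/-- The radial coordinate is constant on a compact connected hypersurface. -/
lemma exists_radial_eq [CompactSpace M] [ConnectedSpace M] (h : IsSelfSimilar lam I p g X ν)
    (hn : 2 ≤ n) (hp : 0 < p) (hI : I.OrdConnected) : ∃ r₀ ∈ I, ∀ x, (X x).1 = r₀ := by
  obtain ⟨P, hP⟩ := exists_hasDerivAt_of_continuousOn h.warping.isOpen hI
    h.warping.contDiffOn.continuousOn
  obtain ⟨m, hm⟩ := h.exists_eq_const (by omega) hp hP
  have hloc : IsLocallyConstant fun x => (X x).1 := by
    refine (IsLocallyConstant.iff_eventually_eq _).2 fun x => ?_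
    refine eventually_of_eventually_extChartAt_symm (n := n) (q := fun x' => (X x').1 = (X x).1) ?_
    have hS := h.isSelfSimilarOn (by omega) x
    obtain ⟨ε, hε, hball⟩ := Metric.isOpen_iff.1 (isOpen_extChartAt_target (I := 𝓡 n) x) _
      (mem_extChartAt_target x)
    have hd : DifferentiableOn ℝ (fun y => (X ((extChartAt (𝓡 n) x).symm y)).1)
        (Metric.ball (extChartAt (𝓡 n) x x) ε) := fun y hy => by
      obtain ⟨G, V, F, η, U, hmod⟩ := hS.model y (hball hy)
      exact (hmod.contDiffAt_radial.differentiableAt (by simp)).differentiableWithinAt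
    have hz : EqOn (fderiv ℝ (fun y => (X ((extChartAt (𝓡 n) x).symm y)).1)) 0
        (Metric.ball (extChartAt (𝓡 n) x x) ε) := fun y hy =>
      hS.fderiv_radial_eq_zero hn hp h.warping hP (hball hy)
        (Eventually.of_forall fun z => (hm _).trans (hm _).symm)
    filter_upwards [Metric.ball_mem_nhds _ hε] with y hy
    have := Metric.isOpen_ball.is_const_of_fderiv_eq_zero
      (convex_ball _ _).isPreconnected hd hz hy (Metric.mem_ball_self hε)
    simpa only [extChartAt_to_inv] using this
  obtain ⟨x₁⟩ := (inferInstance : Nonempty M)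
  exact ⟨(X x₁).1, h.mem x₁, fun x => hloc.apply_eq_of_preconnectedSpace x x₁⟩

end IsSelfSimilar

/-- A hypersurface contained in a slice is locally diffeomorphic to the slice. -/
lemma IsWarpedHypersurface.isOpenMap_snd (h : IsWarpedHypersurface lam I g X ν) {r₀ : ℝ}
    (hr : ∀ x, (X x).1 = r₀) : IsOpenMap fun x => (X x).2 := by
  refine isOpenMap_iff_nhds_le.2 fun x => ?_
  set C := extChartAt (𝓡 n) (X x).2 with hC
  set ψ := extChartAt (𝓡 n) x with hψ
  have hself : ψ.symm (ψ x) = x := extChartAt_to_inv x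
  have hdom : ψ x ∈ localDomain (n := n) X x (X x) := by
    refine ⟨mem_extChartAt_target x, ?_⟩
    rw [mem_preimage, hself]
    exact mem_extChartAt_source _
  have hH := h.isHypersurface_localMap (x₀ := x) (p := X x)
  have hF := hH.contDiffAt hdom
  set F := localMap (n := n) X x (X x) with hFdef
  -- as the radial component is constant, the injective derivative of `F` has values in `0 × E`
  have hF1 : ∀ z, F z = (r₀, C (X (ψ.symm z)).2) := fun z => by
    rw [hFdef, localMap, extChartAt_warped_apply, hr]
  have hfst : ∀ a, (fderiv ℝ F (ψ x) a).1 = 0 := fun a => by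
    have h1 : HasFDerivAt (fun z => (F z).1)
        ((ContinuousLinearMap.fst ℝ ℝ (EuclideanSpace ℝ (Fin n))).comp (fderiv ℝ F (ψ x))) (ψ x) :=
      (ContinuousLinearMap.fst ℝ ℝ (EuclideanSpace ℝ (Fin n))).hasFDerivAt.comp _
        (hF.differentiableAt (by simp)).hasFDerivAt
    have h2 : (fun z => (F z).1) = fun _ => r₀ := funext fun z => by rw [hF1]
    rw [h2] at h1
    exact DFunLike.congr_fun (h1.unique (hasFDerivAt_const r₀ (ψ x))) a
  have hstrict : HasStrictFDerivAt (fun z => (F z).2)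
      ((ContinuousLinearMap.snd ℝ ℝ (EuclideanSpace ℝ (Fin n))).comp (fderiv ℝ F (ψ x))) (ψ x) :=
    (ContinuousLinearMap.snd ℝ ℝ (EuclideanSpace ℝ (Fin n))).hasStrictFDerivAt.comp _
      (hF.hasStrictFDerivAt (by simp))
  have hinj : Function.Injective
      ((ContinuousLinearMap.snd ℝ ℝ (EuclideanSpace ℝ (Fin n))).comp (fderiv ℝ F (ψ x))) := by
    intro a b hab
    exact hH.injective _ hdom (Prod.ext ((hfst a).trans (hfst b).symm) hab)
  have hsurj : ((ContinuousLinearMap.snd ℝ ℝ (EuclideanSpace ℝ (Fin n))).comp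
      (fderiv ℝ F (ψ x))).range = ⊤ :=
    LinearMap.range_eq_top.2 (LinearMap.injective_iff_surjective.1 hinj)
  have hmap := hstrict.map_nhds_eq_of_surj hsurj
  have hF2 : (F (ψ x)).2 = C (X x).2 := by rw [hF1, hself]
  rw [hF2] at hmap
  intro s hs
  have hs' : (fun x => (X x).2) ⁻¹' s ∈ 𝓝 x := hs
  have h1 : ∀ᶠ z in 𝓝 (ψ x), (X (ψ.symm z)).2 ∈ s ∩ C.source := by
    have e1 : ∀ᶠ x' in 𝓝 (ψ.symm (ψ x)), (X x').2 ∈ s ∩ C.source := by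
      rw [hself]
      exact (show ∀ᶠ x' in 𝓝 x, (X x').2 ∈ s from hs').and
        ((continuous_snd.comp h.contMDiff.continuous).continuousAt.eventually
          (extChartAt_source_mem_nhds (I := 𝓡 n) (X x).2))
    exact (continuousAt_extChartAt_symm (I := 𝓡 n) x).eventually e1
  -- the projection to `N` is open at `x` in the charts; the image is pulled back by the chart `C`
  have h2 : C '' (s ∩ C.source) ∈ 𝓝 (C (X x).2) := by
    rw [← hmap]
    exact h1.mono fun z hz => ⟨_, hz, (congrArg Prod.snd (hF1 z)).symm⟩
  filter_upwards [(continuousAt_extChartAt (I := 𝓡 n) (X x).2).eventually h2,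
    extChartAt_source_mem_nhds (I := 𝓡 n) (X x).2] with q hq hq'
  obtain ⟨q', ⟨hq's, hq'C⟩, he⟩ := hq
  rwa [← C.injOn hq'C hq' he]

/-- A closed hypersurface on which the radial coordinate is constant is a slice, since its
projection to the connected manifold `N` is open and closed. -/
lemma IsWarpedHypersurface.range_eq_of_radial_eq [CompactSpace M] [Nonempty M] [T2Space N]
    [PreconnectedSpace N] (h : IsWarpedHypersurface lam I g X ν) {r₀ : ℝ}
    (hr : ∀ x, (X x).1 = r₀) : range X = {r₀} ×ˢ (univ : Set N) := by
  have hopen := h.isOpenMap_snd hr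
  have hcont : Continuous fun x => (X x).2 := continuous_snd.comp h.contMDiff.continuous
  have hrange : range (fun x => (X x).2) = univ :=
    IsClopen.eq_univ ⟨(isCompact_range hcont).isClosed, hopen.isOpen_range⟩ (range_nonempty _)
  ext ⟨r, q⟩
  constructor
  · rintro ⟨x, hx⟩
    exact ⟨(congrArg Prod.fst hx).symm.trans (hr x), mem_univ _⟩
  · rintro ⟨hr', -⟩
    obtain ⟨x, hx⟩ : q ∈ range fun x => (X x).2 := hrange ▸ mem_univ q
    exact ⟨x, Prod.ext ((hr x).trans hr'.symm) hx⟩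

end Closed

end WarpedProduct

end

theorem mainTheorem2 (n : ℕ) (hn : 2 ≤ n)
    {N : Type*} [TopologicalSpace N] [T2Space N] [CompactSpace N] [ConnectedSpace N]
    [ChartedSpace (EuclideanSpace ℝ (Fin n)) N] [IsManifold (𝓡 n) ∞ N]
    (gN : Bundle.ContMDiffRiemannianMetric (𝓡 n) ∞ (EuclideanSpace ℝ (Fin n))
      (fun p : N => TangentSpace (𝓡 n) p))
    (rbar : EReal) (lam : ℝ → ℝ)
    (hlam : ContDiffOn ℝ ∞ lam {r : ℝ | 0 < r ∧ (r : EReal) < rbar})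
    (hlam_pos : ∀ r : ℝ, 0 < r → (r : EReal) < rbar → 0 < lam r)
    (hRic : ∀ r : ℝ, 0 < r → (r : EReal) < rbar →
      ∀ (p : N) (v : TangentSpace (𝓡 n) p),
        ((n : ℝ) - 1) * (deriv lam r ^ 2 - lam r * deriv (deriv lam) r) * gN.inner p v v
          ≤ WarpedProduct.ricci gN.inner p v v)
    {M : Type*} [TopologicalSpace M] [T2Space M] [CompactSpace M] [ConnectedSpace M]
    [ChartedSpace (EuclideanSpace ℝ (Fin n)) M] [IsManifold (𝓡 n) ∞ M]
    (X : M → ℝ × N)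
    (hX_mem : ∀ x : M, 0 < (X x).1 ∧ ((X x).1 : EReal) < rbar)
    (hX : ContMDiff (𝓡 n) (𝓘(ℝ, ℝ).prod (𝓡 n)) ∞ X)
    (hX_imm : ∀ x : M, Function.Injective (mfderiv (𝓡 n) (𝓘(ℝ, ℝ).prod (𝓡 n)) X x))
    (ν : ∀ x : M, TangentSpace (𝓘(ℝ, ℝ).prod (𝓡 n)) (X x))
    (hν : ContMDiff (𝓡 n) (𝓘(ℝ, ℝ).prod (𝓡 n)).tangent ∞
      (fun x => (⟨X x, ν x⟩ : TangentBundle (𝓘(ℝ, ℝ).prod (𝓡 n)) (ℝ × N))))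
    (hν_unit : ∀ x : M, WarpedProduct.warpedMetric lam gN.inner (X x) (ν x) (ν x) = 1)
    (hν_normal : ∀ (x : M) (v : TangentSpace (𝓡 n) x),
      WarpedProduct.warpedMetric lam gN.inner (X x) (ν x)
        (mfderiv (𝓡 n) (𝓘(ℝ, ℝ).prod (𝓡 n)) X x v) = 0)
    (α : ℝ) (hα : 0 < α)
    (hH_pos : ∀ x : M, 0 < WarpedProduct.meanCurvature n (𝓘(ℝ, ℝ).prod (𝓡 n))
      (WarpedProduct.warpedMetric lam gN.inner) X ν x)
    (hH_eq : ∀ x : M, WarpedProduct.meanCurvature n (𝓘(ℝ, ℝ).prod (𝓡 n))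
        (WarpedProduct.warpedMetric lam gN.inner) X ν x ^ (-α)
      = WarpedProduct.warpedMetric lam gN.inner (X x)
          (WarpedProduct.radialField lam (X x)) (ν x)) :
    ∃ r₀ : ℝ, 0 < r₀ ∧ (r₀ : EReal) < rbar ∧ Set.range X = {r₀} ×ˢ (Set.univ : Set N) := by
  have hopen : IsOpen {r : ℝ | 0 < r ∧ (r : EReal) < rbar} :=
    isOpen_Ioi.inter (isOpen_Iio.preimage continuous_coe_real_ereal)
  have hconn : {r : ℝ | 0 < r ∧ (r : EReal) < rbar}.OrdConnected :=
    ⟨fun a ha b hb c hc => ⟨ha.1.trans_le hc.1, (EReal.coe_le_coe_iff.2 hc.2).trans_lt hb.2⟩⟩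
  have h : WarpedProduct.IsSelfSimilar lam {r : ℝ | 0 < r ∧ (r : EReal) < rbar} (1 / α) gN X ν :=
    { warping := ⟨hopen, hlam, fun r hr => hlam_pos r hr.1 hr.2⟩
      mem := hX_mem
      contMDiff := hX
      injective := hX_imm
      contMDiff_normal := hν
      unit := hν_unit
      normal := hν_normal
      support_pos := fun x => (Real.rpow_pos_of_pos (hH_pos x) _).trans_eq (hH_eq x)
      meanCurvature_eq := fun x => by
        rw [WarpedProduct.supportFunction, ← hH_eq x, ← Real.rpow_mul (hH_pos x).le]
        -- `u = H ^ (-α)` is solved for `H`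
        have : -α * -(1 / α) = 1 := by field_simp
        rw [this, Real.rpow_one]
      ricci_le := fun r hr => hRic r hr.1 hr.2 }
  obtain ⟨r₀, hr₀, hr⟩ := h.exists_radial_eq hn (by positivity) hconn
  exact ⟨r₀, hr₀.1, hr₀.2, h.range_eq_of_radial_eq hr⟩
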